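/- Conventions. Manifolds are smooth, finite-dimensional, Hausdorff and second countable. A contact form $\eta$ on a connected manifold $M$ of dimension $2n+1$ is a nowhere vanishing 1-form with $d\eta$ nondegenerate on $\ker\eta$; its Reeb vector field $\mathcal R$ is defined by $i_{\mathcal R}\eta=1$, $i_{\mathcal R}d\eta=0$. We call $(M,\eta)$ a principal contactification of a symplectic manifold $(N,\omega)$, with minimal period $\rho\in(0,+\infty]$, if $\mathcal R$ is complete, its flow induces a free action of $\mathbb R/\rho\mathbb Z$ (of $\mathbb R$ if $\rho=+\infty$), and there is a surjective submersion $p:M\to N$ whose fibres are the orbits, so that $p$ is a principal bundle, with $p^*\omega=d\eta$. Its prequantum line bundle $\mathbb L\to N$ is the complex line bundle whose smooth sections are the smooth functions $F:M\to\mathbb C$ with $F(\exp(t\mathcal R)(y))=e^{-2\pi it/\rho}F(y)$ (where $e^{-2\pi it/\rho}=1$ if $\rho=+\infty$), with the Hermitian metric $\langle F,G\rangle=F\,\overline G$ and the linear connection $D_XF=X^h(F)$, where $X^h$ is the lift of the vector field $X$ to $M$ with $\eta(X^h)=0$. Theorem. For $j=1,2$ let $(M_j,\eta_j)$ be a principal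 contactification of a symplectic manifold $(N_j,\omega_j)$, with projection $p_j$ and Reeb vector field $\mathcal R_j$, both with the same minimal period $\rho\in(0,+\infty]$. Then the quotient $$M=(M_1\times M_2)/(\mathcal R_1-\mathcal R_2)$$ of $M_1\times M_2$ by the flow of $\mathcal R_1-\mathcal R_2$ is a connected manifold of dimension $\dim M_1+\dim M_2-1$ onto which the canonical projection is a submersion. The 1-form $\eta_1\oplus\eta_2$ descends to a contact form $\eta$ on $M$, and $(M,\eta)$, with the projection $[(y_1,y_2)]\mapsto(p_1(y_1),p_2(y_2))$, is a principal contactification of $(N_1\times N_2,\omega_1\oplus\omega_2)$ with minimal period $\rho$. The prequantum line bundle $\mathbb L$ of $(M,\eta)$ is a Hermitian line bundle with connection, and the products $(F_1\otimes F_2)([(y_1,y_2)])=F_1(y_1)F_2(y_2)$ of equivariant functions induce an isomorphism of line bundles over $N_1\times N_2$ between the tensor product $\mathbb L_1\otimes\mathbb L_2$, with fibre $(\mathbb L_1)_{x_1}\otimes(\mathbb L_2)_{x_2}$ over $(x_1,x_2)$, and $\mathbb L$. Under this isomorphism the metric of $\mathbb L$ is the product metric $$\langle\psi_1\otimes\psi_2,\psi_1'\otimes\psi_2'\rangle=\langle\psi_1,\psi_1'\rangle\cdot\langle\psi_2,\psi_2'\rangle,$$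 and the connection of $\mathbb L$ is the product connection $$D_{X_1\oplus X_2}(\psi_1\otimes\psi_2)=D^1_{X_1}\psi_1\otimes\psi_2+\psi_1\otimes D^2_{X_2}\psi_2.$$ -/

import Mathlib

open Bundle Set Function
open scoped Manifold ContDiff Topology TensorProduct

namespace Prequantization

/-! ### Differential forms of degree one and two, vector fields and flows -/

section Forms

variable {E : Type*} [NormedAddCommGroup E] [NormedSpace ℝ E]
  {H : Type*} [TopologicalSpace H] (I : ModelWithCorners ℝ E H)
  {M : Type*} [TopologicalSpace M] [ChartedSpace H M]
  {E' : Type*} [NormedAddCommGroup E'] [NormedSpace ℝ E']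
  {H' : Type*} [TopologicalSpace H'] (J : ModelWithCorners ℝ E' H')
  {N : Type*} [TopologicalSpace N] [ChartedSpace H' N]

/-- A vector field, not necessarily continuous. -/
abbrev VField (M : Type*) [TopologicalSpace M] [ChartedSpace H M] : Type _ :=
  Π x : M, TangentSpace I x

/-- A field of covectors, not necessarily continuous. -/
abbrev OneForm (M : Type*) [TopologicalSpace M] [ChartedSpace H M] : Type _ :=
  Π x : M, TangentSpace I x →L[ℝ] ℝ

/-- A field of bilinear forms on the tangent spaces; alternation and smoothness are imposed
separately. -/
abbrev TwoForm (M : Type*) [TopologicalSpace M] [ChartedSpace H M] : Type _ :=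
  Π x : M, TangentSpace I x →L[ℝ] TangentSpace I x →L[ℝ] ℝ

/-- The vector field `X` is smooth on `U`. -/
def SmoothVFieldOn [IsManifold I ∞ M] (X : VField I M) (U : Set M) : Prop :=
  ContMDiffOn I I.tangent ∞ (fun x ↦ (TotalSpace.mk' E x (X x) : TangentBundle I M)) U

/-- Smoothness of a 1-form, as a section of the cotangent bundle. -/
def SmoothOneForm [IsManifold I ∞ M] (η : OneForm I M) : Prop :=
  ContMDiff I (I.prod 𝓘(ℝ, E →L[ℝ] ℝ)) ∞
    (fun x ↦ TotalSpace.mk' (E →L[ℝ] ℝ)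
      (E := fun x : M ↦ TangentSpace I x →L[ℝ] Trivial M ℝ x) x (η x))

/-- Smoothness of a 2-form, as a section of the bundle of bilinear forms. -/
def SmoothTwoForm [IsManifold I ∞ M] (Ω : TwoForm I M) : Prop :=
  ContMDiff I (I.prod 𝓘(ℝ, E →L[ℝ] E →L[ℝ] ℝ)) ∞
    (fun x ↦ TotalSpace.mk' (E →L[ℝ] E →L[ℝ] ℝ)
      (E := fun x : M ↦ TangentSpace I x →L[ℝ] TangentSpace I x →L[ℝ] Trivial M ℝ x) x (Ω x))

variable {J} in
/-- Pullback of a 1-form. -/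
noncomputable def pullback₁ (f : M → N) (η : OneForm J N) : OneForm I M :=
  fun x ↦ (η (f x)).comp (mfderiv I J f x)

variable {J} in
/-- Pullback of a 2-form. -/
noncomputable def pullback₂ (f : M → N) (Ω : TwoForm J N) : TwoForm I M :=
  fun x ↦ (ContinuousLinearMap.precomp ℝ (mfderiv I J f x)).comp
    ((Ω (f x)).comp (mfderiv I J f x))

variable {I J} in
theorem pullback₂_apply (f : M → N) (Ω : TwoForm J N) (x : M) (u v : TangentSpace I x) :
    pullback₂ I f Ω x u v = Ω (f x) (mfderiv I J f x u) (mfderiv I J f x v) := rfl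

/-- The 1-form `η` read in the preferred chart at `x₀`, as a map on the model space. -/
noncomputable def oneFormInChart (η : OneForm I M) (x₀ : M) : E → E →L[ℝ] ℝ := fun e ↦
  (η ((extChartAt I x₀).symm e)).comp
    (mfderivWithin 𝓘(ℝ, E) I (extChartAt I x₀).symm (range I) e)

/-- The 2-form `Ω` read in the preferred chart at `x₀`, as a map on the model space. -/
noncomputable def twoFormInChart (Ω : TwoForm I M) (x₀ : M) : E → E →L[ℝ] E →L[ℝ] ℝ := fun e ↦
  (ContinuousLinearMap.precomp ℝ
      (mfderivWithin 𝓘(ℝ, E) I (extChartAt I x₀).symm (range I) e)).comp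
    ((Ω ((extChartAt I x₀).symm e)).comp
      (mfderivWithin 𝓘(ℝ, E) I (extChartAt I x₀).symm (range I) e))

/-- The exterior derivative of a 1-form, `dη(u, v) = D_u η(v) - D_v η(u)` in a chart. -/
noncomputable def extDeriv₁ (η : OneForm I M) (x : M) (u v : TangentSpace I x) : ℝ :=
  fderivWithin ℝ (oneFormInChart I η x) (range I) (extChartAt I x x)
      (mfderiv I 𝓘(ℝ, E) (extChartAt I x) x u) (mfderiv I 𝓘(ℝ, E) (extChartAt I x) x v)
    - fderivWithin ℝ (oneFormInChart I η x) (range I) (extChartAt I x x)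
      (mfderiv I 𝓘(ℝ, E) (extChartAt I x) x v) (mfderiv I 𝓘(ℝ, E) (extChartAt I x) x u)

/-- The exterior derivative of a 2-form,
`dΩ(u, v, w) = D_u Ω(v, w) + D_v Ω(w, u) + D_w Ω(u, v)` in a chart. -/
noncomputable def extDeriv₂ (Ω : TwoForm I M) (x : M) (u v w : TangentSpace I x) : ℝ :=
  let D := fderivWithin ℝ (twoFormInChart I Ω x) (range I) (extChartAt I x x)
  let A := mfderiv I 𝓘(ℝ, E) (extChartAt I x) x
  D (A u) (A v) (A w) + D (A v) (A w) (A u) + D (A w) (A u) (A v)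

/-- A symplectic form: a smooth closed nondegenerate 2-form. -/
structure IsSymplecticForm [IsManifold I ∞ M] (Ω : TwoForm I M) : Prop where
  smooth : SmoothTwoForm I Ω
  alternating : ∀ x (v : TangentSpace I x), Ω x v v = 0
  nondegenerate : ∀ x (v : TangentSpace I x), (∀ w, Ω x v w = 0) → v = 0
  closed : ∀ x (u v w : TangentSpace I x), extDeriv₂ I Ω x u v w = 0

/-- A contact form: a smooth nowhere vanishing 1-form `η` such that `dη` is nondegenerate on
the field of hyperplanes `ker η`. -/
structure IsContactForm [IsManifold I ∞ M] (η : OneForm I M) : Prop where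
  smooth : SmoothOneForm I η
  ne_zero : ∀ x, η x ≠ 0
  nondegenerate : ∀ x (v : TangentSpace I x), η x v = 0 →
    (∀ w : TangentSpace I x, η x w = 0 → extDeriv₁ I η x v w = 0) → v = 0

/-- `R` is the Reeb vector field of `η`. -/
structure IsReebField (η : OneForm I M) (R : VField I M) : Prop where
  apply_one : ∀ x, η x (R x) = 1
  extDeriv_zero : ∀ x (v : TangentSpace I x), extDeriv₁ I η x (R x) v = 0

/-- The one-parameter group `φ` is smooth and is the (complete) flow of the vector field `X`. -/
structure IsFlowOf (X : VField I M) (φ : Flow ℝ M) : Prop where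
  smooth : ContMDiff (𝓘(ℝ, ℝ).prod I) I ∞ (fun q : ℝ × M ↦ φ q.1 q.2)
  integralCurve : ∀ y, IsMIntegralCurve (I := I) (fun t ↦ φ t y) X

/-- A smooth map with surjective differentials. -/
structure IsSmoothSubmersion (f : M → N) : Prop where
  smooth : ContMDiff I J ∞ f
  surjective_mfderiv : ∀ x, Surjective (mfderiv I J f x)

variable {I J} in
/-- The vector field `X₁ ⊕ X₂` on a product of manifolds. -/
def prodVField (X₁ : VField I M) (X₂ : VField J N) : VField (I.prod J) (M × N) :=
  fun x ↦ (X₁ x.1, X₂ x.2)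

variable {I J} in
/-- The 1-form `η₁ ⊕ η₂` on a product of manifolds. -/
noncomputable def prodOneForm (η₁ : OneForm I M) (η₂ : OneForm J N) : OneForm (I.prod J) (M × N) :=
  pullback₁ (I.prod J) Prod.fst η₁ + pullback₁ (I.prod J) Prod.snd η₂

variable {I J} in
/-- The 2-form `Ω₁ ⊕ Ω₂` on a product of manifolds. -/
noncomputable def prodTwoForm (Ω₁ : TwoForm I M) (Ω₂ : TwoForm J N) : TwoForm (I.prod J) (M × N) :=
  pullback₂ (I.prod J) Prod.fst Ω₁ + pullback₂ (I.prod J) Prod.snd Ω₂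

end Forms

/-! ### The quotient by the flow of the difference of two vector fields -/

section Quotients

/-- The orbit equivalence relation of a flow. -/
def orbitSetoid {M : Type*} [TopologicalSpace M] (φ : Flow ℝ M) : Setoid M where
  r y y' := ∃ t, φ t y = y'
  iseqv :=
    { refl := fun y ↦ ⟨0, φ.map_zero_apply y⟩
      symm := by
        rintro y _ ⟨t, rfl⟩
        exact ⟨-t, by rw [← φ.map_add, neg_add_cancel, φ.map_zero_apply]⟩
      trans := by
        rintro y _ _ ⟨t, rfl⟩ ⟨s, rfl⟩
        exact ⟨s + t, φ.map_add s t y⟩ }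

variable {M₁ M₂ : Type*} [TopologicalSpace M₁] [TopologicalSpace M₂]

/-- The flow `(y₁, y₂) ↦ (φ₁ t y₁, φ₂ (-t) y₂)`: if `φ₁`, `φ₂` are the flows of `R₁`, `R₂`, this
is the flow of `R₁ - R₂` on the product (see `isFlowOf_differenceFlow`). -/
def differenceFlow (φ₁ : Flow ℝ M₁) (φ₂ : Flow ℝ M₂) : Flow ℝ (M₁ × M₂) where
  toFun t y := (φ₁ t y.1, φ₂ (-t) y.2)
  cont' := by
    have h₁ : Continuous fun q : ℝ × M₁ × M₂ ↦ φ₁ q.1 q.2.1 :=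
      φ₁.continuous continuous_fst (continuous_fst.comp continuous_snd)
    have h₂ : Continuous fun q : ℝ × M₁ × M₂ ↦ φ₂ (-q.1) q.2.2 :=
      φ₂.continuous continuous_fst.neg (continuous_snd.comp continuous_snd)
    exact h₁.prodMk h₂
  map_add' t s y := by
    ext
    · exact φ₁.map_add t s y.1
    · show φ₂ (-(t + s)) y.2 = φ₂ (-t) (φ₂ (-s) y.2)
      rw [neg_add, φ₂.map_add]
  map_zero' y := by
    ext
    · exact φ₁.map_zero_apply y.1
    · show φ₂ (-0) y.2 = y.2
      rw [neg_zero, φ₂.map_zero_apply]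

/-- The quotient `(M₁ × M₂) / (R₁ - R₂)`, with the quotient topology. -/
abbrev ReducedProduct (φ₁ : Flow ℝ M₁) (φ₂ : Flow ℝ M₂) : Type _ :=
  Quotient (orbitSetoid (differenceFlow φ₁ φ₂))

/-- The canonical projection `M₁ × M₂ → (M₁ × M₂) / (R₁ - R₂)`. -/
def ReducedProduct.mk (φ₁ : Flow ℝ M₁) (φ₂ : Flow ℝ M₂) : M₁ × M₂ → ReducedProduct φ₁ φ₂ :=
  Quotient.mk (orbitSetoid (differenceFlow φ₁ φ₂))

variable {E : Type*} [NormedAddCommGroup E] [NormedSpace ℝ E]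
  {H : Type*} [TopologicalSpace H] {I : ModelWithCorners ℝ E H} [ChartedSpace H M₁]
  {E' : Type*} [NormedAddCommGroup E'] [NormedSpace ℝ E']
  {H' : Type*} [TopologicalSpace H'] {J : ModelWithCorners ℝ E' H'} [ChartedSpace H' M₂]

theorem isFlowOf_differenceFlow {R₁ : VField I M₁} {R₂ : VField J M₂}
    {φ₁ : Flow ℝ M₁} {φ₂ : Flow ℝ M₂} (h₁ : IsFlowOf I R₁ φ₁) (h₂ : IsFlowOf J R₂ φ₂) :
    IsFlowOf (I.prod J) (prodVField R₁ (-R₂)) (differenceFlow φ₁ φ₂) where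
  smooth := by
    have a : ContMDiff (𝓘(ℝ, ℝ).prod (I.prod J)) I ∞
        (fun q : ℝ × M₁ × M₂ ↦ φ₁ q.1 q.2.1) :=
      h₁.smooth.comp (contMDiff_fst.prodMk (contMDiff_fst.comp contMDiff_snd))
    have n : ContMDiff 𝓘(ℝ, ℝ) 𝓘(ℝ, ℝ) ∞ (fun t : ℝ ↦ -t) := contDiff_neg.contMDiff
    have b : ContMDiff (𝓘(ℝ, ℝ).prod (I.prod J)) J ∞
        (fun q : ℝ × M₁ × M₂ ↦ φ₂ (-q.1) q.2.2) :=
      h₂.smooth.comp ((n.comp contMDiff_fst).prodMk (contMDiff_snd.comp contMDiff_snd))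
    exact a.prodMk b
  integralCurve := by
    intro y
    have a := h₁.integralCurve y.1
    have b : IsMIntegralCurve (I := J) (fun t ↦ φ₂ (-t) y.2) (-R₂) := by
      have b' := (h₂.integralCurve y.2).comp_mul (-1)
      have e₁ : (fun t ↦ φ₂ t y.2) ∘ (fun t : ℝ ↦ t * -1) = fun t ↦ φ₂ (-t) y.2 := by
        funext t
        show φ₂ (t * -1) y.2 = φ₂ (-t) y.2
        rw [mul_neg_one]
      have e₂ : (-1 : ℝ) • R₂ = -R₂ := by
        funext x
        exact neg_one_smul ℝ (R₂ x)
      rwa [e₁, e₂] at b'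
    intro t
    refine ((a t).prodMk (b t)).congr_mfderiv ?_
    ext <;> rfl

end Quotients

/-! ### Principal contactifications -/

section Contactification

variable {E : Type*} [NormedAddCommGroup E] [NormedSpace ℝ E]
  {H : Type*} [TopologicalSpace H] (I : ModelWithCorners ℝ E H)
  {M : Type*} [TopologicalSpace M] [ChartedSpace H M]
  {E' : Type*} [NormedAddCommGroup E'] [NormedSpace ℝ E']
  {H' : Type*} [TopologicalSpace H'] (J : ModelWithCorners ℝ E' H')
  {N : Type*} [TopologicalSpace N] [ChartedSpace H' N]

/-- The group of periods of a flow with minimal period `ρ ∈ (0, ∞]`: it is `ρ ℤ` if `ρ` is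
finite, and trivial if `ρ = ∞` (note that `(⊤ : ENNReal).toReal = 0`). -/
def periodGroup (ρ : ENNReal) : AddSubgroup ℝ := AddSubgroup.zmultiples ρ.toReal

/-- `(M, η)`, with Reeb vector field `R` and Reeb flow `φ`, is a principal contactification of the
symplectic manifold `(N, Ω)`, with projection `p : M → N = M / R` and minimal period
`ρ ∈ (0, ∞]` of the Reeb vector field.

The flow of `R` is an action of `ℝ / ρℤ` (which is `U(1)` for finite `ρ` and `ℝ` for `ρ = ∞`).
It is free (`period`), its orbits are the fibres of the surjective submersion `p` (`orbits`), and
there are local trivializations `(x, t) ↦ φ t (σ x)` coming from smooth local sections `σ`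
(`localSection`); so it makes `p` a principal bundle. -/
structure IsPrincipalContactification [IsManifold I ∞ M] [IsManifold J ∞ N]
    (η : OneForm I M) (R : VField I M) (φ : Flow ℝ M) (p : M → N) (Ω : TwoForm J N)
    (ρ : ENNReal) : Prop where
  symplectic : IsSymplecticForm J Ω
  contact : IsContactForm I η
  reeb : IsReebField I η R
  flow : IsFlowOf I R φ
  period_pos : 0 < ρ
  period : ∀ y t, φ t y = y ↔ t ∈ periodGroup ρ
  surjective : Surjective p
  submersion : IsSmoothSubmersion I J p
  orbits : ∀ y y', p y = p y' ↔ ∃ t, φ t y = y'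
  localSection : ∀ x : N, ∃ (U : Set N) (σ : N → M), IsOpen U ∧ x ∈ U ∧
    ContMDiffOn J I ∞ σ U ∧ ∀ x' ∈ U, p (σ x') = x'
  extDeriv_eq : ∀ y (u v : TangentSpace I y), extDeriv₁ I η y u v = pullback₂ I p Ω y u v

end Contactification

/-! ### Hermitian line bundles with connection -/

section LineBundle

universe v v₁ v₂

variable {E : Type*} [NormedAddCommGroup E] [NormedSpace ℝ E]
  {H : Type*} [TopologicalSpace H] (J : ModelWithCorners ℝ E H)
  (N : Type*) [TopologicalSpace N] [ChartedSpace H N]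

/-- The data of a smooth complex line bundle with Hermitian metric and linear connection: the
fibres, the smooth sections over open sets, the metric (linear in the first variable) and the
covariant derivative `D X ψ`. A section over `U` is given by an arbitrary extension to all of `N`.
The axioms are `IsHermitianLineBundle` and `IsLinearConnection` below. -/
structure LineBundleData where
  Fiber : N → Type v
  [addCommGroup : ∀ x, AddCommGroup (Fiber x)]
  [module : ∀ x, Module ℂ (Fiber x)]
  SmoothOn : (Π x, Fiber x) → Set N → Prop
  herm : ∀ x, Fiber x → Fiber x → ℂ
  D : VField J N → (Π x, Fiber x) → Π x, Fiber x

attribute [instance] LineBundleData.addCommGroup LineBundleData.module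

variable {J N}

/-- The data define a smooth complex line bundle (smooth sections form a sheaf, which near every
point is freely generated over the smooth functions by one section that is a basis of each fibre)
with a smooth Hermitian metric. -/
structure LineBundleData.IsHermitianLineBundle (L : LineBundleData.{v} J N) : Prop where
  smoothOn_congr : ∀ (ψ ψ' : Π x, L.Fiber x) (U : Set N), IsOpen U → (∀ x ∈ U, ψ x = ψ' x) →
    L.SmoothOn ψ U → L.SmoothOn ψ' U
  smoothOn_iff_locally : ∀ (ψ : Π x, L.Fiber x) (U : Set N), IsOpen U →
    (L.SmoothOn ψ U ↔ ∀ x ∈ U, ∃ V ⊆ U, IsOpen V ∧ x ∈ V ∧ L.SmoothOn ψ V)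
  localFrame : ∀ x : N, ∃ (U : Set N) (e : Π x, L.Fiber x), IsOpen U ∧ x ∈ U ∧
    (∀ x' ∈ U, ∀ ξ : L.Fiber x', ∃! c : ℂ, ξ = c • e x') ∧
    ∀ V ⊆ U, IsOpen V → ∀ f : N → ℂ,
      L.SmoothOn (fun x' ↦ f x' • e x') V ↔ ContMDiffOn J 𝓘(ℝ, ℂ) ∞ f V
  herm_add_left : ∀ x (ξ ξ' ζ : L.Fiber x), L.herm x (ξ + ξ') ζ = L.herm x ξ ζ + L.herm x ξ' ζ
  herm_smul_left : ∀ x (c : ℂ) (ξ ζ : L.Fiber x), L.herm x (c • ξ) ζ = c * L.herm x ξ ζ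
  herm_symm : ∀ x (ξ ζ : L.Fiber x), L.herm x ζ ξ = (starRingEnd ℂ) (L.herm x ξ ζ)
  herm_pos : ∀ x (ξ : L.Fiber x), ξ ≠ 0 → 0 < (L.herm x ξ ξ).re
  herm_smooth : ∀ (ψ ψ' : Π x, L.Fiber x) (U : Set N), IsOpen U → L.SmoothOn ψ U →
    L.SmoothOn ψ' U → ContMDiffOn J 𝓘(ℝ, ℂ) ∞ (fun x ↦ L.herm x (ψ x) (ψ' x)) U

/-- `D` is a smooth linear connection. -/
structure LineBundleData.IsLinearConnection [IsManifold J ∞ N] (L : LineBundleData.{v} J N) :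
    Prop where
  local_ : ∀ (X X' : VField J N) (ψ ψ' : Π x, L.Fiber x) (U : Set N), IsOpen U →
    (∀ x ∈ U, X x = X' x) → (∀ x ∈ U, ψ x = ψ' x) → ∀ x ∈ U, L.D X ψ x = L.D X' ψ' x
  add_section : ∀ (X : VField J N) (ψ ψ' : Π x, L.Fiber x) (U : Set N), IsOpen U →
    L.SmoothOn ψ U → L.SmoothOn ψ' U → ∀ x ∈ U, L.D X (ψ + ψ') x = L.D X ψ x + L.D X ψ' x
  leibniz : ∀ (X : VField J N) (f : N → ℂ) (ψ : Π x, L.Fiber x) (U : Set N), IsOpen U →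
    ContMDiffOn J 𝓘(ℝ, ℂ) ∞ f U → L.SmoothOn ψ U → ∀ x ∈ U,
      L.D X (fun x ↦ f x • ψ x) x
        = f x • L.D X ψ x + mvfderiv J f x (X x) • ψ x
  add_vField : ∀ (X X' : VField J N) (ψ : Π x, L.Fiber x) (U : Set N), IsOpen U →
    L.SmoothOn ψ U → ∀ x ∈ U, L.D (X + X') ψ x = L.D X ψ x + L.D X' ψ x
  smul_vField : ∀ (g : N → ℝ) (X : VField J N) (ψ : Π x, L.Fiber x) (U : Set N), IsOpen U →
    L.SmoothOn ψ U → ∀ x ∈ U, L.D (fun x ↦ g x • X x) ψ x = (g x : ℂ) • L.D X ψ x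
  smooth : ∀ (X : VField J N) (ψ : Π x, L.Fiber x) (U : Set N), IsOpen U →
    SmoothVFieldOn J X U → L.SmoothOn ψ U → L.SmoothOn (L.D X ψ) U

variable {E' : Type*} [NormedAddCommGroup E'] [NormedSpace ℝ E']
  {H' : Type*} [TopologicalSpace H'] {J' : ModelWithCorners ℝ E' H'}
  {N' : Type*} [TopologicalSpace N'] [ChartedSpace H' N']

/-- Smooth sections over `W` of the (external) tensor product bundle, whose fibre over `(x₁, x₂)`
is the tensor product of the fibres over `x₁` and `x₂`: locally they are finite sums of tensor
products of smooth sections of the factors, with smooth coefficients. -/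
def tensorSmoothOn (L₁ : LineBundleData.{v₁} J N) (L₂ : LineBundleData.{v₂} J' N')
    (ψ : Π x : N × N', L₁.Fiber x.1 ⊗[ℂ] L₂.Fiber x.2) (W : Set (N × N')) : Prop :=
  ∀ x ∈ W, ∃ (U₁ : Set N) (U₂ : Set N'), IsOpen U₁ ∧ IsOpen U₂ ∧ x ∈ U₁ ×ˢ U₂ ∧ U₁ ×ˢ U₂ ⊆ W ∧
    ∃ (k : ℕ) (f : Fin k → N × N' → ℂ) (s₁ : Fin k → Π x, L₁.Fiber x)
      (s₂ : Fin k → Π x, L₂.Fiber x),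
      (∀ i, ContMDiffOn (J.prod J') 𝓘(ℝ, ℂ) ∞ (f i) (U₁ ×ˢ U₂)) ∧
      (∀ i, L₁.SmoothOn (s₁ i) U₁) ∧ (∀ i, L₂.SmoothOn (s₂ i) U₂) ∧
      ∀ z ∈ U₁ ×ˢ U₂, ψ z = ∑ i, f i z • (s₁ i z.1 ⊗ₜ[ℂ] s₂ i z.2)

/-- The fibrewise linear isomorphisms `Φ` identify `L` with the tensor product bundle of `L₁` and
`L₂`, the metric of `L` with the product metric, and the connection of `L` with the product
connection. -/
structure IsTensorProductIso (L₁ : LineBundleData.{v₁} J N) (L₂ : LineBundleData.{v₂} J' N')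
    (L : LineBundleData.{v} (J.prod J') (N × N'))
    (Φ : ∀ x : N × N', (L₁.Fiber x.1 ⊗[ℂ] L₂.Fiber x.2) ≃ₗ[ℂ] L.Fiber x) : Prop where
  smoothOn_iff : ∀ (ψ : Π x : N × N', L₁.Fiber x.1 ⊗[ℂ] L₂.Fiber x.2) (W : Set (N × N')),
    IsOpen W → (L.SmoothOn (fun x ↦ Φ x (ψ x)) W ↔ tensorSmoothOn L₁ L₂ ψ W)
  herm_tmul : ∀ (x : N × N') (ξ₁ ξ₁' : L₁.Fiber x.1) (ξ₂ ξ₂' : L₂.Fiber x.2),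
    L.herm x (Φ x (ξ₁ ⊗ₜ[ℂ] ξ₂)) (Φ x (ξ₁' ⊗ₜ[ℂ] ξ₂'))
      = L₁.herm x.1 ξ₁ ξ₁' * L₂.herm x.2 ξ₂ ξ₂'
  D_tmul : ∀ (X₁ : VField J N) (X₂ : VField J' N') (ψ₁ : Π x, L₁.Fiber x)
    (ψ₂ : Π x, L₂.Fiber x) (U₁ : Set N) (U₂ : Set N'), IsOpen U₁ → IsOpen U₂ →
    L₁.SmoothOn ψ₁ U₁ → L₂.SmoothOn ψ₂ U₂ → ∀ x ∈ U₁ ×ˢ U₂,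
      L.D (prodVField X₁ X₂) (fun x ↦ Φ x (ψ₁ x.1 ⊗ₜ[ℂ] ψ₂ x.2)) x
        = Φ x (L₁.D X₁ ψ₁ x.1 ⊗ₜ[ℂ] ψ₂ x.2 + ψ₁ x.1 ⊗ₜ[ℂ] L₂.D X₂ ψ₂ x.2)

end LineBundle

/-! ### The prequantum line bundle of a principal contactification -/

section Prequantum

variable {E : Type*} [NormedAddCommGroup E] [NormedSpace ℝ E]
  {H : Type*} [TopologicalSpace H] {I : ModelWithCorners ℝ E H}
  {M : Type*} [TopologicalSpace M] [ChartedSpace H M]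
  {E' : Type*} [NormedAddCommGroup E'] [NormedSpace ℝ E']
  {H' : Type*} [TopologicalSpace H'] {J : ModelWithCorners ℝ E' H'}
  {N : Type*} [TopologicalSpace N] [ChartedSpace H' N]

/-- `exp(-2πit/ρ)`; for `ρ = ∞` this is `1`, as `(⊤ : ENNReal).toReal = 0` and `t / 0 = 0`. -/
noncomputable def phase (ρ : ENNReal) (t : ℝ) : ℂ :=
  Complex.exp (-(2 * Real.pi * (t / ρ.toReal) : ℝ) * Complex.I)

/-- The fibre over `x` of the line bundle associated with `p : M → N`: the functions on the fibre
`p ⁻¹' {x}` with `f (φ t y) = exp(-2πit/ρ) f y`. -/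
def equivariantFunctions (φ : Flow ℝ M) (p : M → N) (ρ : ENNReal) (x : N) :
    Submodule ℂ ({y : M // p y = x} → ℂ) where
  carrier := {f | ∀ (y y' : {y : M // p y = x}) (t : ℝ), φ t y = y' → f y' = phase ρ t * f y}
  add_mem' := by
    intro f g hf hg y y' t h
    simp only [Pi.add_apply, hf y y' t h, hg y y' t h]
    ring
  zero_mem' := by
    intro y y' t _
    simp
  smul_mem' := by
    intro c f hf y y' t h
    simp only [Pi.smul_apply, smul_eq_mul, hf y y' t h]
    ring

/-- The equivariant function on `M` that corresponds to a section. -/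
def sectionFun {φ : Flow ℝ M} {p : M → N} {ρ : ENNReal}
    (ψ : Π x, equivariantFunctions φ p ρ x) : M → ℂ :=
  fun y ↦ (ψ (p y)).1 ⟨y, rfl⟩

/-- The horizontal lift to `T_y M` of a tangent vector `v` at `p y`: the vector `w` with `η w = 0`
and `dp w = v`, that is, the preimage of `(0, v)` under the isomorphism `(η, dp)`. -/
noncomputable def horizontalLift (η : OneForm I M) (p : M → N) (y : M)
    (v : TangentSpace J (p y)) : TangentSpace I y :=
  ((η y).prod (mfderiv I J p y)).inverse (0, v)

/-- The derivative of a function on `M` along the horizontal lift of a vector field on `N`. -/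
noncomputable def horizontalDeriv (η : OneForm I M) (p : M → N) (X : VField J N) (F : M → ℂ)
    (y : M) : ℂ :=
  mvfderiv I F y (horizontalLift η p y (X (p y)))

open Classical in
/-- The prequantum line bundle of a principal contactification. Its sections are the equivariant
functions `F` on `M`; the metric is given by the product of `F` and the conjugate of `G`, which is
constant on the fibres of `p`; the covariant derivative `D X F` is the derivative of `F` along the
horizontal lift of `X`. The default value `0` is never taken where `F` is smooth, because the
derivative is again equivariant; in particular the Leibniz rule excludes it. -/
noncomputable def prequantumBundle [IsManifold I ∞ M] [IsManifold J ∞ N]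
    {η : OneForm I M} {R : VField I M} {φ : Flow ℝ M} {p : M → N} {Ω : TwoForm J N} {ρ : ENNReal}
    (h : IsPrincipalContactification I J η R φ p Ω ρ) : LineBundleData J N where
  Fiber x := equivariantFunctions φ p ρ x
  SmoothOn ψ U := ContMDiffOn I 𝓘(ℝ, ℂ) ∞ (sectionFun ψ) (p ⁻¹' U)
  herm x f g :=
    let y : {y : M // p y = x} := ⟨surjInv h.surjective x, surjInv_eq h.surjective x⟩
    f.1 y * (starRingEnd ℂ) (g.1 y)
  D X ψ x :=
    if hD : (fun y : {y : M // p y = x} ↦ horizontalDeriv η p X (sectionFun ψ) y.1)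
        ∈ equivariantFunctions φ p ρ x
    then ⟨_, hD⟩ else 0

end Prequantum

end Prequantization

open Prequantization

/-!
A local section `σ` of `p₂` over `U` identifies `M₁ × U` with the part of the quotient over `U`, by
`(y₁, x) ↦ [(y₁, σ x)]`: the orbit of `(y₁, φ₂ t (σ x))` under the flow of `R₁ - R₂` contains
`(φ₁ t y₁, σ x)`, and the ambiguity of `t` is harmless because both flows have the same period
group. These identifications are the charts of the quotient.

The form `η₁ ⊕ η₂` is invariant under the flow of `R₁ - R₂` and vanishes on its generator, hence
descends to a form `η`, and `dη` is the pullback of `Ω₁ ⊕ Ω₂` because this holds on `M₁ × M₂`. Since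
`η` is `1` on the generator of the flow `[(y₁, y₂)] ↦ [(φ₁ t y₁, y₂)]`, whose direction spans the
kernel of the differential of the projection to `N₁ × N₂`, it is a contact form.

The fibres of the prequantum bundles are one-dimensional, so the product of equivariant functions
gives a linear isomorphism of fibres. It is compatible with the connections because the horizontal
lift of `X₁ ⊕ X₂` is the image of the pair of horizontal lifts of `X₁` and `X₂`.
-/

namespace Prequantization

/-! ### Differential forms in charts -/

section Forms

variable {E : Type*} [NormedAddCommGroup E] [NormedSpace ℝ E]
  {H : Type*} [TopologicalSpace H] {I : ModelWithCorners ℝ E H}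
  {M : Type*} [TopologicalSpace M] [ChartedSpace H M]
  {E' : Type*} [NormedAddCommGroup E'] [NormedSpace ℝ E']
  {H' : Type*} [TopologicalSpace H'] {J : ModelWithCorners ℝ E' H'}
  {N : Type*} [TopologicalSpace N] [ChartedSpace H' N]
  {V : Type*} [NormedAddCommGroup V] [NormedSpace ℝ V]

/-- The pullback of a 1-form by a map defined on a normed space. It is `pullback₁` with values in
the dual of the model space instead of the dual of a tangent space, so that it can be
differentiated. -/
noncomputable def flatPullback (f : V → M) (η : OneForm I M) : V → V →L[ℝ] ℝ :=
  fun e ↦ (η (f e)).comp (mfderiv 𝓘(ℝ, V) I f e)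

/-- The exterior derivative of a 1-form on a normed space. -/
noncomputable def flatExtDeriv (β : V → V →L[ℝ] ℝ) (e u v : V) : ℝ :=
  fderiv ℝ β e u v - fderiv ℝ β e v u

theorem oneForm_congr (η : OneForm I M) {x x' : M} (hx : x = x') {v v' : E} (hv : v = v') :
    (show E →L[ℝ] ℝ from η x) v = (show E →L[ℝ] ℝ from η x') v' := by
  subst hx hv
  rfl

theorem twoForm_congr (Ω : TwoForm I M) {x x' : M} (hx : x = x') {v v' w w' : E} (hv : v = v')
    (hw : w = w') :
    (show E →L[ℝ] E →L[ℝ] ℝ from Ω x) v w = (show E →L[ℝ] E →L[ℝ] ℝ from Ω x') v' w' := by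
  subst hx hv hw
  rfl

theorem mfderiv_apply_congr (f : M → N) {x x' : M} (hx : x = x') {v v' : E} (hv : v = v') :
    (show E →L[ℝ] E' from mfderiv I J f x) v = (show E →L[ℝ] E' from mfderiv I J f x') v' := by
  subst hx hv
  rfl

theorem extDeriv₁_congr (η : OneForm I M) {x x' : M} (hx : x = x') {v v' w w' : E} (hv : v = v')
    (hw : w = w') : extDeriv₁ I η x v w = extDeriv₁ I η x' v' w' := by
  subst hx hv hw
  rfl

theorem eventually_mdifferentiableAt [IsManifold I ∞ M] [IsManifold J ∞ N] {f : M → N} {x : M}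
    (hf : ContMDiffAt I J ∞ f x) : ∀ᶠ x' in 𝓝 x, MDifferentiableAt I J f x' := by
  filter_upwards [(contMDiffAt_iff_contMDiffAt_nhds (by simp)).1
    (hf.of_le ENat.LEInfty.out : ContMDiffAt I J 1 f x)] with x' hx'
  exact hx'.mdifferentiableAt one_ne_zero

theorem contMDiffAt_extChartAt_symm [IsManifold I ∞ M] [I.Boundaryless] (x : M) :
    ContMDiffAt 𝓘(ℝ, E) I ∞ (extChartAt I x).symm (extChartAt I x x) :=
  (contMDiffOn_extChartAt_symm x).contMDiffAt (extChartAt_target_mem_nhds x)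

theorem mfderiv_extChartAt_symm_self [IsManifold I 1 M] [I.Boundaryless] (x : M) :
    mfderiv 𝓘(ℝ, E) I (extChartAt I x).symm (extChartAt I x x) = ContinuousLinearMap.id ℝ E := by
  rw [← mfderivWithin_univ, ← I.range_eq_univ]
  exact mfderivWithin_range_extChartAt_symm

theorem mfderiv_comp_extChartAt_symm [IsManifold I ∞ M] [I.Boundaryless] {F : M → N} {x : M}
    (hF : MDifferentiableAt I J F x) (w : E) :
    (show E' from mfderiv 𝓘(ℝ, E) J (F ∘ (extChartAt I x).symm) (extChartAt I x x) w)
      = mfderiv I J F x w := by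
  have hx : (extChartAt I x).symm (extChartAt I x x) = x := extChartAt_to_inv x
  rw [mfderiv_comp _ (by rwa [hx])
    ((contMDiffAt_extChartAt_symm x).mdifferentiableAt (by simp)), mfderiv_extChartAt_symm_self]
  exact congrArg (fun z ↦ (show E →L[ℝ] E' from mfderiv I J F z) w) hx

theorem contMDiffAt_comp_extChartAt_iff [I.Boundaryless] {g : E → V} {x₀ : M} :
    ContMDiffAt I 𝓘(ℝ, V) ∞ (fun x ↦ g (extChartAt I x₀ x)) x₀
      ↔ ContDiffAt ℝ ∞ g (extChartAt I x₀ x₀) := by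
  rw [contMDiffAt_iff_source, I.range_eq_univ, contMDiffWithinAt_univ, contMDiffAt_iff_contDiffAt]
  have h : (fun x ↦ g (extChartAt I x₀ x)) ∘ (extChartAt I x₀).symm
      =ᶠ[𝓝 (extChartAt I x₀ x₀)] g := by
    filter_upwards [extChartAt_target_mem_nhds (I := I) x₀] with e he
    exact congrArg g ((extChartAt I x₀).right_inv he)
  exact ⟨fun hg ↦ hg.congr_of_eventuallyEq h.symm, fun hg ↦ hg.congr_of_eventuallyEq h⟩

theorem contDiffAt_extChartAt_comp {f : V → M} {e : V} (hf : ContMDiffAt 𝓘(ℝ, V) I ∞ f e) :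
    ContDiffAt ℝ ∞ (extChartAt I (f e) ∘ f) e :=
  (contMDiffAt_extChartAt.comp e hf).contDiffAt

theorem fderiv_extChartAt_comp [IsManifold I 1 M] {f : V → M} {x₀ : M} {e : V}
    (hf : MDifferentiableAt 𝓘(ℝ, V) I f e) (hx : f e ∈ (extChartAt I x₀).source) :
    fderiv ℝ (extChartAt I x₀ ∘ f) e
      = (mfderiv I 𝓘(ℝ, E) (extChartAt I x₀) (f e)).comp (mfderiv 𝓘(ℝ, V) I f e) := by
  rw [← mfderiv_eq_fderiv]
  exact mfderiv_comp e (mdifferentiableAt_extChartAt (by simpa using hx)) hf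

theorem oneFormInChart_comp_mfderiv [IsManifold I 1 M] (η : OneForm I M) {x₀ y : M}
    (hy : y ∈ (extChartAt I x₀).source) :
    (oneFormInChart I η x₀ (extChartAt I x₀ y)).comp (mfderiv I 𝓘(ℝ, E) (extChartAt I x₀) y)
      = η y :=
  ContinuousLinearMap.ext fun w ↦ oneForm_congr η ((extChartAt I x₀).left_inv hy)
    (congrArg (fun A : E →L[ℝ] E ↦ A w) (mfderivWithin_extChartAt_symm_comp_mfderiv_extChartAt' hy))

theorem flatPullback_eq [IsManifold I 1 M] (η : OneForm I M) {f : V → M} {x₀ : M} {e : V}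
    (hf : MDifferentiableAt 𝓘(ℝ, V) I f e) (hx : f e ∈ (extChartAt I x₀).source) :
    flatPullback f η e = (oneFormInChart I η x₀ (extChartAt I x₀ (f e))).comp
      (fderiv ℝ (extChartAt I x₀ ∘ f) e) := by
  rw [fderiv_extChartAt_comp hf hx]
  exact (congrArg (fun A : E →L[ℝ] ℝ ↦ A.comp (mfderiv 𝓘(ℝ, V) I f e))
    (oneFormInChart_comp_mfderiv η hx)).symm

theorem flatPullback_eventuallyEq [IsManifold I ∞ M] (η : OneForm I M) {f : V → M} {e : V}
    (hf : ContMDiffAt 𝓘(ℝ, V) I ∞ f e) :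
    flatPullback f η =ᶠ[𝓝 e] fun e' ↦
      (oneFormInChart I η (f e) ((extChartAt I (f e) ∘ f) e')).comp
        (fderiv ℝ (extChartAt I (f e) ∘ f) e') := by
  filter_upwards [eventually_mdifferentiableAt hf,
    hf.continuousAt.eventually (extChartAt_source_mem_nhds (I := I) (f e))] with e' hdiff hsource
  exact flatPullback_eq η hdiff hsource

theorem flatPullback_pullback₁ [IsManifold I ∞ M] [IsManifold J ∞ N] (η : OneForm J N) {F : M → N}
    {f : V → M} {e : V} (hf : ContMDiffAt 𝓘(ℝ, V) I ∞ f e) (hF : ContMDiffAt I J ∞ F (f e)) :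
    flatPullback f (pullback₁ I F η) =ᶠ[𝓝 e] flatPullback (F ∘ f) η := by
  filter_upwards [eventually_mdifferentiableAt hf,
    hf.continuousAt.eventually (eventually_mdifferentiableAt hF)] with e' hf' hF'
  unfold flatPullback pullback₁
  rw [mfderiv_comp e' hF' hf']
  rfl

theorem flatExtDeriv_congr {β β' : V → V →L[ℝ] ℝ} {e : V} (h : β =ᶠ[𝓝 e] β') :
    flatExtDeriv β e = flatExtDeriv β' e := by
  funext u v
  rw [flatExtDeriv, h.fderiv_eq, flatExtDeriv]

theorem flatExtDeriv_add {β β' : V → V →L[ℝ] ℝ} {e : V} (h : DifferentiableAt ℝ β e)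
    (h' : DifferentiableAt ℝ β' e) (u v : V) :
    flatExtDeriv (β + β') e u v = flatExtDeriv β e u v + flatExtDeriv β' e u v := by
  simp only [flatExtDeriv, fderiv_add h h', _root_.add_apply]
  ring

-- `d(g^*β) = g^*dβ` holds because the terms containing the second derivative of `g` cancel.
theorem flatExtDeriv_comp_fderiv {β : E → E →L[ℝ] ℝ} {g : V → E} {e : V}
    (hβ : DifferentiableAt ℝ β (g e)) (hg : ContDiffAt ℝ ∞ g e) (u v : V) :
    flatExtDeriv (fun e' ↦ (β (g e')).comp (fderiv ℝ g e')) e u v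
      = flatExtDeriv β (g e) (fderiv ℝ g e u) (fderiv ℝ g e v) := by
  have hg₁ : HasFDerivAt g (fderiv ℝ g e) e := (hg.differentiableAt (by simp)).hasFDerivAt
  have hg₂ : HasFDerivAt (fderiv ℝ g) (fderiv ℝ (fderiv ℝ g) e) e :=
    ((hg.fderiv_right (m := ∞) (by simp)).differentiableAt (by simp)).hasFDerivAt
  have hsymm := (hg.isSymmSndFDerivAt (by simpa using ENat.LEInfty.out)).eq u v
  have hd := ((hβ.hasFDerivAt.comp e hg₁).clm_comp hg₂).fderiv
  simp only [Function.comp_apply] at hd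
  simp only [flatExtDeriv, hd, _root_.add_apply, ContinuousLinearMap.comp_apply,
    ContinuousLinearMap.compL_apply, ContinuousLinearMap.flip_apply, hsymm]
  ring

theorem oneFormInChart_add (η η' : OneForm I M) (x : M) :
    oneFormInChart I (η + η') x = oneFormInChart I η x + oneFormInChart I η' x :=
  funext fun _ ↦ ContinuousLinearMap.add_comp _ _ _

theorem oneFormInChart_eq_flatPullback [I.Boundaryless] (η : OneForm I M) (x : M) :
    oneFormInChart I η x = flatPullback (extChartAt I x).symm η := by
  funext e
  unfold oneFormInChart flatPullback
  rw [I.range_eq_univ, mfderivWithin_univ]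

section Smoothness

variable [IsManifold I ∞ M]

theorem symmL_trivializationAt_apply {x₀ x : M} (hx : x ∈ (extChartAt I x₀).source) (w : E) :
    (show E from (trivializationAt E (TangentSpace I) x₀).symmL ℝ x w)
      = mfderivWithin 𝓘(ℝ, E) I (extChartAt I x₀).symm (range I) (extChartAt I x₀ x) w := by
  rw [TangentBundle.symmL_trivializationAt (by simpa using hx)]
  rfl

variable [I.Boundaryless]

theorem smoothOneForm_iff (η : OneForm I M) :
    SmoothOneForm I η ↔ ∀ x₀, ContDiffAt ℝ ∞ (oneFormInChart I η x₀) (extChartAt I x₀ x₀) := by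
  refine forall_congr' fun x₀ ↦ ?_
  rw [contMDiffAt_hom_bundle, ← contMDiffAt_comp_extChartAt_iff]
  refine (and_iff_right contMDiffAt_id).trans (Filter.EventuallyEq.contMDiffAt_iff ?_)
  filter_upwards [extChartAt_source_mem_nhds (I := I) x₀] with x hx
  refine ContinuousLinearMap.ext fun w ↦ Eq.trans ?_
    (oneForm_congr η ((extChartAt I x₀).left_inv hx).symm (symmL_trivializationAt_apply hx w))
  simp only [ContinuousLinearMap.inCoordinates, Trivial.fiberBundle_trivializationAt',
    Trivial.continuousLinearMapAt_trivialization, ContinuousLinearMap.id_comp,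
    ContinuousLinearMap.comp_apply]
  rfl

theorem smoothTwoForm_iff (Ω : TwoForm I M) :
    SmoothTwoForm I Ω ↔ ∀ x₀, ContDiffAt ℝ ∞ (twoFormInChart I Ω x₀) (extChartAt I x₀ x₀) := by
  refine forall_congr' fun x₀ ↦ ?_
  rw [contMDiffAt_hom_bundle, ← contMDiffAt_comp_extChartAt_iff]
  refine (and_iff_right contMDiffAt_id).trans (Filter.EventuallyEq.contMDiffAt_iff ?_)
  filter_upwards [extChartAt_source_mem_nhds (I := I) x₀] with x hx
  refine ContinuousLinearMap.ext fun v ↦ ContinuousLinearMap.ext fun w ↦ Eq.trans ?_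
    (twoForm_congr Ω ((extChartAt I x₀).left_inv hx).symm
      (symmL_trivializationAt_apply hx v) (symmL_trivializationAt_apply hx w))
  have hb : x ∈ (trivializationAt E (TangentSpace I) x₀).baseSet := by simpa using hx
  refine (inCoordinates_apply_eq₂ hb hb (mem_univ _)).trans ?_
  rw [← Trivialization.symmL_apply (R := ℝ) _ hb, ← Trivialization.symmL_apply (R := ℝ) _ hb]
  simp only [Trivial.fiberBundle_trivializationAt', Trivial.linearMapAt_trivialization,
    LinearMap.id_coe, id_eq]
  rfl

theorem contDiffAt_flatPullback {η : OneForm I M} (hη : SmoothOneForm I η) {f : V → M} {e : V}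
    (hf : ContMDiffAt 𝓘(ℝ, V) I ∞ f e) : ContDiffAt ℝ ∞ (flatPullback f η) e := by
  have hg := contDiffAt_extChartAt_comp hf
  have hη' := ((smoothOneForm_iff η).1 hη (f e)).comp e hg
  exact (hη'.clm_comp (hg.fderiv_right (by simp))).congr_of_eventuallyEq
    (flatPullback_eventuallyEq η hf)

theorem SmoothOneForm.add {η η' : OneForm I M} (h : SmoothOneForm I η) (h' : SmoothOneForm I η') :
    SmoothOneForm I (η + η') := by
  rw [smoothOneForm_iff] at *
  intro x
  rw [oneFormInChart_add]
  exact (h x).add (h' x)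

end Smoothness

section ExteriorDerivative

variable [IsManifold I ∞ M] [IsManifold J ∞ N] [I.Boundaryless] [J.Boundaryless]

theorem extDeriv₁_eq (η : OneForm I M) (x : M) (u v : TangentSpace I x) :
    extDeriv₁ I η x u v = flatExtDeriv (oneFormInChart I η x) (extChartAt I x x) u v := by
  unfold extDeriv₁ flatExtDeriv
  rw [I.range_eq_univ, fderivWithin_univ, mfderiv_extChartAt_self]
  rfl

theorem extDeriv₂_eq (Ω : TwoForm I M) (x : M) (u v w : TangentSpace I x) :
    extDeriv₂ I Ω x u v w = fderiv ℝ (twoFormInChart I Ω x) (extChartAt I x x) u v w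
      + fderiv ℝ (twoFormInChart I Ω x) (extChartAt I x x) v w u
      + fderiv ℝ (twoFormInChart I Ω x) (extChartAt I x x) w u v := by
  unfold extDeriv₂
  rw [I.range_eq_univ, fderivWithin_univ, mfderiv_extChartAt_self]
  rfl

theorem extDeriv₁_add {η η' : OneForm I M} (h : SmoothOneForm I η) (h' : SmoothOneForm I η')
    (x : M) (u v : TangentSpace I x) :
    extDeriv₁ I (η + η') x u v = extDeriv₁ I η x u v + extDeriv₁ I η' x u v := by
  rw [smoothOneForm_iff] at h h'
  simp only [extDeriv₁_eq, oneFormInChart_add]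
  exact flatExtDeriv_add ((h x).differentiableAt (by simp)) ((h' x).differentiableAt (by simp)) _ _

theorem extDeriv₁_mfderiv {η : OneForm I M} (hη : SmoothOneForm I η) {f : V → M} {e : V}
    (hf : ContMDiffAt 𝓘(ℝ, V) I ∞ f e) (u v : V) :
    extDeriv₁ I η (f e) (mfderiv 𝓘(ℝ, V) I f e u) (mfderiv 𝓘(ℝ, V) I f e v)
      = flatExtDeriv (flatPullback f η) e u v := by
  have hfderiv := fderiv_extChartAt_comp (hf.mdifferentiableAt (by simp))
    (mem_extChartAt_source (I := I) (f e))
  rw [mfderiv_extChartAt_self] at hfderiv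
  rw [flatExtDeriv_congr (flatPullback_eventuallyEq η hf), extDeriv₁_eq]
  refine Eq.trans ?_ (flatExtDeriv_comp_fderiv (g := extChartAt I (f e) ∘ f)
    (((smoothOneForm_iff η).1 hη (f e)).differentiableAt (by simp))
    (contDiffAt_extChartAt_comp hf) u v).symm
  rw [hfderiv]
  rfl

theorem extDeriv₁_pullback₁ {η : OneForm J N} (hη : SmoothOneForm J η) {F : M → N} {x : M}
    (hF : ContMDiffAt I J ∞ F x) (u v : TangentSpace I x) :
    extDeriv₁ I (pullback₁ I F η) x u v
      = extDeriv₁ J η (F x) (mfderiv I J F x u) (mfderiv I J F x v) := by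
  have hsymm := contMDiffAt_extChartAt_symm (I := I) x
  have hx : (extChartAt I x).symm (extChartAt I x x) = x := extChartAt_to_inv x
  have hF' : ContMDiffAt I J ∞ F ((extChartAt I x).symm (extChartAt I x x)) := by rwa [hx]
  have hdiff := hF.mdifferentiableAt (by simp)
  rw [extDeriv₁_eq, oneFormInChart_eq_flatPullback,
    flatExtDeriv_congr (flatPullback_pullback₁ η hsymm hF')]
  exact (extDeriv₁_mfderiv hη (hF'.comp _ hsymm) _ _).symm.trans (extDeriv₁_congr η (congrArg F hx)
    (mfderiv_comp_extChartAt_symm hdiff u) (mfderiv_comp_extChartAt_symm hdiff v))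

theorem smoothOneForm_of_eventuallyEq_pullback₁ {η : OneForm I M} {α : OneForm J N}
    (hα : SmoothOneForm J α)
    (h : ∀ x, ∃ s : M → N, ContMDiffAt I J ∞ s x ∧ ∀ᶠ x' in 𝓝 x, η x' = pullback₁ I s α x') :
    SmoothOneForm I η := by
  rw [smoothOneForm_iff]
  intro x
  obtain ⟨s, hs, h⟩ := h x
  have hsymm := contMDiffAt_extChartAt_symm (I := I) x
  have hx : (extChartAt I x).symm (extChartAt I x x) = x := extChartAt_to_inv x
  rw [← hx] at hs h
  refine (contDiffAt_flatPullback hα (hs.comp _ hsymm)).congr_of_eventuallyEq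
    (Filter.EventuallyEq.trans ?_ (flatPullback_pullback₁ α hsymm hs))
  rw [oneFormInChart_eq_flatPullback]
  filter_upwards [hsymm.continuousAt.eventually h] with e he
  unfold flatPullback
  rw [he]

theorem SmoothOneForm.pullback₁ {η : OneForm J N} (hη : SmoothOneForm J η) {F : M → N}
    (hF : ContMDiff I J ∞ F) : SmoothOneForm I (pullback₁ I F η) :=
  smoothOneForm_of_eventuallyEq_pullback₁ hη fun x ↦ ⟨F, hF x, .of_forall fun _ ↦ rfl⟩

end ExteriorDerivative

end Forms

/-! ### Products of differential forms -/

section Products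

variable {E : Type*} [NormedAddCommGroup E] [NormedSpace ℝ E]
  {H : Type*} [TopologicalSpace H] {I : ModelWithCorners ℝ E H}
  {M : Type*} [TopologicalSpace M] [ChartedSpace H M]
  {E' : Type*} [NormedAddCommGroup E'] [NormedSpace ℝ E']
  {H' : Type*} [TopologicalSpace H'] {J : ModelWithCorners ℝ E' H'}
  {N : Type*} [TopologicalSpace N] [ChartedSpace H' N]

section Apply

theorem prodOneForm_apply (η₁ : OneForm I M) (η₂ : OneForm J N) (x : M × N)
    (v : TangentSpace I x.1) (w : TangentSpace J x.2) :
    prodOneForm η₁ η₂ x (v, w) = η₁ x.1 v + η₂ x.2 w := by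
  unfold prodOneForm pullback₁
  rw [Pi.add_apply, mfderiv_fst, mfderiv_snd]
  rfl

theorem prodTwoForm_apply (Ω₁ : TwoForm I M) (Ω₂ : TwoForm J N) (x : M × N)
    (v v' : TangentSpace I x.1) (w w' : TangentSpace J x.2) :
    prodTwoForm Ω₁ Ω₂ x (v, w) (v', w') = Ω₁ x.1 v v' + Ω₂ x.2 w w' := by
  unfold prodTwoForm pullback₂
  rw [Pi.add_apply, mfderiv_fst, mfderiv_snd]
  rfl

end Apply

section Bilinear

variable {F F' W : Type*} [NormedAddCommGroup F] [NormedSpace ℝ F] [NormedAddCommGroup F']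
  [NormedSpace ℝ F'] [NormedAddCommGroup W] [NormedSpace ℝ W] {A : F →L[ℝ] W} {A' : F' →L[ℝ] W}
  {f : E → F} {g : E' → F'} {e : E × E'}

theorem contDiffAt_clm_fst_add_clm_snd (hf : ContDiffAt ℝ ∞ f e.1) (hg : ContDiffAt ℝ ∞ g e.2) :
    ContDiffAt ℝ ∞ (fun e : E × E' ↦ A (f e.1) + A' (g e.2)) e :=
  (A.contDiff.contDiffAt.comp e (hf.comp e contDiffAt_fst)).add
    (A'.contDiff.contDiffAt.comp e (hg.comp e contDiffAt_snd))

theorem fderiv_clm_fst_add_clm_snd (hf : DifferentiableAt ℝ f e.1) (hg : DifferentiableAt ℝ g e.2)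
    (r : E × E') :
    fderiv ℝ (fun e : E × E' ↦ A (f e.1) + A' (g e.2)) e r
      = A (fderiv ℝ f e.1 r.1) + A' (fderiv ℝ g e.2 r.2) :=
  congrArg (fun B : (E × E') →L[ℝ] W ↦ B r)
    ((A.hasFDerivAt.comp e (hf.hasFDerivAt.comp e hasFDerivAt_fst)).add
      (A'.hasFDerivAt.comp e (hg.hasFDerivAt.comp e hasFDerivAt_snd))).fderiv

/-- Pullback of bilinear forms by a linear map. -/
noncomputable def bilinPullback (A : F →L[ℝ] E) :
    (E →L[ℝ] E →L[ℝ] ℝ) →L[ℝ] F →L[ℝ] F →L[ℝ] ℝ :=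
  ((ContinuousLinearMap.compL ℝ F E (F →L[ℝ] ℝ)).flip A).comp
    (ContinuousLinearMap.compL ℝ E (E →L[ℝ] ℝ) (F →L[ℝ] ℝ) (ContinuousLinearMap.precomp ℝ A))

end Bilinear

section Smoothness

variable [IsManifold I ∞ M] [IsManifold J ∞ N] [I.Boundaryless] [J.Boundaryless]

theorem SmoothOneForm.prodOneForm {η₁ : OneForm I M} {η₂ : OneForm J N} (h₁ : SmoothOneForm I η₁)
    (h₂ : SmoothOneForm J η₂) : SmoothOneForm (I.prod J) (prodOneForm η₁ η₂) :=
  (h₁.pullback₁ contMDiff_fst).add (h₂.pullback₁ contMDiff_snd)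

theorem extDeriv₁_prodOneForm {η₁ : OneForm I M} {η₂ : OneForm J N} (h₁ : SmoothOneForm I η₁)
    (h₂ : SmoothOneForm J η₂) (x : M × N) (u v : TangentSpace (I.prod J) x) :
    extDeriv₁ (I.prod J) (Prequantization.prodOneForm η₁ η₂) x u v
      = extDeriv₁ I η₁ x.1 u.1 v.1 + extDeriv₁ J η₂ x.2 u.2 v.2 := by
  refine (extDeriv₁_add (h₁.pullback₁ contMDiff_fst) (h₂.pullback₁ contMDiff_snd) x u v).trans ?_
  rw [extDeriv₁_pullback₁ h₁ contMDiff_fst.contMDiffAt,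
    extDeriv₁_pullback₁ h₂ contMDiff_snd.contMDiffAt, mfderiv_fst, mfderiv_snd]
  rfl

theorem mdifferentiableAt_extChartAt_symm {x : M} {e : E} (he : e ∈ (extChartAt I x).target) :
    MDifferentiableAt 𝓘(ℝ, E) I (extChartAt I x).symm e :=
  ((contMDiffOn_extChartAt_symm (n := ∞) x).contMDiffAt
    ((isOpen_extChartAt_target x).mem_nhds he)).mdifferentiableAt (by simp)

theorem mfderivWithin_extChartAt_prod_symm {x : M × N} {e : E × E'}
    (he : e ∈ (extChartAt (I.prod J) x).target) (u : E × E') :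
    (show E × E' from mfderivWithin 𝓘(ℝ, E × E') (I.prod J) (extChartAt (I.prod J) x).symm
        (range (I.prod J)) e u)
      = (mfderivWithin 𝓘(ℝ, E) I (extChartAt I x.1).symm (range I) e.1 u.1,
        mfderivWithin 𝓘(ℝ, E') J (extChartAt J x.2).symm (range J) e.2 u.2) := by
  rw [extChartAt_prod] at he
  have h := ((mdifferentiableAt_extChartAt_symm he.1).hasMFDerivAt.prodMap
    (mdifferentiableAt_extChartAt_symm he.2).hasMFDerivAt).mfderiv
  rw [modelWithCornersSelf_prod, ← chartedSpaceSelf_prod, (I.prod J).range_eq_univ,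
    I.range_eq_univ, J.range_eq_univ]
  simp only [mfderivWithin_univ]
  exact congrArg (fun A : (E × E') →L[ℝ] E × E' ↦ A u) h

theorem twoFormInChart_prodTwoForm (Ω₁ : TwoForm I M) (Ω₂ : TwoForm J N) (x : M × N) :
    twoFormInChart (I.prod J) (prodTwoForm Ω₁ Ω₂) x =ᶠ[𝓝 (extChartAt (I.prod J) x x)]
      fun e ↦ bilinPullback (ContinuousLinearMap.fst ℝ E E') (twoFormInChart I Ω₁ x.1 e.1)
        + bilinPullback (ContinuousLinearMap.snd ℝ E E') (twoFormInChart J Ω₂ x.2 e.2) := by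
  filter_upwards [extChartAt_target_mem_nhds (I := I.prod J) x] with e he
  refine ContinuousLinearMap.ext fun u ↦ ContinuousLinearMap.ext fun v ↦ ?_
  exact (twoForm_congr _ rfl (mfderivWithin_extChartAt_prod_symm he u)
    (mfderivWithin_extChartAt_prod_symm he v)).trans (prodTwoForm_apply Ω₁ Ω₂ _ _ _ _ _)

theorem SmoothTwoForm.prodTwoForm {Ω₁ : TwoForm I M} {Ω₂ : TwoForm J N}
    (h₁ : SmoothTwoForm I Ω₁) (h₂ : SmoothTwoForm J Ω₂) :
    SmoothTwoForm (I.prod J) (prodTwoForm Ω₁ Ω₂) := by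
  rw [smoothTwoForm_iff]
  intro x
  refine ContDiffAt.congr_of_eventuallyEq ?_ (twoFormInChart_prodTwoForm Ω₁ Ω₂ x)
  have h := @contDiffAt_clm_fst_add_clm_snd E _ _ E' _ _ (E →L[ℝ] E →L[ℝ] ℝ)
    (E' →L[ℝ] E' →L[ℝ] ℝ) ((E × E') →L[ℝ] (E × E') →L[ℝ] ℝ)
  exact h (e := extChartAt (I.prod J) x x) ((smoothTwoForm_iff Ω₁).1 h₁ x.1)
    ((smoothTwoForm_iff Ω₂).1 h₂ x.2)

-- A shortcut: the general instance search times out on bilinear forms.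
noncomputable local instance : NormedAddCommGroup (E →L[ℝ] E →L[ℝ] ℝ) :=
  ContinuousLinearMap.toNormedAddCommGroup

theorem fderiv_twoFormInChart_prodTwoForm {Ω₁ : TwoForm I M} {Ω₂ : TwoForm J N}
    (h₁ : SmoothTwoForm I Ω₁) (h₂ : SmoothTwoForm J Ω₂) (x : M × N) (r s t : E × E') :
    fderiv ℝ (twoFormInChart (I.prod J) (prodTwoForm Ω₁ Ω₂) x) (extChartAt (I.prod J) x x) r s t
      = fderiv ℝ (twoFormInChart I Ω₁ x.1) (extChartAt I x.1 x.1) r.1 s.1 t.1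
        + fderiv ℝ (twoFormInChart J Ω₂ x.2) (extChartAt J x.2 x.2) r.2 s.2 t.2 := by
  have hΩ₁ := ((smoothTwoForm_iff Ω₁).1 h₁ x.1).differentiableAt (by simp)
  have hΩ₂ := ((smoothTwoForm_iff Ω₂).1 h₂ x.2).differentiableAt (by simp)
  rw [(twoFormInChart_prodTwoForm Ω₁ Ω₂ x).fderiv_eq]
  exact congrArg (fun A : (E × E') →L[ℝ] (E × E') →L[ℝ] ℝ ↦ A s t)
    (fderiv_clm_fst_add_clm_snd (e := extChartAt (I.prod J) x x) hΩ₁ hΩ₂ r)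

theorem extDeriv₂_prodTwoForm {Ω₁ : TwoForm I M} {Ω₂ : TwoForm J N}
    (h₁ : SmoothTwoForm I Ω₁) (h₂ : SmoothTwoForm J Ω₂) (x : M × N)
    (u v w : TangentSpace (I.prod J) x) :
    extDeriv₂ (I.prod J) (prodTwoForm Ω₁ Ω₂) x u v w
      = extDeriv₂ I Ω₁ x.1 u.1 v.1 w.1 + extDeriv₂ J Ω₂ x.2 u.2 v.2 w.2 := by
  have hD := fderiv_twoFormInChart_prodTwoForm h₁ h₂ x
  rw [extDeriv₂_eq]
  refine (congrArg₂ (· + ·) (congrArg₂ (· + ·) (hD u v w) (hD v w u)) (hD w u v)).trans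
    (Eq.trans ?_ (congrArg₂ (· + ·) (extDeriv₂_eq Ω₁ x.1 u.1 v.1 w.1)
      (extDeriv₂_eq Ω₂ x.2 u.2 v.2 w.2)).symm)
  ring

theorem IsSymplecticForm.prodTwoForm {Ω₁ : TwoForm I M} {Ω₂ : TwoForm J N}
    (h₁ : IsSymplecticForm I Ω₁) (h₂ : IsSymplecticForm J Ω₂) :
    IsSymplecticForm (I.prod J) (prodTwoForm Ω₁ Ω₂) where
  smooth := h₁.smooth.prodTwoForm h₂.smooth
  alternating := by
    rintro x ⟨v, w⟩
    exact (prodTwoForm_apply Ω₁ Ω₂ x v v w w).trans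
      ((congrArg₂ (· + ·) (h₁.alternating x.1 v) (h₂.alternating x.2 w)).trans (add_zero 0))
  nondegenerate := by
    rintro x ⟨v, w⟩ h
    have hv : v = 0 := h₁.nondegenerate x.1 v fun v' ↦ by
      simpa only [map_zero, add_zero] using
        (prodTwoForm_apply Ω₁ Ω₂ x v v' w 0).symm.trans (h (v', 0))
    have hw : w = 0 := h₂.nondegenerate x.2 w fun w' ↦ by
      simpa only [map_zero, zero_add] using
        (prodTwoForm_apply Ω₁ Ω₂ x v 0 w w').symm.trans (h (0, w'))
    exact Prod.ext hv hw
  closed x u v w := by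
    rw [extDeriv₂_prodTwoForm h₁.smooth h₂.smooth]
    exact (congrArg₂ (· + ·) (h₁.closed x.1 u.1 v.1 w.1) (h₂.closed x.2 u.2 v.2 w.2)).trans
      (add_zero 0)

end Smoothness

end Products

/-! ### Flows -/

section Flows

variable {E : Type*} [NormedAddCommGroup E] [NormedSpace ℝ E]
  {H : Type*} [TopologicalSpace H] {I : ModelWithCorners ℝ E H}
  {M : Type*} [TopologicalSpace M] [ChartedSpace H M]
  {V : Type*} [NormedAddCommGroup V] [NormedSpace ℝ V]
  {R : VField I M} {φ : Flow ℝ M} {η : OneForm I M}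

theorem mfderiv_apply_zero_right {f : ℝ × V → M} {t : ℝ} {e : V}
    (hf : MDifferentiableAt 𝓘(ℝ, ℝ × V) I f (t, e)) (a : ℝ) :
    (show E from mfderiv 𝓘(ℝ, ℝ × V) I f (t, e) (a, 0))
      = mfderiv 𝓘(ℝ, ℝ) I (fun s ↦ f (s, e)) t a := by
  have hinl : HasMFDerivAt 𝓘(ℝ, ℝ) 𝓘(ℝ, ℝ × V) (fun s : ℝ ↦ (s, e)) t
      (ContinuousLinearMap.inl ℝ ℝ V) :=
    ((hasFDerivAt_id t).prodMk (hasFDerivAt_const e t)).hasMFDerivAt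
  exact congrArg (fun A : ℝ →L[ℝ] E ↦ A a) (hf.hasMFDerivAt.comp t hinl).mfderiv.symm

theorem mfderiv_apply_zero_left {f : ℝ × V → M} {t : ℝ} {e : V}
    (hf : MDifferentiableAt 𝓘(ℝ, ℝ × V) I f (t, e)) (w : V) :
    (show E from mfderiv 𝓘(ℝ, ℝ × V) I f (t, e) (0, w))
      = mfderiv 𝓘(ℝ, V) I (fun e' ↦ f (t, e')) e w := by
  have hinr : HasMFDerivAt 𝓘(ℝ, V) 𝓘(ℝ, ℝ × V) (fun e' : V ↦ (t, e')) e
      (ContinuousLinearMap.inr ℝ ℝ V) :=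
    ((hasFDerivAt_const t e).prodMk (hasFDerivAt_id e)).hasMFDerivAt
  exact congrArg (fun A : V →L[ℝ] E ↦ A w) (hf.hasMFDerivAt.comp e hinr).mfderiv.symm

theorem IsFlowOf.contMDiff (h : IsFlowOf I R φ) (t : ℝ) : ContMDiff I I ∞ (φ t) :=
  h.smooth.comp (contMDiff_const.prodMk contMDiff_id)

theorem IsFlowOf.contMDiffAt_comp (h : IsFlowOf I R φ) {c : V → M} {e : V}
    (hc : ContMDiffAt 𝓘(ℝ, V) I ∞ c e) (t : ℝ) :
    ContMDiffAt 𝓘(ℝ, ℝ × V) I ∞ (fun q : ℝ × V ↦ φ q.1 (c q.2)) (t, e) := by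
  have hfst : ContMDiffAt 𝓘(ℝ, ℝ × V) 𝓘(ℝ, ℝ) ∞ Prod.fst (t, e) := contDiffAt_fst.contMDiffAt
  have hsnd : ContMDiffAt 𝓘(ℝ, ℝ × V) 𝓘(ℝ, V) ∞ Prod.snd (t, e) := contDiffAt_snd.contMDiffAt
  exact h.smooth.contMDiffAt.comp (t, e) (hfst.prodMk (hc.comp (t, e) hsnd))

theorem IsFlowOf.mfderiv_apply (h : IsFlowOf I R φ) (y : M) (t a : ℝ) :
    mfderiv 𝓘(ℝ, ℝ) I (fun s ↦ φ s y) t a = (show E from a • R (φ t y)) :=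
  congrArg (fun A : ℝ →L[ℝ] E ↦ A a) (h.integralCurve y t).mfderiv

theorem flatExtDeriv_of_eventually_eq_const {β : V → V →L[ℝ] ℝ} {e u : V} {c : ℝ}
    (hβ : DifferentiableAt ℝ β e) (hu : ∀ᶠ e' in 𝓝 e, β e' u = c) (v : V) :
    flatExtDeriv β e u v = fderiv ℝ β e u v := by
  have h := (hβ.hasFDerivAt.clm_apply (hasFDerivAt_const u e)).unique
    ((hasFDerivAt_const c e).congr_of_eventuallyEq hu)
  have h₀ : fderiv ℝ β e v u = 0 := by simpa using congrArg (fun A : V →L[ℝ] ℝ ↦ A v) h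
  rw [flatExtDeriv, h₀, sub_zero]

theorem eq_of_fderiv_inl_eq_zero {β : ℝ × V → ℝ × V →L[ℝ] ℝ} {e : V} {w : ℝ × V}
    (hβ : ∀ t, DifferentiableAt ℝ β (t, e)) (hw : ∀ t, fderiv ℝ β (t, e) (1, 0) w = 0) (s t : ℝ) :
    β (s, e) w = β (t, e) w := by
  have hderiv : ∀ t, HasDerivAt (fun t ↦ β (t, e) w) 0 t := fun t ↦ by
    have hinl : HasFDerivAt (fun s : ℝ ↦ (s, e)) (ContinuousLinearMap.inl ℝ ℝ V) t :=
      (hasFDerivAt_id t).prodMk (hasFDerivAt_const e t)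
    have h := ((hβ t).hasFDerivAt.comp t hinl).clm_apply (hasFDerivAt_const w t)
    simpa [hw t] using h.hasDerivAt
  exact is_const_of_deriv_eq_zero (fun t ↦ (hderiv t).differentiableAt)
    (fun t ↦ (hderiv t).deriv) s t

variable [IsManifold I ∞ M] [I.Boundaryless]

-- `β = f^*η` satisfies `β(∂ₜ) = 1` and `dβ(∂ₜ, w) = 0`, so `∂ₜ(β(w)) = dβ(∂ₜ, w) + w(β(∂ₜ)) = 0`.
theorem IsFlowOf.flatPullback_reeb (h : IsFlowOf I R φ) (hη : SmoothOneForm I η)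
    (hR : IsReebField I η R) {c : V → M} {e : V} (hc : ContMDiffAt 𝓘(ℝ, V) I ∞ c e) (w : V)
    (s t : ℝ) :
    flatPullback (fun q : ℝ × V ↦ φ q.1 (c q.2)) η (s, e) (0, w)
      = flatPullback (fun q : ℝ × V ↦ φ q.1 (c q.2)) η (t, e) (0, w) := by
  set f : ℝ × V → M := fun q ↦ φ q.1 (c q.2)
  have hfsmooth := h.contMDiffAt_comp hc
  have hf_one : ∀ {q : ℝ × V}, MDifferentiableAt 𝓘(ℝ, ℝ × V) I f q →
      mfderiv 𝓘(ℝ, ℝ × V) I f q (1, 0) = (show E from R (f q)) := fun {q} hq ↦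
    (mfderiv_apply_zero_right hq 1).trans
      ((h.mfderiv_apply (c q.2) q.1 1).trans (one_smul ℝ (R (f q))))
  have hβ : ∀ t, DifferentiableAt ℝ (flatPullback f η) (t, e) := fun t ↦
    (contDiffAt_flatPullback hη (hfsmooth t)).differentiableAt (by simp)
  refine eq_of_fderiv_inl_eq_zero hβ (fun t ↦ ?_) s t
  have hone : ∀ᶠ q in 𝓝 (t, e), flatPullback f η q (1, 0) = 1 := by
    filter_upwards [eventually_mdifferentiableAt (hfsmooth t)] with q hq
    exact (oneForm_congr η rfl (hf_one hq)).trans (hR.apply_one (f q))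
  rw [← flatExtDeriv_of_eventually_eq_const (hβ t) hone (0, w), ← extDeriv₁_mfderiv hη (hfsmooth t)]
  exact (extDeriv₁_congr η rfl (hf_one ((hfsmooth t).mdifferentiableAt (by simp))) rfl).trans
    (hR.extDeriv_zero (f (t, e)) _)

theorem IsFlowOf.pullback₁_reeb (h : IsFlowOf I R φ) (hη : SmoothOneForm I η)
    (hR : IsReebField I η R) (t : ℝ) : pullback₁ I (φ t) η = η := by
  funext y
  refine ContinuousLinearMap.ext fun w ↦ ?_
  have hc := contMDiffAt_extChartAt_symm (I := I) y
  have hpull : ∀ s, flatPullback (fun q : ℝ × E ↦ φ q.1 ((extChartAt I y).symm q.2)) η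
      (s, extChartAt I y y) (0, w) = pullback₁ I (φ s) η y w := fun s ↦
    oneForm_congr η (congrArg (φ s) (extChartAt_to_inv y))
      ((mfderiv_apply_zero_left ((h.contMDiffAt_comp hc s).mdifferentiableAt (by simp)) w).trans
        (mfderiv_comp_extChartAt_symm ((h.contMDiff s).mdifferentiable (by simp) y) w))
  have hzero : pullback₁ I (φ 0) η y w = η y w := by
    have hid : (φ 0 : M → M) = id := funext φ.map_zero_apply
    rw [hid]
    exact oneForm_congr η rfl (congrArg (fun A : E →L[ℝ] E ↦ A w) mfderiv_id)
  rw [← hpull, h.flatPullback_reeb hη hR hc w t 0, hpull, hzero]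

end Flows

/-! ### Submersions with local sections and principal contactifications -/

section Contactifications

variable {E : Type*} [NormedAddCommGroup E] [NormedSpace ℝ E]
  {H : Type*} [TopologicalSpace H] {I : ModelWithCorners ℝ E H}
  {M : Type*} [TopologicalSpace M] [ChartedSpace H M]
  {E' : Type*} [NormedAddCommGroup E'] [NormedSpace ℝ E']
  {H' : Type*} [TopologicalSpace H'] {J : ModelWithCorners ℝ E' H'}
  {N : Type*} [TopologicalSpace N] [ChartedSpace H' N]
  {V : Type*} [NormedAddCommGroup V] [NormedSpace ℝ V]
  {η : OneForm I M} {R : VField I M} {φ : Flow ℝ M} {p : M → N} {Ω : TwoForm J N} {ρ : ENNReal}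

theorem bijective_prod_of_finrank [FiniteDimensional ℝ E] [FiniteDimensional ℝ E']
    {A : E →L[ℝ] ℝ} {B : E →L[ℝ] E'} {r : E} (hA : A r = 1) (hB : B r = 0) (hB' : Surjective B)
    (hd : Module.finrank ℝ E = Module.finrank ℝ E' + 1) : Bijective (A.prod B) := by
  have hs : Surjective (A.prod B).toLinearMap := by
    rintro ⟨a, b⟩
    obtain ⟨v, hv⟩ := hB' b
    exact ⟨v + (a - A v) • r, Prod.ext (by simp [hA]) (by simp [hB, hv])⟩
  have hf : Module.finrank ℝ E = Module.finrank ℝ (ℝ × E') := by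
    rw [hd, Module.finrank_prod, Module.finrank_self, add_comm]
  exact ⟨(LinearMap.injective_iff_surjective_of_finrank_eq_finrank hf).2 hs, hs⟩

theorem IsFlowOf.mfderiv_comp_eq_zero (hφ : IsFlowOf I R φ) (hp : MDifferentiable I J p)
    (hinv : ∀ y t, p (φ t y) = p y) (y : M) : mfderiv I J p y (R y) = 0 := by
  have hconst : p ∘ (fun t ↦ φ t y) = fun _ ↦ p y := funext fun t ↦ hinv y t
  have hcomp := (hp (φ 0 y)).hasMFDerivAt.comp (0 : ℝ) (hφ.integralCurve y 0)
  rw [hconst] at hcomp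
  refine (mfderiv_apply_congr (I := I) (J := J) p (φ.map_zero_apply y).symm ?_).trans
    (congrArg (fun A : ℝ →L[ℝ] E' ↦ A 1) (hasMFDerivAt_unique hcomp (hasMFDerivAt_const _ _)))
  exact (congrArg (fun z ↦ (show E from R z)) (φ.map_zero_apply y).symm).trans
    (one_smul ℝ (show E from R (φ 0 y))).symm

theorem exists_contMDiffAt_rightInverse [IsManifold I ∞ M] [CompleteSpace E] [CompleteSpace V]
    {f : V → M} {e : V} (hf : ContMDiffAt 𝓘(ℝ, V) I ∞ f e)
    (hbij : Bijective (mfderiv 𝓘(ℝ, V) I f e)) :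
    ∃ g : M → V, ContMDiffAt I 𝓘(ℝ, V) ∞ g (f e) ∧ g (f e) = e ∧
      ∀ᶠ y in 𝓝 (f e), f (g y) = y := by
  have hfc := contDiffAt_extChartAt_comp hf
  have hchart : ContMDiffAt I 𝓘(ℝ, E) ∞ (extChartAt I (f e)) (f e) := contMDiffAt_extChartAt
  have hker : Bijective (fderiv ℝ (extChartAt I (f e) ∘ f) e) := by
    rw [fderiv_extChartAt_comp (hf.mdifferentiableAt (by simp)) (mem_extChartAt_source _)]
    exact (isInvertible_mfderiv_extChartAt (mem_extChartAt_source (I := I) (f e))).bijective.comp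
      hbij
  obtain ⟨A, hA⟩ : ∃ A : V ≃L[ℝ] E, (A : V →L[ℝ] E) = fderiv ℝ (extChartAt I (f e) ∘ f) e :=
    ⟨.ofBijective _ (LinearMap.ker_eq_bot.2 hker.1) (LinearMap.range_eq_top.2 hker.2),
      ContinuousLinearEquiv.coe_ofBijective _ _ _⟩
  have hderiv : HasFDerivAt (extChartAt I (f e) ∘ f) (A : V →L[ℝ] E) e :=
    hA ▸ (hfc.differentiableAt (by simp)).hasFDerivAt
  set G : E → V := hfc.localInverse hderiv (by simp)
  have hG₀ : G (extChartAt I (f e) (f e)) = e := hfc.localInverse_apply_image hderiv (by simp)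
  have hG : ContMDiffAt I 𝓘(ℝ, V) ∞ (fun y ↦ G (extChartAt I (f e) y)) (f e) :=
    ContMDiffAt.comp (f e) (g := G) (hfc.to_localInverse hderiv (by simp)).contMDiffAt hchart
  have hright : ∀ᶠ z in 𝓝 (extChartAt I (f e) (f e)), extChartAt I (f e) (f (G z)) = z :=
    (hfc.hasStrictFDerivAt' hderiv (by simp)).eventually_right_inverse
  have hcont : Filter.Tendsto (fun y ↦ f (G (extChartAt I (f e) y))) (𝓝 (f e)) (𝓝 (f e)) := by
    have h := hG.continuousAt.tendsto
    rw [hG₀] at h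
    exact hf.continuousAt.tendsto.comp h
  refine ⟨fun y ↦ G (extChartAt I (f e) y), hG, hG₀, ?_⟩
  filter_upwards [hchart.continuousAt.eventually hright, extChartAt_source_mem_nhds (I := I) (f e),
    hcont.eventually (extChartAt_source_mem_nhds (I := I) (f e))] with y hy hysource hfsource
  exact (extChartAt I (f e)).injOn hfsource hysource hy

theorem mfderiv_mfderiv_rightInverse {f : M → N} {s : N → M} {x : N}
    (hf : MDifferentiableAt I J f (s x)) (hs : MDifferentiableAt J I s x)
    (hfs : ∀ᶠ x' in 𝓝 x, f (s x') = x') (v : TangentSpace J x) :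
    mfderiv I J f (s x) (mfderiv J I s x v) = (show E' from v) := by
  have hcomp := hf.hasMFDerivAt.comp x hs.hasMFDerivAt
  exact congrArg (fun A : E' →L[ℝ] E' ↦ A v) (hasMFDerivAt_unique
    (hcomp.congr_of_eventuallyEq (hfs.mono fun _ hx ↦ hx.symm)) (hasMFDerivAt_id x))

/-- A smooth map with smooth local sections through every point of its domain. It plays the role
of a submersion in arguments that descend objects from `M` to `N`. -/
structure HasSmoothLocalSections (I : ModelWithCorners ℝ E H) (J : ModelWithCorners ℝ E' H')
    (f : M → N) : Prop where
  smooth : ContMDiff I J ∞ f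
  exists_section : ∀ y, ∃ (U : Set N) (s : N → M), IsOpen U ∧ f y ∈ U ∧ ContMDiffOn J I ∞ s U ∧
    (∀ x ∈ U, f (s x) = x) ∧ s (f y) = y

namespace HasSmoothLocalSections

variable {f : M → N} (hf : HasSmoothLocalSections I J f)
include hf

theorem exists_contMDiffAt_section (y : M) : ∃ s : N → M, ContMDiffAt J I ∞ s (f y) ∧
    (∀ᶠ x in 𝓝 (f y), f (s x) = x) ∧ s (f y) = y := by
  obtain ⟨U, s, hU, hy, hs, hfs, hsy⟩ := hf.exists_section y
  exact ⟨s, hs.contMDiffAt (hU.mem_nhds hy), Filter.mem_of_superset (hU.mem_nhds hy) hfs, hsy⟩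

theorem surjective_mfderiv (y : M) : Surjective (mfderiv I J f y) := by
  obtain ⟨s, hs, hfs, hsy⟩ := hf.exists_contMDiffAt_section y
  exact fun v ↦ ⟨(show E from mfderiv J I s (f y) v),
    (mfderiv_apply_congr (I := I) (J := J) f hsy.symm rfl).trans
      (mfderiv_mfderiv_rightInverse (hf.smooth.mdifferentiable (by simp) _)
        (hs.mdifferentiableAt (by simp)) hfs v)⟩

theorem isSmoothSubmersion : IsSmoothSubmersion I J f := ⟨hf.smooth, hf.surjective_mfderiv⟩

variable {F : Type*} [NormedAddCommGroup F] [NormedSpace ℝ F]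
  {G : Type*} [TopologicalSpace G] {K : ModelWithCorners ℝ F G}
  {P : Type*} [TopologicalSpace P] [ChartedSpace G P]

theorem contMDiffAt_of_comp {g : N → P} {y : M} (hg : ContMDiffAt I K ∞ (g ∘ f) y) :
    ContMDiffAt J K ∞ g (f y) := by
  obtain ⟨s, hs, hfs, hsy⟩ := hf.exists_contMDiffAt_section y
  have hgs : ContMDiffAt J K ∞ ((g ∘ f) ∘ s) (f y) := ContMDiffAt.comp _ (by rwa [hsy]) hs
  exact hgs.congr_of_eventuallyEq (hfs.mono fun x hx ↦ congrArg g hx.symm)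

theorem contMDiffOn_iff (hsurj : Surjective f) {g : N → P} {U : Set N} (hU : IsOpen U) :
    ContMDiffOn J K ∞ g U ↔ ContMDiffOn I K ∞ (g ∘ f) (f ⁻¹' U) := by
  refine ⟨fun h ↦ h.comp hf.smooth.contMDiffOn Subset.rfl, fun h x hx ↦ ?_⟩
  obtain ⟨y, rfl⟩ := hsurj x
  exact (hf.contMDiffAt_of_comp (h.contMDiffAt
    ((hU.preimage hf.smooth.continuous).mem_nhds hx))).contMDiffWithinAt

theorem contMDiff_iff (hsurj : Surjective f) {g : N → P} :
    ContMDiff J K ∞ g ↔ ContMDiff I K ∞ (g ∘ f) := by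
  rw [← contMDiffOn_univ, hf.contMDiffOn_iff hsurj isOpen_univ, preimage_univ, contMDiffOn_univ]

end HasSmoothLocalSections

namespace IsPrincipalContactification

variable [IsManifold I ∞ M] [IsManifold J ∞ N] (h : IsPrincipalContactification I J η R φ p Ω ρ)
include h

theorem proj_flow (y : M) (t : ℝ) : p (φ t y) = p y :=
  ((h.orbits y (φ t y)).2 ⟨t, rfl⟩).symm

theorem flow_eq_iff (y : M) (s t : ℝ) : φ s y = φ t y ↔ s - t ∈ periodGroup ρ := by
  rw [← h.period (φ t y), ← φ.map_add, sub_add_cancel]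

theorem mfderiv_proj_reeb (y : M) : mfderiv I J p y (R y) = 0 :=
  h.flow.mfderiv_comp_eq_zero (h.submersion.smooth.mdifferentiable (by simp)) h.proj_flow y

theorem hasSmoothLocalSections : HasSmoothLocalSections I J p := by
  refine ⟨h.submersion.smooth, fun y ↦ ?_⟩
  obtain ⟨U, σ, hU, hy, hσ, hpσ⟩ := h.localSection (p y)
  obtain ⟨t, ht⟩ := (h.orbits (σ (p y)) y).1 (hpσ _ hy)
  exact ⟨U, fun x ↦ φ t (σ x), hU, hy, (h.flow.contMDiff t).comp_contMDiffOn hσ,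
    fun x hx ↦ (h.proj_flow _ _).trans (hpσ x hx), ht⟩

theorem injective_mfderiv_flow_comp {c : V → M} {e : V} (hc : ContMDiffAt 𝓘(ℝ, V) I ∞ c e)
    (hpc : Injective (mfderiv 𝓘(ℝ, V) J (p ∘ c) e)) (t : ℝ) :
    Injective (mfderiv 𝓘(ℝ, ℝ × V) I (fun q : ℝ × V ↦ φ q.1 (c q.2)) (t, e)) := by
  set f : ℝ × V → M := fun q ↦ φ q.1 (c q.2)
  have hp := h.submersion.smooth.mdifferentiable (n := ∞) (by simp)
  have hf : MDifferentiableAt 𝓘(ℝ, ℝ × V) I f (t, e) :=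
    (h.flow.contMDiffAt_comp hc t).mdifferentiableAt (by simp)
  have hsnd : HasMFDerivAt 𝓘(ℝ, ℝ × V) 𝓘(ℝ, V) (Prod.snd : ℝ × V → V) (t, e)
      (ContinuousLinearMap.snd ℝ ℝ V) := (hasFDerivAt_snd (p := (t, e))).hasMFDerivAt
  have hpf : p ∘ f = (p ∘ c) ∘ Prod.snd := funext fun q ↦ h.proj_flow (c q.2) q.1
  have hcomp := ((hp (c e)).comp e (hc.mdifferentiableAt (by simp))).hasMFDerivAt.comp (t, e) hsnd
  have hderiv := hasMFDerivAt_unique (hpf ▸ (hp (f (t, e))).hasMFDerivAt.comp (t, e)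
    hf.hasMFDerivAt) hcomp
  refine (injective_iff_map_eq_zero (show (ℝ × V) →L[ℝ] E from mfderiv _ I f (t, e))).2 ?_
  rintro ⟨a, w⟩ hq
  have hw : w = 0 := hpc <|
    (congrArg (fun A : (ℝ × V) →L[ℝ] E' ↦ A (a, w)) hderiv).symm.trans
      ((congrArg (show E →L[ℝ] E' from mfderiv I J p (f (t, e))) hq).trans
        ((map_zero _).trans (map_zero (show V →L[ℝ] E' from mfderiv _ J (p ∘ c) e)).symm))
  subst hw
  have hR : a • (show E from R (f (t, e))) = 0 :=
    ((mfderiv_apply_zero_right hf a).trans (h.flow.mfderiv_apply (c e) t a)).symm.trans hq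
  have ha : a • (1 : ℝ) = 0 := by
    rw [← h.reeb.apply_one (f (t, e))]
    exact ((show E →L[ℝ] ℝ from η (f (t, e))).map_smul a _).symm.trans
      ((congrArg (show E →L[ℝ] ℝ from η (f (t, e))) hR).trans (map_zero _))
  exact Prod.ext (by simpa using ha) rfl

variable [FiniteDimensional ℝ E] [FiniteDimensional ℝ E']
  (hd : Module.finrank ℝ E = Module.finrank ℝ E' + 1)
include hd

theorem prod_bijective (y : M) : Bijective ((η y).prod (mfderiv I J p y)) :=
  bijective_prod_of_finrank (A := show E →L[ℝ] ℝ from η y)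
    (B := show E →L[ℝ] E' from mfderiv I J p y) (r := show E from R y) (h.reeb.apply_one y)
    (h.mfderiv_proj_reeb y) (h.submersion.surjective_mfderiv y) hd

theorem eq_of_apply_eq {y : M} {v w : TangentSpace I y} (hη : η y v = η y w)
    (hp : mfderiv I J p y v = mfderiv I J p y w) : v = w :=
  (h.prod_bijective hd y).1 (Prod.ext hη hp)

theorem horizontalLift_spec (y : M) (v : TangentSpace J (p y)) :
    η y (horizontalLift η p y v) = 0 ∧ mfderiv I J p y (horizontalLift η p y v) = v := by
  set L : E →L[ℝ] ℝ × E' := (show E →L[ℝ] ℝ from η y).prod (show E →L[ℝ] E' from mfderiv I J p y)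
  have hL : Bijective L := h.prod_bijective hd y
  have hinv : L.IsInvertible :=
    ⟨.ofBijective L (LinearMap.ker_eq_bot.2 hL.1) (LinearMap.range_eq_top.2 hL.2),
      ContinuousLinearEquiv.coe_ofBijective _ _ _⟩
  have hv : L (L.inverse (0, v)) = (0, v) := hinv.self_apply_inverse _
  exact ⟨congrArg Prod.fst hv, congrArg Prod.snd hv⟩

theorem eq_horizontalLift {y : M} {w : TangentSpace I y} {v : TangentSpace J (p y)}
    (hη : η y w = 0) (hp : mfderiv I J p y w = v) : w = horizontalLift η p y v :=
  h.eq_of_apply_eq hd (hη.trans (h.horizontalLift_spec hd y v).1.symm)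
    (hp.trans (h.horizontalLift_spec hd y v).2.symm)

-- `(t, e) ↦ φ t (σ e)`, with `e` in a chart of `N`, is a local diffeomorphism; its inverse has the
-- required time as first component.
theorem exists_time [J.Boundaryless] {σ : N → M} {y₀ : M} (hσ : ContMDiffAt J I ∞ σ (p y₀))
    (hpσ : ∀ᶠ x in 𝓝 (p y₀), p (σ x) = x) {t₀ : ℝ} (ht₀ : φ t₀ (σ (p y₀)) = y₀) :
    ∃ τ : M → ℝ, ContMDiffAt I 𝓘(ℝ, ℝ) ∞ τ y₀ ∧ τ y₀ = t₀ ∧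
      ∀ᶠ y in 𝓝 y₀, φ (τ y) (σ (p y)) = y := by
  set e₀ := extChartAt J (p y₀) (p y₀)
  set c : E' → M := σ ∘ (extChartAt J (p y₀)).symm
  have hx : (extChartAt J (p y₀)).symm e₀ = p y₀ := extChartAt_to_inv (p y₀)
  have hsymm := contMDiffAt_extChartAt_symm (I := J) (p y₀)
  have hc : ContMDiffAt 𝓘(ℝ, E') I ∞ c e₀ := ContMDiffAt.comp e₀ (by rwa [hx]) hsymm
  have hpc : ∀ᶠ e in 𝓝 e₀, p (c e) = (extChartAt J (p y₀)).symm e :=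
    hsymm.continuousAt.eventually (by rwa [hx])
  have hinj : Injective (mfderiv 𝓘(ℝ, E') J (p ∘ c) e₀) := by
    rw [Filter.EventuallyEq.mfderiv_eq (f₁ := p ∘ c) hpc]
    exact (congrArg (fun A : E' →L[ℝ] E' ↦ Injective A)
      (mfderiv_extChartAt_symm_self (I := J) (p y₀))).mpr injective_id
  set f : ℝ × E' → M := fun q ↦ φ q.1 (c q.2)
  have hf₀ : f (t₀, e₀) = y₀ := (congrArg (fun x ↦ φ t₀ (σ x)) hx).trans ht₀
  have hfinj := h.injective_mfderiv_flow_comp hc hinj t₀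
  have hfr : Module.finrank ℝ (ℝ × E') = Module.finrank ℝ E := by
    rw [hd, Module.finrank_prod, Module.finrank_self, add_comm]
  have := FiniteDimensional.complete ℝ E
  have := FiniteDimensional.complete ℝ E'
  obtain ⟨g, hg, hg₀, hfg⟩ := exists_contMDiffAt_rightInverse (h.flow.contMDiffAt_comp hc t₀)
    ⟨hfinj, (LinearMap.injective_iff_surjective_of_finrank_eq_finrank
      (f := (show (ℝ × E') →L[ℝ] E from mfderiv _ I f (t₀, e₀)).toLinearMap) hfr).1 hfinj⟩
  change ContMDiffAt I 𝓘(ℝ, ℝ × E') ∞ g (f (t₀, e₀)) at hg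
  change g (f (t₀, e₀)) = (t₀, e₀) at hg₀
  change ∀ᶠ y in 𝓝 (f (t₀, e₀)), f (g y) = y at hfg
  rw [hf₀] at hg hg₀ hfg
  refine ⟨fun y ↦ (g y).1, ContMDiffAt.comp y₀ contDiffAt_fst.contMDiffAt hg,
    congrArg Prod.fst hg₀, ?_⟩
  have hsnd : Filter.Tendsto (fun y ↦ (g y).2) (𝓝 y₀) (𝓝 e₀) := by
    have := continuousAt_snd.tendsto.comp hg.continuousAt.tendsto
    rwa [hg₀] at this
  filter_upwards [hfg, hsnd.eventually hpc] with y hy hyc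
  have hproj : p y = (extChartAt J (p y₀)).symm (g y).2 :=
    ((congrArg p hy).symm.trans (h.proj_flow _ _)).trans hyc
  rw [hproj]
  exact hy

end IsPrincipalContactification

end Contactifications

/-! ### The Hermitian line bundle of a principal contactification -/

section Phase

variable (ρ : ENNReal)

theorem phase_zero : phase ρ 0 = 1 := by simp [phase]

theorem phase_add (s t : ℝ) : phase ρ (s + t) = phase ρ s * phase ρ t := by
  unfold phase
  rw [← Complex.exp_add]
  congr 1
  push_cast
  ring

theorem phase_mul_conj (t : ℝ) : phase ρ t * (starRingEnd ℂ) (phase ρ t) = 1 := by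
  rw [Complex.mul_conj, Complex.normSq_eq_norm_sq, phase, ← Complex.ofReal_neg,
    Complex.norm_exp_ofReal_mul_I]
  simp

theorem phase_of_mem {t : ℝ} (ht : t ∈ periodGroup ρ) : phase ρ t = 1 := by
  obtain ⟨k, rfl⟩ := AddSubgroup.mem_zmultiples_iff.1 ht
  unfold phase
  rcases eq_or_ne ρ.toReal 0 with hρ | hρ
  · simp [hρ]
  · rw [zsmul_eq_mul, mul_div_assoc, div_self hρ, mul_one, Complex.exp_eq_one_iff]
    exact ⟨-k, by push_cast; ring⟩

theorem hasDerivAt_phase (t : ℝ) :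
    HasDerivAt (phase ρ) (-(2 * Real.pi / ρ.toReal : ℝ) * Complex.I * phase ρ t) t := by
  have harg : HasDerivAt (fun t : ℝ ↦ -((2 * Real.pi * (t / ρ.toReal) : ℝ) : ℂ) * Complex.I)
      (-((2 * Real.pi * (1 / ρ.toReal) : ℝ) : ℂ) * Complex.I) t :=
    ((((hasDerivAt_id t).div_const ρ.toReal).const_mul (2 * Real.pi)).ofReal_comp.neg).mul_const _
  refine harg.cexp.congr_deriv ?_
  unfold phase
  push_cast
  ring

theorem contDiff_phase : ContDiff ℝ ∞ (phase ρ) :=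
  ((Complex.ofRealCLM.contDiff.comp
    (contDiff_const.mul (contDiff_id.div_const ρ.toReal))).neg.mul contDiff_const).cexp

end Phase

instance contMDiffMul_of_normedAlgebra {A : Type*} [NormedRing A] [NormedAlgebra ℝ A] :
    ContMDiffMul 𝓘(ℝ, A) ∞ A where
  contMDiff_mul := contDiff_mul.comp_contMDiff (contMDiff_fst.prodMk_space contMDiff_snd)

section Fibers

variable {E : Type*} [NormedAddCommGroup E] [NormedSpace ℝ E]
  {H : Type*} [TopologicalSpace H] {I : ModelWithCorners ℝ E H}
  {M : Type*} [TopologicalSpace M] [ChartedSpace H M]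
  {E' : Type*} [NormedAddCommGroup E'] [NormedSpace ℝ E']
  {H' : Type*} [TopologicalSpace H'] {J : ModelWithCorners ℝ E' H'}
  {N : Type*}
  {η : OneForm I M} {R : VField I M} {φ : Flow ℝ M} {p : M → N} {ρ : ENNReal}

theorem sectionFun_eq (ψ : Π x, equivariantFunctions φ p ρ x) {x : N} (y : {y : M // p y = x}) :
    sectionFun ψ y.1 = (ψ x).1 y := by
  obtain ⟨y, rfl⟩ := y
  rfl

/-- Evaluation of the elements of a fibre of the prequantum bundle at a point of the corresponding
fibre of `p`. -/
def evalFiber (φ : Flow ℝ M) (p : M → N) (ρ : ENNReal) {x : N} (y : {y : M // p y = x}) :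
    equivariantFunctions φ p ρ x →ₗ[ℂ] ℂ where
  toFun f := f.1 y
  map_add' _ _ := rfl
  map_smul' _ _ := rfl

variable [TopologicalSpace N] [ChartedSpace H' N] {Ω : TwoForm J N}
  [IsManifold I ∞ M] [IsManifold J ∞ N]

namespace IsPrincipalContactification

variable (h : IsPrincipalContactification I J η R φ p Ω ρ)
include h

theorem sectionFun_flow (ψ : Π x, equivariantFunctions φ p ρ x) (t : ℝ) (y : M) :
    sectionFun ψ (φ t y) = phase ρ t * sectionFun ψ y :=
  (sectionFun_eq ψ ⟨φ t y, h.proj_flow y t⟩).trans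
    ((ψ (p y)).2 ⟨y, rfl⟩ ⟨φ t y, h.proj_flow y t⟩ t rfl)

theorem exists_time_fiber {x : N} (y y' : {y : M // p y = x}) : ∃ t, φ t y = y' :=
  (h.orbits y y').1 (y.2.trans y'.2.symm)

theorem phase_eq {y : M} {s t : ℝ} (hst : φ s y = φ t y) : phase ρ s = phase ρ t := by
  rw [← sub_add_cancel s t, phase_add, phase_of_mem ρ ((h.flow_eq_iff y s t).1 hst), one_mul]

theorem evalFiber_bijective {x : N} (y : {y : M // p y = x}) :
    Bijective (evalFiber φ p ρ y) := by
  refine ⟨fun f g hfg ↦ Subtype.ext (funext fun y' ↦ ?_), fun c ↦ ?_⟩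
  · obtain ⟨t, ht⟩ := h.exists_time_fiber y y'
    rw [f.2 y y' t ht, g.2 y y' t ht]
    exact congrArg _ hfg
  · choose τ hτ using h.exists_time_fiber y
    refine ⟨⟨fun y' ↦ phase ρ (τ y') * c, fun y₁ y₂ t ht ↦ ?_⟩, ?_⟩
    · have hflow : φ (τ y₂) y = φ (t + τ y₁) y := by rw [φ.map_add, hτ, hτ, ht]
      change phase ρ (τ y₂) * c = phase ρ t * (phase ρ (τ y₁) * c)
      rw [h.phase_eq hflow, phase_add, mul_assoc]
    · change phase ρ (τ y) * c = c
      rw [phase_of_mem ρ ((h.period _ _).1 (hτ y)), one_mul]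

/-- The identification of a fibre of the prequantum bundle with `ℂ` given by evaluation at a point
of the corresponding fibre of `p`. -/
noncomputable def evalEquiv {x : N} (y : {y : M // p y = x}) :
    equivariantFunctions φ p ρ x ≃ₗ[ℂ] ℂ :=
  LinearEquiv.ofBijective (evalFiber φ p ρ y) (h.evalFiber_bijective y)

theorem evalEquiv_symm_apply {x : N} (y : {y : M // p y = x}) (c : ℂ) :
    ((h.evalEquiv y).symm c).1 y = c :=
  (h.evalEquiv y).apply_symm_apply c

theorem fiber_ext {x : N} (y : {y : M // p y = x}) {f g : equivariantFunctions φ p ρ x}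
    (hfg : f.1 y = g.1 y) : f = g :=
  (h.evalFiber_bijective y).1 hfg

open Classical in
/-- The section of the prequantum bundle with value `1` on the image of a local section `σ` of `p`.
It is set to zero where `σ` is not a section. -/
noncomputable def frame (σ : N → M) (x : N) : equivariantFunctions φ p ρ x :=
  if hx : p (σ x) = x then (h.evalEquiv ⟨σ x, hx⟩).symm 1 else 0

theorem frame_apply {σ : N → M} {x : N} (hx : p (σ x) = x) : (h.frame σ x).1 ⟨σ x, hx⟩ = 1 := by
  rw [frame, dif_pos hx]
  exact h.evalEquiv_symm_apply _ 1

theorem existsUnique_eq_smul_frame {σ : N → M} {x : N} (hx : p (σ x) = x)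
    (ξ : equivariantFunctions φ p ρ x) : ∃! c : ℂ, ξ = c • h.frame σ x := by
  have hsmul : ∀ c : ℂ, (c • h.frame σ x).1 ⟨σ x, hx⟩ = c := fun c ↦
    (congrArg (c * ·) (h.frame_apply hx)).trans (mul_one c)
  exact ⟨ξ.1 ⟨σ x, hx⟩, h.fiber_ext ⟨σ x, hx⟩ (hsmul _).symm, fun c hc ↦ hc ▸ (hsmul c).symm⟩

theorem sectionFun_smul_frame (f : N → ℂ) {σ : N → M} {x : N} (hx : p (σ x) = x) :
    sectionFun (fun x' ↦ f x' • h.frame σ x') (σ x) = f x :=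
  (sectionFun_eq _ ⟨σ x, hx⟩).trans
    ((congrArg (f x * ·) (h.frame_apply hx)).trans (mul_one (f x)))

theorem herm_eq {x : N} (y : {y : M // p y = x}) (f g : equivariantFunctions φ p ρ x) :
    (prequantumBundle h).herm x f g = f.1 y * (starRingEnd ℂ) (g.1 y) := by
  set y₀ : {y : M // p y = x} := ⟨surjInv h.surjective x, surjInv_eq h.surjective x⟩
  obtain ⟨t, ht⟩ := h.exists_time_fiber y₀ y
  change f.1 y₀ * (starRingEnd ℂ) (g.1 y₀) = _
  rw [f.2 y₀ y t ht, g.2 y₀ y t ht, map_mul, mul_mul_mul_comm, phase_mul_conj, one_mul]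

theorem herm_comp_proj (ψ ψ' : Π x, equivariantFunctions φ p ρ x) :
    (fun x ↦ (prequantumBundle h).herm x (ψ x) (ψ' x)) ∘ p
      = fun y ↦ sectionFun ψ y * (starRingEnd ℂ) (sectionFun ψ' y) :=
  funext fun y ↦ h.herm_eq ⟨y, rfl⟩ (ψ (p y)) (ψ' (p y))

theorem contMDiffOn_herm {ψ ψ' : Π x, equivariantFunctions φ p ρ x} {U : Set N} (hU : IsOpen U)
    (hψ : ContMDiffOn I 𝓘(ℝ, ℂ) ∞ (sectionFun ψ) (p ⁻¹' U))
    (hψ' : ContMDiffOn I 𝓘(ℝ, ℂ) ∞ (sectionFun ψ') (p ⁻¹' U)) :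
    ContMDiffOn J 𝓘(ℝ, ℂ) ∞ (fun x ↦ (prequantumBundle h).herm x (ψ x) (ψ' x)) U := by
  rw [h.hasSmoothLocalSections.contMDiffOn_iff h.surjective hU, h.herm_comp_proj]
  exact hψ.mul (Complex.conjCLE.contDiff.contMDiff.comp_contMDiffOn hψ')

variable [J.Boundaryless] [FiniteDimensional ℝ E] [FiniteDimensional ℝ E']
  (hd : Module.finrank ℝ E = Module.finrank ℝ E' + 1)
include hd

theorem contMDiffAt_sectionFun_of_comp {σ : N → M} {y₀ : M} (hσ : ContMDiffAt J I ∞ σ (p y₀))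
    (hpσ : ∀ᶠ x in 𝓝 (p y₀), p (σ x) = x) {ψ : Π x, equivariantFunctions φ p ρ x}
    (hψ : ContMDiffAt J 𝓘(ℝ, ℂ) ∞ (fun x ↦ sectionFun ψ (σ x)) (p y₀)) :
    ContMDiffAt I 𝓘(ℝ, ℂ) ∞ (sectionFun ψ) y₀ := by
  obtain ⟨t, ht⟩ := (h.orbits (σ (p y₀)) y₀).1 hpσ.self_of_nhds
  obtain ⟨τ, hτ, -, hτσ⟩ := h.exists_time hd hσ hpσ ht
  have hphase : ContMDiffAt I 𝓘(ℝ, ℂ) ∞ (fun y ↦ phase ρ (τ y)) y₀ :=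
    (contDiff_phase ρ).contMDiff.contMDiffAt.comp y₀ hτ
  have hσψ : ContMDiffAt I 𝓘(ℝ, ℂ) ∞ (fun y ↦ sectionFun ψ (σ (p y))) y₀ :=
    hψ.comp y₀ h.submersion.smooth.contMDiffAt
  refine (hphase.mul hσψ).congr_of_eventuallyEq ?_
  filter_upwards [hτσ] with y hy
  exact (congrArg (sectionFun ψ) hy).symm.trans (h.sectionFun_flow ψ _ _)

theorem contMDiffOn_sectionFun_iff {σ : N → M} {V : Set N} (hV : IsOpen V)
    (hσ : ContMDiffOn J I ∞ σ V) (hpσ : ∀ x ∈ V, p (σ x) = x)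
    (ψ : Π x, equivariantFunctions φ p ρ x) :
    ContMDiffOn I 𝓘(ℝ, ℂ) ∞ (sectionFun ψ) (p ⁻¹' V)
      ↔ ContMDiffOn J 𝓘(ℝ, ℂ) ∞ (fun x ↦ sectionFun ψ (σ x)) V := by
  refine ⟨fun hψ ↦ hψ.comp hσ fun x hx ↦ ?_, fun hψ y hy ↦ ?_⟩
  · change p (σ x) ∈ V
    rwa [hpσ x hx]
  · have hVy : V ∈ 𝓝 (p y) := hV.mem_nhds hy
    exact (h.contMDiffAt_sectionFun_of_comp hd (hσ.contMDiffAt hVy)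
      (Filter.mem_of_superset hVy hpσ) (hψ.contMDiffAt hVy)).contMDiffWithinAt

theorem isHermitianLineBundle : (prequantumBundle h).IsHermitianLineBundle where
  smoothOn_congr ψ ψ' U _ hψ hs :=
    ContMDiffOn.congr (f := sectionFun ψ) hs fun y hy ↦
      congrArg (fun f : equivariantFunctions φ p ρ (p y) ↦ f.1 ⟨y, rfl⟩) (hψ (p y) hy).symm
  smoothOn_iff_locally ψ U hU := by
    refine ⟨fun hs x hx ↦ ⟨U, Subset.rfl, hU, hx, hs⟩, fun hs y hy ↦ ?_⟩
    obtain ⟨V, -, hV, hyV, hsV⟩ := hs (p y) hy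
    have hyV' := (hV.preimage h.submersion.smooth.continuous).mem_nhds hyV
    exact (ContMDiffOn.contMDiffAt (f := sectionFun ψ) hsV hyV').contMDiffWithinAt
  localFrame x := by
    obtain ⟨U, σ, hU, hx, hσ, hpσ⟩ := h.localSection x
    refine ⟨U, h.frame σ, hU, hx, fun x' hx' ↦ h.existsUnique_eq_smul_frame (hpσ x' hx'),
      fun V hVU hV f ↦ ?_⟩
    refine (h.contMDiffOn_sectionFun_iff hd hV (hσ.mono hVU) (fun x' hx' ↦ hpσ x' (hVU hx'))
      _).trans ?_
    exact contMDiffOn_congr fun x' hx' ↦ h.sectionFun_smul_frame f (hpσ x' (hVU hx'))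
  herm_add_left x ξ ξ' ζ := add_mul _ _ _
  herm_smul_left x c ξ ζ := mul_assoc _ _ _
  herm_symm x ξ ζ := by
    obtain ⟨y, hy⟩ := h.surjective x
    refine (h.herm_eq ⟨y, hy⟩ ζ ξ).trans
      (Eq.trans ?_ (congrArg (starRingEnd ℂ) (h.herm_eq ⟨y, hy⟩ ξ ζ)).symm)
    rw [map_mul, Complex.conj_conj, mul_comm]
  herm_pos x ξ hξ := by
    obtain ⟨y, hy⟩ := h.surjective x
    rw [h.herm_eq ⟨y, hy⟩ ξ ξ, Complex.mul_conj, Complex.ofReal_re, Complex.normSq_pos]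
    exact fun hzero ↦ hξ (h.fiber_ext ⟨y, hy⟩ hzero)
  herm_smooth ψ ψ' U hU hψ hψ' := h.contMDiffOn_herm hU hψ hψ'

end IsPrincipalContactification

end Fibers

/-! ### The connection of a principal contactification -/

section Connections

variable {E : Type*} [NormedAddCommGroup E] [NormedSpace ℝ E]
  {H : Type*} [TopologicalSpace H] {I : ModelWithCorners ℝ E H}
  {M : Type*} [TopologicalSpace M] [ChartedSpace H M]
  {E' : Type*} [NormedAddCommGroup E'] [NormedSpace ℝ E']
  {H' : Type*} [TopologicalSpace H'] {J : ModelWithCorners ℝ E' H'}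
  {N : Type*} [TopologicalSpace N] [ChartedSpace H' N]
  {V : Type*} [NormedAddCommGroup V] [NormedSpace ℝ V]
  {η : OneForm I M} {R : VField I M} {φ : Flow ℝ M} {p : M → N} {Ω : TwoForm J N} {ρ : ENNReal}

theorem vField_congr_point (X : VField J N) {x x' : N} (hx : x = x') :
    (show E' from X x) = (show E' from X x') := by
  subst hx
  rfl

theorem SmoothVFieldOn.exists_chart_coordinates [IsManifold J ∞ N] [J.Boundaryless]
    {X : VField J N} {U : Set N} (hX : SmoothVFieldOn J X U) (hU : IsOpen U) {x₀ : N}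
    (hx₀ : x₀ ∈ U) :
    ∃ w : E' → E', ContDiffAt ℝ ∞ w (extChartAt J x₀ x₀) ∧ ∀ᶠ e in 𝓝 (extChartAt J x₀ x₀),
      (show E' from mfderiv 𝓘(ℝ, E') J (extChartAt J x₀).symm e (w e))
        = (show E' from X ((extChartAt J x₀).symm e)) := by
  set T := trivializationAt E' (TangentSpace J : N → Type _) x₀
  have hcoord : ContMDiffAt J 𝓘(ℝ, E') ∞ (fun x ↦ (T ⟨x, X x⟩).2) x₀ :=
    (contMDiffAt_section x₀).1 ((hX x₀ hx₀).contMDiffAt (hU.mem_nhds hx₀))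
  refine ⟨fun e ↦ (T ⟨(extChartAt J x₀).symm e, X ((extChartAt J x₀).symm e)⟩).2,
    contMDiffAt_iff_contDiffAt.1 (ContMDiffAt.comp _ (g := fun x ↦ (T ⟨x, X x⟩).2)
      (by rwa [extChartAt_to_inv]) (contMDiffAt_extChartAt_symm x₀)), ?_⟩
  filter_upwards [extChartAt_target_mem_nhds (I := J) x₀] with e he
  set x := (extChartAt J x₀).symm e
  have hx : x ∈ (extChartAt J x₀).source := (extChartAt J x₀).map_target he
  have hxT : x ∈ T.baseSet := by simpa [T] using hx
  have hsymm := symmL_trivializationAt_apply (I := J) hx (T ⟨x, X x⟩).2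
  rw [J.range_eq_univ, mfderivWithin_univ, (extChartAt J x₀).right_inv he] at hsymm
  refine hsymm.symm.trans (Eq.trans (congrArg (T.symmL ℝ x) ?_)
    (T.symmL_continuousLinearMapAt (R := ℝ) hxT (X x)))
  exact (T.continuousLinearMapAt_apply_of_mem ℝ hxT _).symm

theorem mvfderiv_comp_complex_apply {f : M → N} {g : N → ℂ} {y : M}
    (hg : MDifferentiableAt J 𝓘(ℝ, ℂ) g (f y)) (hf : MDifferentiableAt I J f y)
    (v : TangentSpace I y) :
    mvfderiv I (fun y ↦ g (f y)) y v = mvfderiv J g (f y) (mfderiv I J f y v) :=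
  congrArg (fun A : E →L[ℝ] ℂ ↦ A v) (hg.hasMFDerivAt.comp y hf.hasMFDerivAt).mfderiv

theorem mvfderiv_mul_apply {F G : M → ℂ} {y : M} (hF : MDifferentiableAt I 𝓘(ℝ, ℂ) F y)
    (hG : MDifferentiableAt I 𝓘(ℝ, ℂ) G y) (v : TangentSpace I y) :
    mvfderiv I (fun y ↦ F y * G y) y v = F y * mvfderiv I G y v + mvfderiv I F y v * G y :=
  (congrArg (fun A : E →L[ℝ] ℂ ↦ A v) (hF.hasMFDerivAt.mul hG.hasMFDerivAt).mfderiv).trans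
    (congrArg (F y * mvfderiv I G y v + ·) (mul_comm _ _))

theorem IsFlowOf.mvfderiv_of_equivariant (hφ : IsFlowOf I R φ) {F : M → ℂ}
    (hF : ∀ t y, F (φ t y) = phase ρ t * F y) {y : M} (hFy : MDifferentiableAt I 𝓘(ℝ, ℂ) F y) :
    mvfderiv I F y (R y) = -(2 * Real.pi / ρ.toReal : ℝ) * Complex.I * F y := by
  have hchain := HasMFDerivAt.comp (g := F) (0 : ℝ)
    (show MDifferentiableAt I 𝓘(ℝ, ℂ) F (φ 0 y) by rwa [φ.map_zero_apply]).hasMFDerivAt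
    (hφ.integralCurve y 0)
  rw [show F ∘ (fun t ↦ φ t y) = fun t ↦ phase ρ t * F y from funext fun t ↦ hF t y] at hchain
  have hderiv : (show E →L[ℝ] ℂ from mvfderiv I F (φ 0 y)) ((1 : ℝ) • (show E from R (φ 0 y)))
      = (1 : ℝ) • (-(2 * Real.pi / ρ.toReal : ℝ) * Complex.I * phase ρ 0 * F y) :=
    congrArg (fun A : ℝ →L[ℝ] ℂ ↦ A 1)
      (hasMFDerivAt_unique hchain ((hasDerivAt_phase ρ 0).mul_const _).hasFDerivAt.hasMFDerivAt)
  rw [one_smul, one_smul, phase_zero, mul_one] at hderiv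
  exact (mfderiv_apply_congr (I := I) (J := 𝓘(ℝ, ℂ)) F (φ.map_zero_apply y).symm
    (vField_congr_point R (φ.map_zero_apply y).symm)).trans hderiv

theorem horizontalLift_add (y : M) (v w : TangentSpace J (p y)) :
    horizontalLift η p y (v + w) = horizontalLift η p y v + horizontalLift η p y w :=
  (congrArg ((η y).prod (mfderiv I J p y)).inverse
    (Prod.ext (add_zero _).symm rfl : ((0 : ℝ), v + w) = (0, v) + (0, w))).trans (map_add _ _ _)

theorem horizontalLift_smul (y : M) (a : ℝ) (v : TangentSpace J (p y)) :
    horizontalLift η p y (a • v) = a • horizontalLift η p y v :=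
  (congrArg ((η y).prod (mfderiv I J p y)).inverse
    (Prod.ext (smul_zero a).symm rfl : ((0 : ℝ), a • v) = a • (0, v))).trans (map_smul _ _ _)

theorem horizontalDeriv_congr {F G : M → ℂ} {X X' : VField J N} {y : M} (hFG : F =ᶠ[𝓝 y] G)
    (hX : X (p y) = X' (p y)) : horizontalDeriv η p X F y = horizontalDeriv η p X' G y := by
  unfold horizontalDeriv
  rw [hX]
  exact congrArg (fun A : E →L[ℝ] ℂ ↦ A (horizontalLift η p y (X' (p y))))
    (hFG.mfderiv_eq (I := I) (I' := 𝓘(ℝ, ℂ)))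

theorem horizontalDeriv_add_vField (X X' : VField J N) (F : M → ℂ) (y : M) :
    horizontalDeriv η p (X + X') F y
      = horizontalDeriv η p X F y + horizontalDeriv η p X' F y :=
  (congrArg (mvfderiv I F y) (horizontalLift_add y _ _)).trans (map_add _ _ _)

theorem horizontalDeriv_smul_vField (g : N → ℝ) (X : VField J N) (F : M → ℂ) (y : M) :
    horizontalDeriv η p (fun x ↦ g x • X x) F y = g (p y) * horizontalDeriv η p X F y :=
  ((congrArg (mvfderiv I F y) (horizontalLift_smul y _ _)).trans (map_smul _ _ _)).trans
    Complex.real_smul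

theorem horizontalDeriv_add (X : VField J N) {F G : M → ℂ} {y : M}
    (hF : MDifferentiableAt I 𝓘(ℝ, ℂ) F y) (hG : MDifferentiableAt I 𝓘(ℝ, ℂ) G y) :
    horizontalDeriv η p X (F + G) y = horizontalDeriv η p X F y + horizontalDeriv η p X G y :=
  congrArg (fun A : E →L[ℝ] ℂ ↦ A (horizontalLift η p y (X (p y)))) (mvfderiv_add hF hG)

namespace IsPrincipalContactification

variable [IsManifold I ∞ M] [IsManifold J ∞ N] (h : IsPrincipalContactification I J η R φ p Ω ρ)
include h

theorem mdifferentiableAt_sectionFun {ψ : Π x, equivariantFunctions φ p ρ x} {U : Set N}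
    (hU : IsOpen U) (hψ : (prequantumBundle h).SmoothOn ψ U) {x : N} (hx : x ∈ U) :
    ∀ y, p y = x → MDifferentiableAt I 𝓘(ℝ, ℂ) (sectionFun ψ) y := by
  rintro y rfl
  exact (ContMDiffOn.contMDiffAt (f := sectionFun ψ) hψ
    ((hU.preimage h.submersion.smooth.continuous).mem_nhds hx)).mdifferentiableAt (by simp)

theorem D_congr {X X' : VField J N} {ψ ψ' : Π x, equivariantFunctions φ p ρ x} {U : Set N}
    (hU : IsOpen U) (hX : ∀ x ∈ U, X x = X' x) (hψ : ∀ x ∈ U, ψ x = ψ' x) {x : N} (hx : x ∈ U) :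
    (prequantumBundle h).D X ψ x = (prequantumBundle h).D X' ψ' x := by
  classical
  have hcongr : (fun y : {y : M // p y = x} ↦ horizontalDeriv η p X (sectionFun ψ) y.1)
      = fun y : {y : M // p y = x} ↦ horizontalDeriv η p X' (sectionFun ψ') y.1 := by
    funext ⟨y, hy⟩
    subst hy
    refine horizontalDeriv_congr ?_ (hX _ hx)
    filter_upwards [(hU.preimage h.submersion.smooth.continuous).mem_nhds hx] with z hz
    exact congrArg (fun f : equivariantFunctions φ p ρ (p z) ↦ f.1 ⟨z, rfl⟩) (hψ (p z) hz)
  exact congrArg (fun f : {y : M // p y = x} → ℂ ↦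
    if hD : f ∈ equivariantFunctions φ p ρ x then (⟨f, hD⟩ : equivariantFunctions φ p ρ x)
      else 0) hcongr

variable [FiniteDimensional ℝ E] [FiniteDimensional ℝ E']
  (hd : Module.finrank ℝ E = Module.finrank ℝ E' + 1)
include hd

theorem horizontalLift_eq_sub {y : M} {v : E} {w : E'}
    (hv : (show E →L[ℝ] E' from mfderiv I J p y) v = w) :
    (show E from horizontalLift η p y (show TangentSpace J (p y) from w))
      = v - (show E →L[ℝ] ℝ from η y) v • (show E from R y) := by
  refine (h.eq_horizontalLift hd (v := w)
    (w := v - (show E →L[ℝ] ℝ from η y) v • (show E from R y)) ?_ ?_).symm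
  · have hηR : (show E →L[ℝ] ℝ from η y) (show E from R y) = 1 := h.reeb.apply_one y
    refine (map_sub (show E →L[ℝ] ℝ from η y) _ _).trans ?_
    rw [map_smul, hηR]
    exact sub_eq_zero.2 (mul_one _).symm
  · have hpR : (show E →L[ℝ] E' from mfderiv I J p y) (show E from R y) = 0 :=
      h.mfderiv_proj_reeb y
    refine (map_sub (show E →L[ℝ] E' from mfderiv I J p y) _ _).trans ?_
    rw [map_smul, hpR, hv, smul_zero, sub_zero]

theorem horizontalDeriv_eq {F : M → ℂ} (hF : ∀ t y, F (φ t y) = phase ρ t * F y) {y : M}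
    (hFy : MDifferentiableAt I 𝓘(ℝ, ℂ) F y) (X : VField J N) {v : E}
    (hv : (show E →L[ℝ] E' from mfderiv I J p y) v = (show E' from X (p y))) :
    horizontalDeriv η p X F y = (show E →L[ℝ] ℂ from mvfderiv I F y) v
      + (show E →L[ℝ] ℝ from η y) v * ((2 * Real.pi / ρ.toReal : ℝ) * Complex.I * F y) := by
  have hFR : (show E →L[ℝ] ℂ from mvfderiv I F y) (show E from R y) = _ :=
    h.flow.mvfderiv_of_equivariant hF hFy
  refine (congrArg (show E →L[ℝ] ℂ from mvfderiv I F y) (h.horizontalLift_eq_sub hd hv)).trans ?_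
  refine (map_sub (show E →L[ℝ] ℂ from mvfderiv I F y) _ _).trans ?_
  rw [map_smul, hFR, Complex.real_smul]
  ring

theorem horizontalDeriv_comp {F : M → ℂ} (hF : ∀ t y, F (φ t y) = phase ρ t * F y) {c : V → M}
    {e : V} (hc : MDifferentiableAt 𝓘(ℝ, V) I c e) (hFc : MDifferentiableAt I 𝓘(ℝ, ℂ) F (c e))
    (X : VField J N) {w : V}
    (hw : (show E' from mfderiv 𝓘(ℝ, V) J (p ∘ c) e w) = (show E' from X (p (c e)))) :
    horizontalDeriv η p X F (c e) = fderiv ℝ (F ∘ c) e w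
      + flatPullback c η e w * ((2 * Real.pi / ρ.toReal : ℝ) * Complex.I * F (c e)) := by
  have hpc := mfderiv_comp e (h.submersion.smooth.mdifferentiable (by simp) (c e)) hc
  have hFcomp := mfderiv_comp e hFc hc
  rw [mfderiv_eq_fderiv] at hFcomp
  rw [hFcomp]
  exact h.horizontalDeriv_eq hd hF hFc X
    ((congrArg (fun A : V →L[ℝ] E' ↦ A w) hpc).symm.trans hw)

theorem horizontalDeriv_comp_proj_mul (X : VField J N) {f : N → ℂ} {F : M → ℂ} {y : M}
    (hf : MDifferentiableAt J 𝓘(ℝ, ℂ) f (p y)) (hF : MDifferentiableAt I 𝓘(ℝ, ℂ) F y) :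
    horizontalDeriv η p X (fun z ↦ f (p z) * F z) y
      = f (p y) * horizontalDeriv η p X F y + mvfderiv J f (p y) (X (p y)) * F y := by
  have hp : MDifferentiableAt I J p y := h.submersion.smooth.mdifferentiable (by simp) y
  have hfp : mvfderiv I (fun z ↦ f (p z)) y (horizontalLift η p y (X (p y)))
      = mvfderiv J f (p y) (X (p y)) :=
    (mvfderiv_comp_complex_apply hf hp _).trans
      (congrArg (mvfderiv J f (p y)) (h.horizontalLift_spec hd y _).2)
  rw [← hfp]
  exact mvfderiv_mul_apply (hf.comp y hp) hF _

variable [I.Boundaryless]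

theorem mfderiv_flow_horizontalLift (t : ℝ) (y : M) (w : E') :
    (show E from mfderiv I I (φ t) y (horizontalLift η p y (show TangentSpace J (p y) from w)))
      = horizontalLift η p (φ t y) (show TangentSpace J (p (φ t y)) from w) := by
  have hspec := h.horizontalLift_spec hd y (show TangentSpace J (p y) from w)
  have hcomp := mfderiv_comp y (h.submersion.smooth.mdifferentiable (by simp) (φ t y))
    ((h.flow.contMDiff t).mdifferentiable (by simp) y)
  rw [show p ∘ φ t = p from funext fun y ↦ h.proj_flow y t] at hcomp
  exact h.eq_horizontalLift hd
    ((congrArg (fun α : OneForm I M ↦ α y (horizontalLift η p y w))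
      (h.flow.pullback₁_reeb h.contact.smooth h.reeb t)).trans hspec.1)
    ((congrArg (fun A : E →L[ℝ] E' ↦ A (horizontalLift η p y w)) hcomp).symm.trans hspec.2)

theorem horizontalDeriv_flow {F : M → ℂ} (hF : ∀ t y, F (φ t y) = phase ρ t * F y)
    (X : VField J N) {y : M} {t : ℝ} (hFy : MDifferentiableAt I 𝓘(ℝ, ℂ) F y)
    (hFt : MDifferentiableAt I 𝓘(ℝ, ℂ) F (φ t y)) :
    horizontalDeriv η p X F (φ t y) = phase ρ t * horizontalDeriv η p X F y := by
  set v := horizontalLift η p y (X (p y))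
  have hchain : mvfderiv I (fun z ↦ F (φ t z)) y v = mvfderiv I F (φ t y) (mfderiv I I (φ t) y v) :=
    mvfderiv_comp_complex_apply hFt ((h.flow.contMDiff t).mdifferentiable (by simp) y) v
  have hmul := mvfderiv_mul_apply (mdifferentiableAt_const (c := phase ρ t)) hFy v
  rw [mvfderiv_const, zero_apply, zero_mul, add_zero] at hmul
  rw [show (fun z ↦ F (φ t z)) = fun z ↦ phase ρ t * F z from funext fun z ↦ hF t z] at hchain
  have hlift : horizontalLift η p (φ t y) (X (p (φ t y))) = mfderiv I I (φ t) y v :=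
    (congrArg (fun w : E' ↦ horizontalLift η p (φ t y) (show TangentSpace J (p (φ t y)) from w))
      (vField_congr_point X (h.proj_flow y t))).trans (h.mfderiv_flow_horizontalLift hd t y _).symm
  exact (congrArg (mvfderiv I F (φ t y)) hlift).trans (hchain.symm.trans hmul)

theorem D_apply (X : VField J N) {ψ : Π x, equivariantFunctions φ p ρ x} {x : N}
    (hψ : ∀ y, p y = x → MDifferentiableAt I 𝓘(ℝ, ℂ) (sectionFun ψ) y) (y : {y : M // p y = x}) :
    (show equivariantFunctions φ p ρ x from (prequantumBundle h).D X ψ x).1 y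
      = horizontalDeriv η p X (sectionFun ψ) y.1 := by
  have hD : (fun y : {y : M // p y = x} ↦ horizontalDeriv η p X (sectionFun ψ) y.1)
      ∈ equivariantFunctions φ p ρ x := by
    rintro ⟨y, hy⟩ ⟨y', hy'⟩ t (rfl : φ t y = y')
    exact h.horizontalDeriv_flow hd (h.sectionFun_flow ψ) X (hψ _ hy) (hψ _ hy')
  exact congrFun (congrArg Subtype.val (dif_pos hD)) y

theorem contDiffAt_horizontalDeriv_comp {F : M → ℂ} (hF : ∀ t y, F (φ t y) = phase ρ t * F y)
    {c : V → M} {e : V} (hc : ContMDiffAt 𝓘(ℝ, V) I ∞ c e)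
    (hFc : ContMDiffAt I 𝓘(ℝ, ℂ) ∞ F (c e)) {X : VField J N} {w : V → V} (hw : ContDiffAt ℝ ∞ w e)
    (hX : ∀ᶠ e' in 𝓝 e,
      (show E' from mfderiv 𝓘(ℝ, V) J (p ∘ c) e' (w e')) = (show E' from X (p (c e')))) :
    ContDiffAt ℝ ∞ (fun e ↦ horizontalDeriv η p X F (c e)) e := by
  have hFcomp : ContDiffAt ℝ ∞ (F ∘ c) e := contMDiffAt_iff_contDiffAt.1 (hFc.comp e hc)
  have hform : ContDiffAt ℝ ∞ (fun e' ↦ fderiv ℝ (F ∘ c) e' (w e')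
      + (flatPullback c η e' (w e') : ℝ)
        * ((2 * Real.pi / ρ.toReal : ℝ) * Complex.I * (F ∘ c) e')) e :=
    ((hFcomp.fderiv_right (m := ∞) (by simp)).clm_apply hw).add
      ((Complex.ofRealCLM.contDiff.contDiffAt.comp e
        ((contDiffAt_flatPullback h.contact.smooth hc).clm_apply hw)).mul
          (contDiffAt_const.mul hFcomp))
  refine hform.congr_of_eventuallyEq ?_
  filter_upwards [hX, eventually_mdifferentiableAt hc,
    hc.continuousAt.eventually (eventually_mdifferentiableAt hFc)] with e' hXe hce hFe
  exact h.horizontalDeriv_comp hd hF hce hFe X hXe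

variable [J.Boundaryless]

theorem contMDiffAt_horizontalDeriv_section {X : VField J N} {U : Set N}
    (hX : SmoothVFieldOn J X U) (hU : IsOpen U) {x₀ : N} (hx₀ : x₀ ∈ U) {F : M → ℂ}
    (hF : ∀ t y, F (φ t y) = phase ρ t * F y) {σ : N → M} (hσ : ContMDiffAt J I ∞ σ x₀)
    (hpσ : ∀ᶠ x in 𝓝 x₀, p (σ x) = x) (hFσ : ContMDiffAt I 𝓘(ℝ, ℂ) ∞ F (σ x₀)) :
    ContMDiffAt J 𝓘(ℝ, ℂ) ∞ (fun x ↦ horizontalDeriv η p X F (σ x)) x₀ := by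
  obtain ⟨w, hw, hwX⟩ := hX.exists_chart_coordinates hU hx₀
  set e₀ := extChartAt J x₀ x₀
  have hx : (extChartAt J x₀).symm e₀ = x₀ := extChartAt_to_inv x₀
  have hsymm := contMDiffAt_extChartAt_symm (I := J) x₀
  have hpc : ∀ᶠ e in 𝓝 e₀, p (σ ((extChartAt J x₀).symm e)) = (extChartAt J x₀).symm e :=
    hsymm.continuousAt.eventually (by rwa [hx])
  have hcomp : ContDiffAt ℝ ∞
      (fun e ↦ horizontalDeriv η p X F (σ ((extChartAt J x₀).symm e))) e₀ := by
    refine h.contDiffAt_horizontalDeriv_comp hd hF (c := σ ∘ (extChartAt J x₀).symm)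
      (ContMDiffAt.comp e₀ (by rwa [hx]) hsymm)
      (show ContMDiffAt I _ ∞ F (σ ((extChartAt J x₀).symm e₀)) by rwa [hx]) hw ?_
    filter_upwards [hwX, hpc.eventually_nhds, hpc] with e hwe hpce hpe
    refine (congrArg (fun A : E' →L[ℝ] E' ↦ A (w e))
      (Filter.EventuallyEq.mfderiv_eq (I := 𝓘(ℝ, E')) (I' := J) hpce)).trans ?_
    exact hwe.trans (vField_congr_point X hpe.symm)
  refine (contMDiffAt_comp_extChartAt_iff.2 hcomp).congr_of_eventuallyEq ?_
  filter_upwards [extChartAt_source_mem_nhds (I := J) x₀] with x hx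
  rw [(extChartAt J x₀).left_inv hx]

theorem contMDiffOn_sectionFun_D {X : VField J N} {ψ : Π x, equivariantFunctions φ p ρ x}
    {U : Set N} (hU : IsOpen U) (hX : SmoothVFieldOn J X U)
    (hψ : (prequantumBundle h).SmoothOn ψ U) :
    (prequantumBundle h).SmoothOn ((prequantumBundle h).D X ψ) U := by
  intro y hy
  obtain ⟨σ, hσ, hpσ, hσy⟩ := h.hasSmoothLocalSections.exists_contMDiffAt_section y
  have hψy : ContMDiffAt I 𝓘(ℝ, ℂ) ∞ (sectionFun ψ) (σ (p y)) := by
    rw [hσy]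
    exact ContMDiffOn.contMDiffAt (f := sectionFun ψ) hψ
      ((hU.preimage h.submersion.smooth.continuous).mem_nhds hy)
  refine (h.contMDiffAt_sectionFun_of_comp hd hσ hpσ ?_).contMDiffWithinAt
  refine (h.contMDiffAt_horizontalDeriv_section hd hX hU hy (h.sectionFun_flow ψ) hσ hpσ
    hψy).congr_of_eventuallyEq ?_
  filter_upwards [hpσ, hU.mem_nhds hy] with x hx hxU
  exact h.D_apply hd X (h.mdifferentiableAt_sectionFun hU hψ (by rwa [hx]))
    ⟨σ x, rfl⟩

theorem isLinearConnection : (prequantumBundle h).IsLinearConnection where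
  local_ X X' ψ ψ' U hU hX hψ x hx := h.D_congr hU hX hψ hx
  add_section X ψ ψ' U hU hs hs' x hx := by
    obtain ⟨y, rfl⟩ := h.surjective x
    have hψ := h.mdifferentiableAt_sectionFun hU hs hx
    have hψ' := h.mdifferentiableAt_sectionFun hU hs' hx
    refine h.fiber_ext ⟨y, rfl⟩ ((h.D_apply hd X (ψ := ψ + ψ')
      (fun z hz ↦ (hψ z hz).add (hψ' z hz)) ⟨y, rfl⟩).trans
        ((horizontalDeriv_add X (hψ y rfl) (hψ' y rfl)).trans ?_))
    exact (congrArg₂ (· + ·) (h.D_apply hd X hψ ⟨y, rfl⟩) (h.D_apply hd X hψ' ⟨y, rfl⟩)).symm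
  leibniz X f ψ U hU hf hs x hx := by
    obtain ⟨y, rfl⟩ := h.surjective x
    have hψ := h.mdifferentiableAt_sectionFun hU hs hx
    have hfy : MDifferentiableAt J 𝓘(ℝ, ℂ) f (p y) :=
      (hf.contMDiffAt (hU.mem_nhds hx)).mdifferentiableAt (by simp)
    have hfψ : ∀ z, p z = p y →
        MDifferentiableAt I 𝓘(ℝ, ℂ) (fun z ↦ f (p z) * sectionFun ψ z) z := fun z hz ↦
      (MDifferentiableAt.comp (g := f) z (by rwa [hz])
        (h.submersion.smooth.mdifferentiable (by simp) z)).mul (hψ z hz)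
    refine h.fiber_ext ⟨y, rfl⟩ ((h.D_apply hd X (ψ := fun x ↦ f x • ψ x) hfψ ⟨y, rfl⟩).trans
      ((h.horizontalDeriv_comp_proj_mul hd X hfy (hψ y rfl)).trans ?_))
    exact congrArg (f (p y) * · + _) (h.D_apply hd X hψ ⟨y, rfl⟩).symm
  add_vField X X' ψ U hU hs x hx := by
    obtain ⟨y, rfl⟩ := h.surjective x
    have hψ := h.mdifferentiableAt_sectionFun hU hs hx
    refine h.fiber_ext ⟨y, rfl⟩ ((h.D_apply hd (X + X') hψ ⟨y, rfl⟩).trans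
      ((horizontalDeriv_add_vField X X' _ y).trans ?_))
    exact (congrArg₂ (· + ·) (h.D_apply hd X hψ ⟨y, rfl⟩) (h.D_apply hd X' hψ ⟨y, rfl⟩)).symm
  smul_vField g X ψ U hU hs x hx := by
    obtain ⟨y, rfl⟩ := h.surjective x
    have hψ := h.mdifferentiableAt_sectionFun hU hs hx
    refine h.fiber_ext ⟨y, rfl⟩ ((h.D_apply hd (fun x ↦ g x • X x) hψ ⟨y, rfl⟩).trans
      ((horizontalDeriv_smul_vField g X _ y).trans ?_))
    exact congrArg ((g (p y) : ℂ) * ·) (h.D_apply hd X hψ ⟨y, rfl⟩).symm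
  smooth X ψ U hU hX hψ := h.contMDiffOn_sectionFun_D hd hU hX hψ

end IsPrincipalContactification

end Connections

/-! ### Smooth quotients -/

section SmoothQuotients

variable {E : Type*} [NormedAddCommGroup E] [NormedSpace ℝ E]
  {H : Type*} [TopologicalSpace H] {I : ModelWithCorners ℝ E H}
  {P : Type*} [TopologicalSpace P] [ChartedSpace H P]
  {Q : Type*} [TopologicalSpace Q]
  {E' : Type*} [NormedAddCommGroup E'] [NormedSpace ℝ E']
  {H' : Type*} [TopologicalSpace H'] {J : ModelWithCorners ℝ E' H'}
  {X : Type*} [TopologicalSpace X] [ChartedSpace H' X]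
  {F : Type*} [NormedAddCommGroup F] [NormedSpace ℝ F]

/-- A local homeomorphism `c` from a quotient `f : P → Q` of a manifold to a manifold `X` that is
smooth on the total space `P`, and whose inverse lifts to a smooth map `s` into `P`. Such maps with
values in a vector space serve as charts of `Q`. -/
structure IsQuotientChart (I : ModelWithCorners ℝ E H) (J : ModelWithCorners ℝ E' H') (f : P → Q)
    (c : OpenPartialHomeomorph Q X) (s : X → P) : Prop where
  contMDiffOn_lift : ContMDiffOn J I ∞ s c.target
  symm_eq : ∀ z ∈ c.target, c.symm z = f (s z)
  contMDiffAt_comp : ∀ y, f y ∈ c.source → ContMDiffAt I J ∞ (fun y ↦ c (f y)) y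

theorem IsQuotientChart.trans {f : P → Q} {c : OpenPartialHomeomorph Q X} {s : X → P}
    (hc : IsQuotientChart I J f c s) {d : OpenPartialHomeomorph X F}
    (hd : ContMDiffOn J 𝓘(ℝ, F) ∞ d d.source)
    (hds : ContMDiffOn 𝓘(ℝ, F) J ∞ d.symm d.target) :
    IsQuotientChart I 𝓘(ℝ, F) f (c.trans d) (s ∘ d.symm) where
  contMDiffOn_lift := hc.contMDiffOn_lift.comp (hds.mono inter_subset_left) inter_subset_right
  symm_eq _ hz := hc.symm_eq _ hz.2
  contMDiffAt_comp y hy := ContMDiffAt.comp (g := d) y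
    (hd.contMDiffAt (d.open_source.mem_nhds hy.2)) (hc.contMDiffAt_comp y hy.1)

theorem exists_smooth_chart [IsManifold J ∞ X] [J.Boundaryless] (L : E' ≃L[ℝ] F) (x : X) :
    ∃ d : OpenPartialHomeomorph X F, x ∈ d.source ∧ ContMDiffOn J 𝓘(ℝ, F) ∞ d d.source ∧
      ContMDiffOn 𝓘(ℝ, F) J ∞ d.symm d.target := by
  refine ⟨(chartAt H' x).transHomeomorph (J.toHomeomorph.trans L.toHomeomorph),
    mem_chart_source H' x, L.contDiff.contMDiff.comp_contMDiffOn contMDiffOn_extChartAt, ?_⟩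
  refine (contMDiffOn_extChartAt_symm x).comp L.symm.contDiff.contMDiff.contMDiffOn fun z hz ↦ ?_
  rw [extChartAt_target, J.range_eq_univ, inter_univ]
  exact hz

theorem IsQuotientChart.isManifold {f : P → Q} {c : Q → OpenPartialHomeomorph Q F}
    {s : Q → F → P} (hmem : ∀ q, q ∈ (c q).source)
    (hc : ∀ q, IsQuotientChart I 𝓘(ℝ, F) f (c q) (s q)) :
    letI : ChartedSpace F Q := ⟨range c, c, hmem, mem_range_self⟩
    IsManifold 𝓘(ℝ, F) ∞ Q := by
  let _ : ChartedSpace F Q := ⟨range c, c, hmem, mem_range_self⟩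
  refine isManifold_of_contDiffOn _ _ _ ?_
  rintro _ _ ⟨q, rfl⟩ ⟨q', rfl⟩ z hz
  have hz₁ : z ∈ (c q).target := hz.1.1
  have hz₂ : f (s q z) ∈ (c q').source := (hc q).symm_eq z hz₁ ▸ hz.1.2
  have hchange : ContMDiffAt 𝓘(ℝ, F) 𝓘(ℝ, F) ∞ (fun z ↦ c q' (f (s q z))) z :=
    ContMDiffAt.comp (g := fun y ↦ c q' (f y)) z ((hc q').contMDiffAt_comp _ hz₂)
      ((hc q).contMDiffOn_lift.contMDiffAt ((c q).open_target.mem_nhds hz₁))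
  refine ((contMDiffAt_iff_contDiffAt.1 hchange).congr_of_eventuallyEq ?_).contDiffWithinAt
  filter_upwards [(c q).open_target.mem_nhds hz₁] with z' hz'
  exact congrArg (c q') ((hc q).symm_eq z' hz')

theorem exists_isManifold_of_isQuotientChart {f : P → Q} (hf : Continuous f)
    (h : ∀ q, ∃ (c : OpenPartialHomeomorph Q F) (s : F → P), q ∈ c.source ∧
      IsQuotientChart I 𝓘(ℝ, F) f c s) :
    ∃ (_ : ChartedSpace F Q) (_ : IsManifold 𝓘(ℝ, F) ∞ Q), ContMDiff I 𝓘(ℝ, F) ∞ f ∧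
      ∀ q, ∃ (U : Set Q) (s : Q → P), IsOpen U ∧ q ∈ U ∧ ContMDiffOn 𝓘(ℝ, F) I ∞ s U ∧
        ∀ x ∈ U, f (s x) = x := by
  choose c s hmem hc using h
  let _ : ChartedSpace F Q := ⟨range c, c, hmem, mem_range_self⟩
  have hQ : IsManifold 𝓘(ℝ, F) ∞ Q := IsQuotientChart.isManifold hmem hc
  refine ⟨inferInstance, hQ, fun y ↦ ?_, fun q ↦ ⟨(c q).source, fun x ↦ s q (c q x),
    (c q).open_source, hmem q, ?_, fun x hx ↦ ?_⟩⟩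
  · have hsymm : ContMDiffAt 𝓘(ℝ, F) 𝓘(ℝ, F) ∞ (c (f y)).symm (c (f y) (f y)) :=
      (contMDiffOn_chart_symm (I := 𝓘(ℝ, F)) (x := f y)).contMDiffAt
        ((c (f y)).open_target.mem_nhds ((c (f y)).map_source (hmem (f y))))
    refine (ContMDiffAt.comp (g := (c (f y)).symm) y hsymm
      ((hc (f y)).contMDiffAt_comp y (hmem _))).congr_of_eventuallyEq ?_
    filter_upwards [hf.continuousAt.eventually ((c (f y)).open_source.mem_nhds (hmem (f y)))]
      with y' hy'
    exact ((c (f y)).left_inv hy').symm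
  · exact (hc q).contMDiffOn_lift.comp (contMDiffOn_chart (I := 𝓘(ℝ, F)) (x := q))
      fun x hx ↦ (c q).map_source hx
  · exact ((hc q).symm_eq _ ((c q).map_source hx)).symm.trans ((c q).left_inv hx)

theorem isOpenQuotientMap_orbitSetoid_mk {M : Type*} [TopologicalSpace M] (φ : Flow ℝ M) :
    IsOpenQuotientMap (Quotient.mk (orbitSetoid φ)) := by
  refine ⟨Quotient.mk_surjective, continuous_quotient_mk', fun U hU ↦ ?_⟩
  have hsat : Quotient.mk (orbitSetoid φ) ⁻¹' (Quotient.mk (orbitSetoid φ) '' U)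
      = ⋃ t, φ t ⁻¹' U := by
    ext y
    simp only [mem_preimage, mem_image, mem_iUnion]
    constructor
    · rintro ⟨y', hy', hq⟩
      obtain ⟨t, ht⟩ := Quotient.exact hq.symm
      exact ⟨t, ht ▸ hy'⟩
    · rintro ⟨t, ht⟩
      exact ⟨_, ht, (Quotient.sound ⟨t, rfl⟩ : Quotient.mk (orbitSetoid φ) y = _).symm⟩
  change IsOpen (Quotient.mk (orbitSetoid φ) ⁻¹' (Quotient.mk (orbitSetoid φ) '' U))
  rw [hsat]
  exact isOpen_iUnion fun t ↦ hU.preimage (φ.continuous continuous_const continuous_id)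

end SmoothQuotients

/-! ### The manifold structure of the reduced product -/

namespace ReducedProduct

section

variable {M₁ M₂ : Type*} [TopologicalSpace M₁] [TopologicalSpace M₂] (φ₁ : Flow ℝ M₁)
  (φ₂ : Flow ℝ M₂)

theorem isOpenQuotientMap_mk : IsOpenQuotientMap (mk φ₁ φ₂) :=
  isOpenQuotientMap_orbitSetoid_mk _

theorem mk_eq_iff {y y' : M₁ × M₂} :
    mk φ₁ φ₂ y = mk φ₁ φ₂ y' ↔ ∃ t, (φ₁ t y.1, φ₂ (-t) y.2) = y' :=
  Quotient.eq (r := orbitSetoid (differenceFlow φ₁ φ₂))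

theorem mk_flow (t : ℝ) (y : M₁ × M₂) : mk φ₁ φ₂ (φ₁ t y.1, y.2) = mk φ₁ φ₂ (y.1, φ₂ t y.2) := by
  rw [mk_eq_iff]
  refine ⟨-t, ?_⟩
  rw [neg_neg, ← φ₁.map_add, neg_add_cancel, φ₁.map_zero_apply]

/-- A map `σ : N₂ → M₂` that is a section of `p₂` over a set `U` turns `[(y₁, φ₂ t (σ x))]`, where
`x ∈ U`, into `(φ₁ t y₁, x)`, see `sectionLift_mk`. -/
noncomputable def sectionLift {N₂ : Type*} (p₂ : M₂ → N₂) (σ : N₂ → M₂)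
    (q : ReducedProduct φ₁ φ₂) : M₁ × N₂ :=
  (φ₁ (Classical.epsilon fun t ↦ φ₂ t (σ (p₂ q.out.2)) = q.out.2) q.out.1, p₂ q.out.2)

end

variable {E₁ : Type*} [NormedAddCommGroup E₁] [NormedSpace ℝ E₁]
  {H₁ : Type*} [TopologicalSpace H₁] {I₁ : ModelWithCorners ℝ E₁ H₁}
  {M₁ : Type*} [TopologicalSpace M₁] [ChartedSpace H₁ M₁]
  {E₁' : Type*} [NormedAddCommGroup E₁'] [NormedSpace ℝ E₁']
  {H₁' : Type*} [TopologicalSpace H₁'] {J₁ : ModelWithCorners ℝ E₁' H₁'}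
  {N₁ : Type*} [TopologicalSpace N₁] [ChartedSpace H₁' N₁]
  {E₂ : Type*} [NormedAddCommGroup E₂] [NormedSpace ℝ E₂]
  {H₂ : Type*} [TopologicalSpace H₂] {I₂ : ModelWithCorners ℝ E₂ H₂}
  {M₂ : Type*} [TopologicalSpace M₂] [ChartedSpace H₂ M₂]
  {E₂' : Type*} [NormedAddCommGroup E₂'] [NormedSpace ℝ E₂']
  {H₂' : Type*} [TopologicalSpace H₂'] {J₂ : ModelWithCorners ℝ E₂' H₂'}
  {N₂ : Type*} [TopologicalSpace N₂] [ChartedSpace H₂' N₂]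
  {η₁ : OneForm I₁ M₁} {R₁ : VField I₁ M₁} {φ₁ : Flow ℝ M₁} {p₁ : M₁ → N₁} {Ω₁ : TwoForm J₁ N₁}
  {η₂ : OneForm I₂ M₂} {R₂ : VField I₂ M₂} {φ₂ : Flow ℝ M₂} {p₂ : M₂ → N₂} {Ω₂ : TwoForm J₂ N₂}
  {ρ : ENNReal} [IsManifold I₂ ∞ M₂] [IsManifold J₂ ∞ N₂]

section

variable (h₂ : IsPrincipalContactification I₂ J₂ η₂ R₂ φ₂ p₂ Ω₂ ρ)
include h₂

theorem proj_snd_eq_of_mk_eq {y y' : M₁ × M₂} (hy : mk φ₁ φ₂ y = mk φ₁ φ₂ y') :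
    p₂ y.2 = p₂ y'.2 := by
  obtain ⟨t, rfl⟩ := (mk_eq_iff φ₁ φ₂).1 hy
  exact (h₂.proj_flow y.2 (-t)).symm

theorem mk_mem_image_proj_snd_iff {U : Set N₂} {y : M₁ × M₂} :
    mk φ₁ φ₂ y ∈ mk φ₁ φ₂ '' {y | p₂ y.2 ∈ U} ↔ p₂ y.2 ∈ U := by
  refine ⟨?_, fun hy ↦ ⟨y, hy, rfl⟩⟩
  rintro ⟨y', hy', hq⟩
  exact proj_snd_eq_of_mk_eq h₂ hq ▸ hy'

theorem isOpen_image_proj_snd {U : Set N₂} (hU : IsOpen U) :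
    IsOpen (mk φ₁ φ₂ '' {y | p₂ y.2 ∈ U}) :=
  (isOpenQuotientMap_mk φ₁ φ₂).isOpenMap _
    (hU.preimage (h₂.submersion.smooth.continuous.comp continuous_snd))

end

variable [IsManifold I₁ ∞ M₁] [IsManifold J₁ ∞ N₁]
  (h₁ : IsPrincipalContactification I₁ J₁ η₁ R₁ φ₁ p₁ Ω₁ ρ)
  (h₂ : IsPrincipalContactification I₂ J₂ η₂ R₂ φ₂ p₂ Ω₂ ρ)
include h₁ h₂

-- Both flows have the same period group, so `φ₁ t` depends only on the value of `φ₂ t` at a point.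
theorem sectionLift_mk {σ : N₂ → M₂} {y : M₁ × M₂} {t : ℝ} (ht : φ₂ t (σ (p₂ y.2)) = y.2) :
    sectionLift φ₁ φ₂ p₂ σ (mk φ₁ φ₂ y) = (φ₁ t y.1, p₂ y.2) := by
  unfold sectionLift
  set y' := (mk φ₁ φ₂ y).out
  obtain ⟨s, hs⟩ := (mk_eq_iff φ₁ φ₂).1 (Quotient.out_eq (mk φ₁ φ₂ y)).symm
  replace hs : (φ₁ s y.1, φ₂ (-s) y.2) = y' := hs
  have hp : p₂ y'.2 = p₂ y.2 := by rw [← hs, h₂.proj_flow]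
  have hex : ∃ t', φ₂ t' (σ (p₂ y'.2)) = y'.2 :=
    ⟨-s + t, by rw [hp, φ₂.map_add, ht, ← hs]⟩
  set t' := Classical.epsilon fun t' ↦ φ₂ t' (σ (p₂ y'.2)) = y'.2
  have ht' : φ₂ t' (σ (p₂ y'.2)) = y'.2 := Classical.epsilon_spec hex
  have htt' : φ₂ t (σ (p₂ y.2)) = φ₂ (s + t') (σ (p₂ y.2)) := by
    rw [φ₂.map_add, ← hp, ht', hp, ht, ← hs, ← φ₂.map_add, add_neg_cancel, φ₂.map_zero_apply]
  have hφ₁ := (h₁.flow_eq_iff y.1 _ _).2 ((h₂.flow_eq_iff _ _ _).1 htt')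
  rw [hp, hφ₁, ← hs, add_comm, φ₁.map_add]

variable [J₂.Boundaryless] [FiniteDimensional ℝ E₂] [FiniteDimensional ℝ E₂']
  (hd₂ : Module.finrank ℝ E₂ = Module.finrank ℝ E₂' + 1)
include hd₂

section

variable {U : Set N₂} {σ : N₂ → M₂} (hU : IsOpen U) (hσ : ContMDiffOn J₂ I₂ ∞ σ U)
  (hpσ : ∀ x ∈ U, p₂ (σ x) = x)
include hU hσ hpσ

theorem contMDiffAt_sectionLift_mk {y : M₁ × M₂} (hy : p₂ y.2 ∈ U) :
    ContMDiffAt (I₁.prod I₂) (I₁.prod J₂) ∞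
      (fun y ↦ sectionLift φ₁ φ₂ p₂ σ (mk φ₁ φ₂ y)) y := by
  obtain ⟨t, ht⟩ := (h₂.orbits (σ (p₂ y.2)) y.2).1 (hpσ _ hy)
  obtain ⟨τ, hτ, -, hτσ⟩ := h₂.exists_time hd₂ (hσ.contMDiffAt (hU.mem_nhds hy))
    (Filter.eventually_of_mem (hU.mem_nhds hy) hpσ) ht
  have hfst : ContMDiffAt (I₁.prod I₂) I₁ ∞ (fun y : M₁ × M₂ ↦ φ₁ (τ y.2) y.1) y :=
    h₁.flow.smooth.contMDiffAt.comp y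
      ((ContMDiffAt.comp y hτ contMDiffAt_snd).prodMk contMDiffAt_fst)
  have hsnd : ContMDiffAt (I₁.prod I₂) J₂ ∞ (fun y : M₁ × M₂ ↦ p₂ y.2) y :=
    (h₂.submersion.smooth.comp contMDiff_snd).contMDiffAt
  refine (hfst.prodMk hsnd).congr_of_eventuallyEq ?_
  filter_upwards [continuousAt_snd.eventually hτσ] with y' hy'
  exact sectionLift_mk h₁ h₂ hy'

/-- The identification, given by a local section of `p₂` over `U`, of the part of the reduced
product over `U` with `M₁ × U`. -/
noncomputable def sectionHomeomorph :
    OpenPartialHomeomorph (ReducedProduct φ₁ φ₂) (M₁ × N₂) where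
  toFun := sectionLift φ₁ φ₂ p₂ σ
  invFun z := mk φ₁ φ₂ (z.1, σ z.2)
  source := mk φ₁ φ₂ '' {y | p₂ y.2 ∈ U}
  target := univ ×ˢ U
  map_source' := by
    rintro _ ⟨y, hy, rfl⟩
    obtain ⟨t, ht⟩ := (h₂.orbits (σ (p₂ y.2)) y.2).1 (hpσ _ hy)
    rw [sectionLift_mk h₁ h₂ ht]
    exact ⟨mem_univ _, hy⟩
  map_target' z hz := (mk_mem_image_proj_snd_iff h₂).2 (by rw [hpσ _ hz.2]; exact hz.2)
  left_inv' := by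
    rintro _ ⟨y, hy, rfl⟩
    obtain ⟨t, ht⟩ := (h₂.orbits (σ (p₂ y.2)) y.2).1 (hpσ _ hy)
    rw [sectionLift_mk h₁ h₂ ht]
    exact (mk_flow φ₁ φ₂ t (y.1, σ (p₂ y.2))).trans (by rw [ht])
  right_inv' z hz := by
    have hz₂ : p₂ (σ z.2) = z.2 := hpσ _ hz.2
    rw [sectionLift_mk h₁ h₂ (t := 0) (by rw [φ₂.map_zero_apply, hz₂]), φ₁.map_zero_apply, hz₂]
  open_source := isOpen_image_proj_snd h₂ hU
  open_target := isOpen_univ.prod hU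
  continuousOn_toFun := by
    rintro _ ⟨y, hy, rfl⟩
    exact ((isOpenQuotientMap_mk φ₁ φ₂).continuousAt_comp_iff (g := sectionLift φ₁ φ₂ p₂ σ) |>.1
      (contMDiffAt_sectionLift_mk h₁ h₂ hd₂ hU hσ hpσ hy).continuousAt).continuousWithinAt
  continuousOn_invFun := (isOpenQuotientMap_mk φ₁ φ₂).continuous.comp_continuousOn
    (continuousOn_fst.prodMk (hσ.continuousOn.comp continuousOn_snd fun _ hz ↦ hz.2))

theorem isQuotientChart_sectionHomeomorph :
    IsQuotientChart (I₁.prod I₂) (I₁.prod J₂) (mk φ₁ φ₂)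
      (sectionHomeomorph h₁ h₂ hd₂ hU hσ hpσ) (fun z ↦ (z.1, σ z.2)) where
  contMDiffOn_lift := contMDiffOn_fst.prodMk (hσ.comp contMDiffOn_snd fun _ hz ↦ hz.2)
  symm_eq _ _ := rfl
  contMDiffAt_comp _ hy :=
    contMDiffAt_sectionLift_mk h₁ h₂ hd₂ hU hσ hpσ ((mk_mem_image_proj_snd_iff h₂).1 hy)

end

theorem t2Space [T2Space M₁] [T2Space N₂] : T2Space (ReducedProduct φ₁ φ₂) := by
  refine ⟨fun q q' hqq' ↦ ?_⟩
  obtain ⟨y, rfl⟩ := (isOpenQuotientMap_mk φ₁ φ₂).surjective q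
  obtain ⟨y', rfl⟩ := (isOpenQuotientMap_mk φ₁ φ₂).surjective q'
  by_cases hp : p₂ y.2 = p₂ y'.2
  · obtain ⟨U, σ, hU, hy, hσ, hpσ⟩ := h₂.localSection (p₂ y.2)
    set e := sectionHomeomorph h₁ h₂ hd₂ hU hσ hpσ
    have hye : mk φ₁ φ₂ y ∈ e.source := ⟨y, hy, rfl⟩
    have hye' : mk φ₁ φ₂ y' ∈ e.source := (mk_mem_image_proj_snd_iff h₂).2 (hp ▸ hy)
    obtain ⟨V, V', hV, hV', hyV, hyV', hVV'⟩ := t2_separation fun h ↦ hqq' (e.injOn hye hye' h)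
    exact ⟨_, _, e.isOpen_inter_preimage hV, e.isOpen_inter_preimage hV', ⟨hye, hyV⟩,
      ⟨hye', hyV'⟩, (hVV'.preimage e).mono inter_subset_right inter_subset_right⟩
  · obtain ⟨V, V', hV, hV', hyV, hyV', hVV'⟩ := t2_separation hp
    refine ⟨_, _, isOpen_image_proj_snd h₂ hV, isOpen_image_proj_snd h₂ hV', ⟨y, hyV, rfl⟩,
      ⟨y', hyV', rfl⟩, Set.disjoint_left.2 ?_⟩
    rintro _ ⟨z, hz, rfl⟩ hz'
    exact Set.disjoint_left.1 hVV' hz ((mk_mem_image_proj_snd_iff h₂).1 hz')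

theorem exists_isManifold [I₁.Boundaryless] {F : Type*} [NormedAddCommGroup F] [NormedSpace ℝ F]
    (L : (E₁ × E₂') ≃L[ℝ] F) :
    ∃ (_ : ChartedSpace F (ReducedProduct φ₁ φ₂))
      (_ : IsManifold 𝓘(ℝ, F) ∞ (ReducedProduct φ₁ φ₂)),
      HasSmoothLocalSections (I₁.prod I₂) 𝓘(ℝ, F) (mk φ₁ φ₂) := by
  have hmk := isOpenQuotientMap_mk φ₁ φ₂
  obtain ⟨C, hC, hsmooth, hsection⟩ := exists_isManifold_of_isQuotientChart (F := F)
    (I := I₁.prod I₂) hmk.continuous (by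
      intro q
      obtain ⟨y, rfl⟩ := hmk.surjective q
      obtain ⟨U, σ, hU, hy, hσ, hpσ⟩ := h₂.localSection (p₂ y.2)
      set e := sectionHomeomorph h₁ h₂ hd₂ hU hσ hpσ
      obtain ⟨d, hyd, hd, hds⟩ := exists_smooth_chart (J := I₁.prod J₂) L (e (mk φ₁ φ₂ y))
      exact ⟨e.trans d, _, ⟨⟨y, hy, rfl⟩, hyd⟩,
        (isQuotientChart_sectionHomeomorph h₁ h₂ hd₂ hU hσ hpσ).trans hd hds⟩)
  refine ⟨C, hC, hsmooth, fun y ↦ ?_⟩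
  obtain ⟨U, s, hU, hy, hs, hmks⟩ := hsection (mk φ₁ φ₂ y)
  obtain ⟨t, ht⟩ := (mk_eq_iff φ₁ φ₂).1 (hmks _ hy)
  refine ⟨U, fun x ↦ differenceFlow φ₁ φ₂ t (s x), hU, hy,
    ((isFlowOf_differenceFlow h₁.flow h₂.flow).contMDiff t).comp_contMDiffOn hs, fun x hx ↦ ?_, ht⟩
  exact ((mk_eq_iff φ₁ φ₂).2 ⟨t, rfl⟩ : mk φ₁ φ₂ (s x) = _).symm.trans (hmks x hx)

end ReducedProduct

/-! ### Descent of forms and flows to the reduced product -/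

section Descent

variable {E : Type*} [NormedAddCommGroup E] [NormedSpace ℝ E]
  {H : Type*} [TopologicalSpace H] {I : ModelWithCorners ℝ E H}
  {M : Type*} [TopologicalSpace M] [ChartedSpace H M]
  {E' : Type*} [NormedAddCommGroup E'] [NormedSpace ℝ E']
  {H' : Type*} [TopologicalSpace H'] {J : ModelWithCorners ℝ E' H'}
  {N : Type*} [TopologicalSpace N] [ChartedSpace H' N]

/-- The vector field that generates a flow. -/
noncomputable def flowGenerator (I : ModelWithCorners ℝ E H) (φ : Flow ℝ M) : VField I M :=
  fun y ↦ (show E from mfderiv 𝓘(ℝ, ℝ) I (fun t ↦ φ t y) 0 (1 : ℝ))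

theorem isFlowOf_flowGenerator {φ : Flow ℝ M}
    (hφ : ContMDiff (𝓘(ℝ, ℝ).prod I) I ∞ (fun q : ℝ × M ↦ φ q.1 q.2)) :
    IsFlowOf I (flowGenerator I φ) φ := by
  refine ⟨hφ, fun y t ↦ ?_⟩
  set A : ℝ →L[ℝ] E := mfderiv 𝓘(ℝ, ℝ) I (fun s ↦ φ s (φ t y)) 0
  have hshift : HasMFDerivAt 𝓘(ℝ, ℝ) 𝓘(ℝ, ℝ) (fun s : ℝ ↦ s - t) t (ContinuousLinearMap.id ℝ ℝ) :=
    ((hasFDerivAt_id t).sub_const t).hasMFDerivAt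
  have horbit : HasMFDerivAt 𝓘(ℝ, ℝ) I (fun s ↦ φ s (φ t y)) (t - t) A := by
    rw [sub_self]
    exact ((hφ.comp (contMDiff_id.prodMk contMDiff_const)).mdifferentiable (by simp) 0).hasMFDerivAt
  have hcomp : (fun s ↦ φ s (φ t y)) ∘ (fun s : ℝ ↦ s - t) = fun s ↦ φ s y :=
    funext fun s ↦ by rw [comp_apply, ← φ.map_add, sub_add_cancel]
  have hderiv := HasMFDerivAt.comp (f := fun s : ℝ ↦ s - t) t horbit hshift
  rw [hcomp] at hderiv
  refine hderiv.congr_mfderiv (ContinuousLinearMap.ext fun a : ℝ ↦ ?_)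
  exact (congrArg A (mul_one a).symm).trans (A.map_smul a 1)

theorem IsReebField.of_extDeriv_eq {η : OneForm I M} {R : VField I M} {p : M → N} {Ω : TwoForm J N}
    (hηR : ∀ y, η y (R y) = 1) (hpR : ∀ y, mfderiv I J p y (R y) = 0)
    (hΩ : ∀ y u v, extDeriv₁ I η y u v = pullback₂ I p Ω y u v) : IsReebField I η R := by
  refine ⟨hηR, fun y v ↦ (hΩ y _ v).trans ?_⟩
  set B : E' →L[ℝ] E' →L[ℝ] ℝ := Ω (p y)
  have hB : B (mfderiv I J p y (R y)) = 0 := (congrArg B (hpR y)).trans B.map_zero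
  exact congrArg (fun A : E' →L[ℝ] ℝ ↦ A (mfderiv I J p y v)) hB

theorem IsContactForm.of_extDeriv_eq [IsManifold I ∞ M] [FiniteDimensional ℝ E]
    [FiniteDimensional ℝ E'] (hd : Module.finrank ℝ E = Module.finrank ℝ E' + 1)
    {η : OneForm I M} (hη : SmoothOneForm I η) {R : VField I M} {p : M → N} {Ω : TwoForm J N}
    (hηR : ∀ y, η y (R y) = 1) (hpR : ∀ y, mfderiv I J p y (R y) = 0)
    (hp : ∀ y, Surjective (mfderiv I J p y))
    (hΩ : ∀ y u v, extDeriv₁ I η y u v = pullback₂ I p Ω y u v)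
    (hnd : ∀ x (v : TangentSpace J x), (∀ w, Ω x v w = 0) → v = 0) : IsContactForm I η := by
  refine ⟨hη, fun y hy ↦ ?_, fun y v hv hvw ↦ ?_⟩
  · have hone := hηR y
    rw [hy] at hone
    exact zero_ne_one hone
  · have hbij := bijective_prod_of_finrank (A := show E →L[ℝ] ℝ from η y)
      (B := show E →L[ℝ] E' from mfderiv I J p y) (r := show E from R y) (hηR y) (hpR y) (hp y) hd
    have hpv : mfderiv I J p y v = (0 : E') := hnd (p y) _ fun w' ↦ by
      obtain ⟨w, hw⟩ := hbij.2 (0, (show E' from w'))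
      have hvw' := (hΩ y v w).symm.trans (hvw w (congrArg Prod.fst hw))
      exact (congrArg (show E' →L[ℝ] ℝ from Ω (p y) (mfderiv I J p y v))
        (congrArg Prod.snd hw).symm).trans hvw'
    exact hbij.1 ((Prod.ext hv hpv).trans (map_zero _).symm)

variable [IsManifold I ∞ M] [IsManifold J ∞ N] [I.Boundaryless] [J.Boundaryless]

theorem HasSmoothLocalSections.exists_pullback₁_eq {f : M → N} (hf : HasSmoothLocalSections I J f)
    (hsurj : Surjective f) {α : OneForm I M} (hα : SmoothOneForm I α)
    (hb : ∀ (y y' : M) (v : TangentSpace I y) (w : TangentSpace I y'), f y = f y' →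
      (show E' from mfderiv I J f y v) = mfderiv I J f y' w → α y v = α y' w) :
    ∃ η : OneForm J N, SmoothOneForm J η ∧ pullback₁ I f η = α := by
  have hsection : ∀ x : N, ∃ s : N → M, ContMDiffAt J I ∞ s x ∧ ∀ᶠ x' in 𝓝 x, f (s x') = x' := by
    intro x
    obtain ⟨y, rfl⟩ := hsurj x
    obtain ⟨s, hs, hfs, -⟩ := hf.exists_contMDiffAt_section y
    exact ⟨s, hs, hfs⟩
  choose s hs hfs using hsection
  have hlift : ∀ x x' (v : TangentSpace J x'), MDifferentiableAt J I (s x) x' →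
      (∀ᶠ z in 𝓝 x', f (s x z) = z) →
      mfderiv I J f (s x x') (mfderiv J I (s x) x' v) = (show E' from v) := fun x x' v h h' ↦
    mfderiv_mfderiv_rightInverse (hf.smooth.mdifferentiable (by simp) _) h h' v
  have hlift_self : ∀ x v, mfderiv I J f (s x x) (mfderiv J I (s x) x v) = (show E' from v) :=
    fun x v ↦ hlift x x v ((hs x).mdifferentiableAt (by simp)) (hfs x)
  refine ⟨fun x ↦ pullback₁ J (s x) α x, ?_, funext fun y ↦ ContinuousLinearMap.ext fun v ↦
    hb _ _ _ _ (hfs (f y)).self_of_nhds (hlift_self _ _)⟩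
  refine smoothOneForm_of_eventuallyEq_pullback₁ hα fun x ↦ ⟨s x, hs x, ?_⟩
  filter_upwards [eventually_mdifferentiableAt (hs x), (hfs x).eventually_nhds] with x' hx' hfx'
  exact ContinuousLinearMap.ext fun v ↦
    hb _ _ _ _ ((hfs x').self_of_nhds.trans hfx'.self_of_nhds.symm)
      ((hlift_self x' v).trans (hlift x x' v hx' hfx').symm)

theorem HasSmoothLocalSections.exists_pullback₁_eq_of_flow {f : M → N}
    (hf : HasSmoothLocalSections I J f) (hsurj : Surjective f) {α : OneForm I M}
    (hα : SmoothOneForm I α) {φ : Flow ℝ M} (hφ : ∀ t, ContMDiff I I ∞ (φ t))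
    (horbits : ∀ y y', f y = f y' ↔ ∃ t, φ t y = y') (hinv : ∀ t, pullback₁ I (φ t) α = α)
    (hker : ∀ y v, mfderiv I J f y v = 0 → α y v = 0) :
    ∃ η : OneForm J N, SmoothOneForm J η ∧ pullback₁ I f η = α := by
  refine hf.exists_pullback₁_eq hsurj hα fun y y' v w hy hvw ↦ ?_
  obtain ⟨t, rfl⟩ := (horbits y y').1 hy
  have hφv : (show E' from mfderiv I J f (φ t y) (mfderiv I I (φ t) y v)) = mfderiv I J f y v := by
    have hcomp := mfderiv_comp_apply y (hf.smooth.mdifferentiable (by simp) (φ t y))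
      ((hφ t).mdifferentiable (by simp) y) v
    rw [show f ∘ φ t = f from funext fun y ↦ ((horbits y _).2 ⟨t, rfl⟩).symm] at hcomp
    exact hcomp.symm
  have hsub : α (φ t y) (mfderiv I I (φ t) y v - w) = 0 := hker _ _
    ((map_sub (show E →L[ℝ] E' from mfderiv I J f (φ t y)) _ _).trans
      (sub_eq_zero.2 (hφv.trans hvw)))
  exact (congrArg (fun β : OneForm I M ↦ β y v) (hinv t)).symm.trans
    (sub_eq_zero.1 ((map_sub (show E →L[ℝ] ℝ from α (φ t y)) _ _).symm.trans hsub))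

end Descent

theorem exists_smul_eq_of_apply_eq_zero {V W : Type*} [NormedAddCommGroup V] [NormedSpace ℝ V]
    [FiniteDimensional ℝ V] [NormedAddCommGroup W] [NormedSpace ℝ W] {A : V →L[ℝ] W}
    (hA : Surjective A) (hd : Module.finrank ℝ V = Module.finrank ℝ W + 1) {v w : V} (hw : A w = 0)
    (hw₀ : w ≠ 0) (hv : A v = 0) : ∃ c : ℝ, c • w = v := by
  have hrank := A.toLinearMap.finrank_range_add_finrank_ker
  rw [LinearMap.range_eq_top.2 hA, finrank_top, hd] at hrank
  obtain ⟨c, hc⟩ := (finrank_eq_one_iff_of_nonzero' (⟨w, hw⟩ : LinearMap.ker A.toLinearMap)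
    fun h ↦ hw₀ (congrArg Subtype.val h)).1 (Nat.add_left_cancel hrank) ⟨v, hv⟩
  exact ⟨c, congrArg Subtype.val hc⟩

section ProdMap

variable {E₁ : Type*} [NormedAddCommGroup E₁] [NormedSpace ℝ E₁]
  {H₁ : Type*} [TopologicalSpace H₁] {I₁ : ModelWithCorners ℝ E₁ H₁}
  {M₁ : Type*} [TopologicalSpace M₁] [ChartedSpace H₁ M₁]
  {E₁' : Type*} [NormedAddCommGroup E₁'] [NormedSpace ℝ E₁']
  {H₁' : Type*} [TopologicalSpace H₁'] {J₁ : ModelWithCorners ℝ E₁' H₁'}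
  {N₁ : Type*} [TopologicalSpace N₁] [ChartedSpace H₁' N₁]
  {E₂ : Type*} [NormedAddCommGroup E₂] [NormedSpace ℝ E₂]
  {H₂ : Type*} [TopologicalSpace H₂] {I₂ : ModelWithCorners ℝ E₂ H₂}
  {M₂ : Type*} [TopologicalSpace M₂] [ChartedSpace H₂ M₂]
  {E₂' : Type*} [NormedAddCommGroup E₂'] [NormedSpace ℝ E₂']
  {H₂' : Type*} [TopologicalSpace H₂'] {J₂ : ModelWithCorners ℝ E₂' H₂'}
  {N₂ : Type*} [TopologicalSpace N₂] [ChartedSpace H₂' N₂] {f : M₁ → N₁} {g : M₂ → N₂}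

theorem mfderiv_prodMap_apply {y : M₁ × M₂} (hf : MDifferentiableAt I₁ J₁ f y.1)
    (hg : MDifferentiableAt I₂ J₂ g y.2) (v : TangentSpace (I₁.prod I₂) y) :
    mfderiv (I₁.prod I₂) (J₁.prod J₂) (Prod.map f g) y v
      = (show E₁' × E₂' from (mfderiv I₁ J₁ f y.1 v.1, mfderiv I₂ J₂ g y.2 v.2)) :=
  congrArg (fun A : E₁ × E₂ →L[ℝ] E₁' × E₂' ↦ A v) (mfderiv_prodMap hf hg)

theorem pullback₁_prodMap_prodOneForm {η₁ : OneForm J₁ N₁} {η₂ : OneForm J₂ N₂}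
    (hf : MDifferentiable I₁ J₁ f) (hg : MDifferentiable I₂ J₂ g) :
    pullback₁ (I₁.prod I₂) (Prod.map f g) (prodOneForm η₁ η₂)
      = prodOneForm (pullback₁ I₁ f η₁) (pullback₁ I₂ g η₂) := by
  refine funext fun y ↦ ContinuousLinearMap.ext fun v ↦ ?_
  exact ((oneForm_congr (prodOneForm η₁ η₂) rfl (mfderiv_prodMap_apply (hf _) (hg _) v)).trans
    (prodOneForm_apply η₁ η₂ (Prod.map f g y) _ _)).trans
    (prodOneForm_apply (pullback₁ I₁ f η₁) (pullback₁ I₂ g η₂) y v.1 v.2).symm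

end ProdMap

namespace ReducedProduct

section ReducedFlow

variable {M₁ M₂ : Type*} [TopologicalSpace M₁] [TopologicalSpace M₂]

/-- The flow `[(y₁, y₂)] ↦ [(φ₁ t y₁, y₂)] = [(y₁, φ₂ t y₂)]` on the quotient, whose generator is
the Reeb field of the reduced product. -/
def flow (φ₁ : Flow ℝ M₁) (φ₂ : Flow ℝ M₂) : Flow ℝ (ReducedProduct φ₁ φ₂) where
  toFun t := Quotient.map (fun y ↦ (φ₁ t y.1, y.2)) (by
    rintro y _ ⟨s, rfl⟩
    refine ⟨s, Prod.ext ?_ rfl⟩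
    change φ₁ s (φ₁ t y.1) = φ₁ t (φ₁ s y.1)
    rw [← φ₁.map_add, ← φ₁.map_add, add_comm])
  cont' := by
    have hquot : IsOpenQuotientMap (Prod.map (id : ℝ → ℝ) (mk φ₁ φ₂)) :=
      IsOpenQuotientMap.id.prodMap (isOpenQuotientMap_mk φ₁ φ₂)
    have hcont : Continuous fun q : ℝ × M₁ × M₂ ↦ mk φ₁ φ₂ (φ₁ q.1 q.2.1, q.2.2) :=
      (isOpenQuotientMap_mk φ₁ φ₂).continuous.comp
        ((φ₁.continuous continuous_fst (continuous_fst.comp continuous_snd)).prodMk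
          (continuous_snd.comp continuous_snd))
    exact hquot.continuous_comp_iff.1 hcont
  map_add' t s := by
    rintro ⟨y⟩
    exact congrArg (fun z ↦ mk φ₁ φ₂ (z, y.2)) (φ₁.map_add t s y.1)
  map_zero' := by
    rintro ⟨y⟩
    exact congrArg (fun z ↦ mk φ₁ φ₂ (z, y.2)) (φ₁.map_zero_apply y.1)

theorem flow_mk (φ₁ : Flow ℝ M₁) (φ₂ : Flow ℝ M₂) (t : ℝ) (y : M₁ × M₂) :
    flow φ₁ φ₂ t (mk φ₁ φ₂ y) = mk φ₁ φ₂ (φ₁ t y.1, y.2) := rfl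

end ReducedFlow

variable {E₁ : Type*} [NormedAddCommGroup E₁] [NormedSpace ℝ E₁]
  {H₁ : Type*} [TopologicalSpace H₁] {I₁ : ModelWithCorners ℝ E₁ H₁}
  {M₁ : Type*} [TopologicalSpace M₁] [ChartedSpace H₁ M₁]
  {E₁' : Type*} [NormedAddCommGroup E₁'] [NormedSpace ℝ E₁']
  {H₁' : Type*} [TopologicalSpace H₁'] {J₁ : ModelWithCorners ℝ E₁' H₁'}
  {N₁ : Type*} [TopologicalSpace N₁] [ChartedSpace H₁' N₁]
  {E₂ : Type*} [NormedAddCommGroup E₂] [NormedSpace ℝ E₂]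
  {H₂ : Type*} [TopologicalSpace H₂] {I₂ : ModelWithCorners ℝ E₂ H₂}
  {M₂ : Type*} [TopologicalSpace M₂] [ChartedSpace H₂ M₂]
  {E₂' : Type*} [NormedAddCommGroup E₂'] [NormedSpace ℝ E₂']
  {H₂' : Type*} [TopologicalSpace H₂'] {J₂ : ModelWithCorners ℝ E₂' H₂'}
  {N₂ : Type*} [TopologicalSpace N₂] [ChartedSpace H₂' N₂]
  {η₁ : OneForm I₁ M₁} {R₁ : VField I₁ M₁} {φ₁ : Flow ℝ M₁} {p₁ : M₁ → N₁} {Ω₁ : TwoForm J₁ N₁}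
  {η₂ : OneForm I₂ M₂} {R₂ : VField I₂ M₂} {φ₂ : Flow ℝ M₂} {p₂ : M₂ → N₂} {Ω₂ : TwoForm J₂ N₂}
  {ρ : ENNReal}
  {F : Type*} [NormedAddCommGroup F] [NormedSpace ℝ F]
  {G : Type*} [TopologicalSpace G] {K : ModelWithCorners ℝ F G}
  [ChartedSpace G (ReducedProduct φ₁ φ₂)]

section Flow

variable (hs : HasSmoothLocalSections (I₁.prod I₂) K (mk φ₁ φ₂)) (hφ₁ : IsFlowOf I₁ R₁ φ₁)
include hs hφ₁

theorem contMDiff_flow : ContMDiff (𝓘(ℝ, ℝ).prod K) K ∞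
    (fun q : ℝ × ReducedProduct φ₁ φ₂ ↦ flow φ₁ φ₂ q.1 q.2) := by
  rintro ⟨t, q⟩
  obtain ⟨y, rfl⟩ := (isOpenQuotientMap_mk φ₁ φ₂).surjective q
  obtain ⟨s, hsmooth, hmks, -⟩ := hs.exists_contMDiffAt_section y
  have hlift : ContMDiffAt (𝓘(ℝ, ℝ).prod K) (I₁.prod I₂) ∞
      (fun q : ℝ × ReducedProduct φ₁ φ₂ ↦ s q.2) (t, mk φ₁ φ₂ y) :=
    hsmooth.comp (t, mk φ₁ φ₂ y) contMDiffAt_snd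
  have hflow : ContMDiffAt (𝓘(ℝ, ℝ).prod K) (I₁.prod I₂) ∞
      (fun q : ℝ × ReducedProduct φ₁ φ₂ ↦ (φ₁ q.1 (s q.2).1, (s q.2).2)) (t, mk φ₁ φ₂ y) :=
    (hφ₁.smooth.contMDiffAt.comp (t, mk φ₁ φ₂ y) (contMDiffAt_fst.prodMk hlift.fst)).prodMk
      hlift.snd
  refine (hs.smooth.contMDiffAt.comp (t, mk φ₁ φ₂ y) hflow).congr_of_eventuallyEq ?_
  filter_upwards [continuousAt_snd.eventually hmks] with q hq
  exact (congrArg (flow φ₁ φ₂ q.1) hq).symm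

theorem isFlowOf_flow :
    IsFlowOf K (flowGenerator K (flow φ₁ φ₂)) (flow φ₁ φ₂) :=
  isFlowOf_flowGenerator (contMDiff_flow hs hφ₁)

theorem flowGenerator_mk (y : M₁ × M₂) :
    (show F from flowGenerator K (flow φ₁ φ₂) (mk φ₁ φ₂ y))
      = mfderiv (I₁.prod I₂) K (mk φ₁ φ₂) y (show E₁ × E₂ from (R₁ y.1, 0)) := by
  have hcurve := (hφ₁.integralCurve y.1 0).prodMk (hasMFDerivAt_const (I' := I₂) y.2 (0 : ℝ))
  have hmk : HasMFDerivAt (I₁.prod I₂) K (mk φ₁ φ₂) (φ₁ 0 y.1, y.2) _ :=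
    (hs.smooth.mdifferentiable (by simp) _).hasMFDerivAt
  refine (congrArg (fun A : ℝ →L[ℝ] F ↦ A 1) (hmk.comp 0 hcurve).mfderiv).trans ?_
  refine mfderiv_apply_congr (I := I₁.prod I₂) (J := K) (mk φ₁ φ₂)
    (Prod.ext (φ₁.map_zero_apply y.1) rfl : (φ₁ 0 y.1, y.2) = y)
    (v := ((1 : ℝ) • (show E₁ from R₁ (φ₁ 0 y.1)), (0 : E₂))) (Prod.ext ?_ rfl)
  exact (one_smul ℝ (show E₁ from R₁ (φ₁ 0 y.1))).trans
    (congrArg (fun z ↦ (show E₁ from R₁ z)) (φ₁.map_zero_apply y.1))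

end Flow

section OneForm

variable {η : OneForm K (ReducedProduct φ₁ φ₂)}
  (hη : pullback₁ (I₁.prod I₂) (mk φ₁ φ₂) η = prodOneForm η₁ η₂)
include hη

theorem oneForm_mfderiv_mk (y : M₁ × M₂) (v : TangentSpace (I₁.prod I₂) y) :
    η (mk φ₁ φ₂ y) (mfderiv (I₁.prod I₂) K (mk φ₁ φ₂) y v) = η₁ y.1 v.1 + η₂ y.2 v.2 :=
  (congrArg (fun α : OneForm (I₁.prod I₂) (M₁ × M₂) ↦ α y v) hη).trans
    (prodOneForm_apply η₁ η₂ y v.1 v.2)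

theorem oneForm_flowGenerator (hs : HasSmoothLocalSections (I₁.prod I₂) K (mk φ₁ φ₂))
    (hφ₁ : IsFlowOf I₁ R₁ φ₁) (hR₁ : IsReebField I₁ η₁ R₁) (q : ReducedProduct φ₁ φ₂) :
    η q (flowGenerator K (flow φ₁ φ₂) q) = 1 := by
  obtain ⟨y, rfl⟩ := (isOpenQuotientMap_mk φ₁ φ₂).surjective q
  exact ((oneForm_congr η rfl (flowGenerator_mk hs hφ₁ y)).trans (oneForm_mfderiv_mk hη y _)).trans
    ((congrArg₂ (· + ·) (hR₁.apply_one y.1) (map_zero _)).trans (add_zero 1))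

end OneForm

variable [IsManifold I₁ ∞ M₁] [IsManifold J₁ ∞ N₁] [IsManifold I₂ ∞ M₂] [IsManifold J₂ ∞ N₂]
  (h₁ : IsPrincipalContactification I₁ J₁ η₁ R₁ φ₁ p₁ Ω₁ ρ)
  (h₂ : IsPrincipalContactification I₂ J₂ η₂ R₂ φ₂ p₂ Ω₂ ρ)

/-- The projection `[(y₁, y₂)] ↦ (p₁ y₁, p₂ y₂)` of the reduced product. -/
def proj : ReducedProduct φ₁ φ₂ → N₁ × N₂ :=
  Quotient.lift (Prod.map p₁ p₂) (by
    rintro y _ ⟨t, rfl⟩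
    exact Prod.ext (h₁.proj_flow y.1 t).symm (h₂.proj_flow y.2 (-t)).symm)

theorem proj_mk (y : M₁ × M₂) : proj h₁ h₂ (mk φ₁ φ₂ y) = (p₁ y.1, p₂ y.2) := rfl

theorem surjective_proj : Surjective (proj h₁ h₂) := by
  rintro ⟨x₁, x₂⟩
  obtain ⟨y₁, rfl⟩ := h₁.surjective x₁
  obtain ⟨y₂, rfl⟩ := h₂.surjective x₂
  exact ⟨mk φ₁ φ₂ (y₁, y₂), rfl⟩

include h₁ h₂ in
theorem flow_eq_iff (q : ReducedProduct φ₁ φ₂) (t : ℝ) :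
    flow φ₁ φ₂ t q = q ↔ t ∈ periodGroup ρ := by
  obtain ⟨y, rfl⟩ := (isOpenQuotientMap_mk φ₁ φ₂).surjective q
  rw [flow_mk, mk_eq_iff]
  constructor
  · rintro ⟨s, hst⟩
    have hmem₁ : s + t ∈ periodGroup ρ :=
      (h₁.period _ _).1 ((φ₁.map_add s t y.1).trans (congrArg Prod.fst hst))
    have hmem₂ : -s ∈ periodGroup ρ := (h₂.period _ _).1 (congrArg Prod.snd hst)
    simpa only [add_neg_cancel_comm] using add_mem hmem₁ hmem₂
  · refine fun ht ↦ ⟨0, Prod.ext ((φ₁.map_zero_apply _).trans ((h₁.period _ _).2 ht)) ?_⟩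
    exact (congrArg (φ₂ · y.2) neg_zero).trans (φ₂.map_zero_apply y.2)

theorem proj_eq_iff (q q' : ReducedProduct φ₁ φ₂) :
    proj h₁ h₂ q = proj h₁ h₂ q' ↔ ∃ t, flow φ₁ φ₂ t q = q' := by
  obtain ⟨y, rfl⟩ := (isOpenQuotientMap_mk φ₁ φ₂).surjective q
  obtain ⟨y', rfl⟩ := (isOpenQuotientMap_mk φ₁ φ₂).surjective q'
  constructor
  · intro hpy
    obtain ⟨s, hs⟩ := (h₁.orbits _ _).1 (congrArg Prod.fst hpy)
    obtain ⟨t, ht⟩ := (h₂.orbits _ _).1 (congrArg Prod.snd hpy)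
    refine ⟨t + s, ?_⟩
    rw [flow_mk, φ₁.map_add, hs]
    exact (mk_flow φ₁ φ₂ t (y'.1, y.2)).trans (by rw [ht])
  · rintro ⟨t, ht⟩
    rw [← ht, flow_mk, proj_mk, proj_mk, h₁.proj_flow]

variable (hs : HasSmoothLocalSections (I₁.prod I₂) K (mk φ₁ φ₂))
include hs

section

include h₁ h₂

theorem mfderiv_mk_differenceFlow (y : M₁ × M₂) :
    mfderiv (I₁.prod I₂) K (mk φ₁ φ₂) y (prodVField R₁ (-R₂) y) = 0 :=
  (isFlowOf_differenceFlow h₁.flow h₂.flow).mfderiv_comp_eq_zero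
    (hs.smooth.mdifferentiable (by simp)) (fun _ t ↦ ((mk_eq_iff φ₁ φ₂).2 ⟨t, rfl⟩).symm) y

variable [FiniteDimensional ℝ E₁] [FiniteDimensional ℝ E₂]
  (hd : Module.finrank ℝ E₁ + Module.finrank ℝ E₂ = Module.finrank ℝ F + 1)
include hd

-- The kernel is the line spanned by `R₁ - R₂`, on which `η₁ ⊕ η₂` takes the value `1 - 1`.
theorem prodOneForm_eq_zero (y : M₁ × M₂) (v : TangentSpace (I₁.prod I₂) y)
    (hv : mfderiv (I₁.prod I₂) K (mk φ₁ φ₂) y v = 0) : prodOneForm η₁ η₂ y v = 0 := by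
  set w : E₁ × E₂ := prodVField R₁ (-R₂) y
  have hη₁ : η₁ y.1 (R₁ y.1) = 1 := h₁.reeb.apply_one y.1
  have hη₂ : η₂ y.2 (-R₂ y.2) = -1 := (map_neg _ _).trans (congrArg Neg.neg (h₂.reeb.apply_one y.2))
  have hw₀ : w ≠ 0 := fun hw ↦ zero_ne_one <|
    (map_zero (show E₁ →L[ℝ] ℝ from η₁ y.1)).symm.trans
      ((congrArg (show E₁ →L[ℝ] ℝ from η₁ y.1) (congrArg Prod.fst hw)).symm.trans hη₁)
  have hαw : prodOneForm η₁ η₂ y w = 0 :=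
    (prodOneForm_apply η₁ η₂ y (R₁ y.1) (-R₂ y.2)).trans (by rw [hη₁, hη₂, add_neg_cancel])
  obtain ⟨c, rfl⟩ := exists_smul_eq_of_apply_eq_zero (hs.surjective_mfderiv y)
    (Module.finrank_prod.trans hd) (mfderiv_mk_differenceFlow h₁ h₂ hs y) hw₀ hv
  exact ((show E₁ × E₂ →L[ℝ] ℝ from prodOneForm η₁ η₂ y).map_smul c w).trans
    ((congrArg (c • ·) hαw).trans (smul_zero c))

theorem exists_oneForm [I₁.Boundaryless] [I₂.Boundaryless] [K.Boundaryless]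
    [IsManifold K ∞ (ReducedProduct φ₁ φ₂)] :
    ∃ η : OneForm K (ReducedProduct φ₁ φ₂), SmoothOneForm K η ∧
      pullback₁ (I₁.prod I₂) (mk φ₁ φ₂) η = prodOneForm η₁ η₂ := by
  refine hs.exists_pullback₁_eq_of_flow (isOpenQuotientMap_mk φ₁ φ₂).surjective
    (h₁.contact.smooth.prodOneForm h₂.contact.smooth)
    (isFlowOf_differenceFlow h₁.flow h₂.flow).contMDiff (fun _ _ ↦ mk_eq_iff φ₁ φ₂)
    (fun t ↦ ?_) (prodOneForm_eq_zero h₁ h₂ hs hd)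
  refine (pullback₁_prodMap_prodOneForm ((h₁.flow.contMDiff t).mdifferentiable (by simp))
    ((h₂.flow.contMDiff (-t)).mdifferentiable (by simp))).trans ?_
  rw [h₁.flow.pullback₁_reeb h₁.contact.smooth h₁.reeb,
    h₂.flow.pullback₁_reeb h₂.contact.smooth h₂.reeb]

end

theorem contMDiff_proj : ContMDiff K (J₁.prod J₂) ∞ (proj h₁ h₂) :=
  (hs.contMDiff_iff (isOpenQuotientMap_mk φ₁ φ₂).surjective).2
    (h₁.submersion.smooth.prodMap h₂.submersion.smooth)

theorem hasSmoothLocalSections_proj : HasSmoothLocalSections K (J₁.prod J₂) (proj h₁ h₂) := by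
  refine ⟨contMDiff_proj h₁ h₂ hs, fun q ↦ ?_⟩
  obtain ⟨y, rfl⟩ := (isOpenQuotientMap_mk φ₁ φ₂).surjective q
  obtain ⟨U₁, σ₁, hU₁, hy₁, hσ₁, hpσ₁, hσy₁⟩ := h₁.hasSmoothLocalSections.exists_section y.1
  obtain ⟨U₂, σ₂, hU₂, hy₂, hσ₂, hpσ₂, hσy₂⟩ := h₂.hasSmoothLocalSections.exists_section y.2
  refine ⟨U₁ ×ˢ U₂, mk φ₁ φ₂ ∘ Prod.map σ₁ σ₂, hU₁.prod hU₂, ⟨hy₁, hy₂⟩,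
    hs.smooth.comp_contMDiffOn (hσ₁.prodMap hσ₂), fun x hx ↦ ?_, ?_⟩
  · exact Prod.ext (hpσ₁ _ hx.1) (hpσ₂ _ hx.2)
  · exact congrArg (mk φ₁ φ₂) (Prod.ext hσy₁ hσy₂)

theorem mfderiv_proj_mfderiv_mk (y : M₁ × M₂) (v : TangentSpace (I₁.prod I₂) y) :
    (show E₁' × E₂' from mfderiv K (J₁.prod J₂) (proj h₁ h₂) (mk φ₁ φ₂ y)
        (mfderiv (I₁.prod I₂) K (mk φ₁ φ₂) y v))
      = (mfderiv I₁ J₁ p₁ y.1 v.1, mfderiv I₂ J₂ p₂ y.2 v.2) :=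
  (mfderiv_comp_apply y ((contMDiff_proj h₁ h₂ hs).mdifferentiable (by simp) _)
    (hs.smooth.mdifferentiable (by simp) y) v).symm.trans
    (mfderiv_prodMap_apply (h₁.submersion.smooth.mdifferentiable (by simp) y.1)
      (h₂.submersion.smooth.mdifferentiable (by simp) y.2) v)

variable {η : OneForm K (ReducedProduct φ₁ φ₂)}
  [IsManifold K ∞ (ReducedProduct φ₁ φ₂)] [I₁.Boundaryless] [I₂.Boundaryless] [K.Boundaryless]
  (hη : SmoothOneForm K η) (hα : pullback₁ (I₁.prod I₂) (mk φ₁ φ₂) η = prodOneForm η₁ η₂)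
include hη hα

theorem extDeriv₁_eq (q : ReducedProduct φ₁ φ₂) (u v : TangentSpace K q) :
    extDeriv₁ K η q u v = pullback₂ K (proj h₁ h₂) (prodTwoForm Ω₁ Ω₂) q u v := by
  obtain ⟨y, rfl⟩ := (isOpenQuotientMap_mk φ₁ φ₂).surjective q
  obtain ⟨u, rfl⟩ := hs.surjective_mfderiv y u
  obtain ⟨v, rfl⟩ := hs.surjective_mfderiv y v
  have hext : extDeriv₁ (I₁.prod I₂) (prodOneForm η₁ η₂) y u v
      = pullback₂ I₁ p₁ Ω₁ y.1 u.1 v.1 + pullback₂ I₂ p₂ Ω₂ y.2 u.2 v.2 :=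
    (extDeriv₁_prodOneForm h₁.contact.smooth h₂.contact.smooth y u v).trans
      (congrArg₂ (· + ·) (h₁.extDeriv_eq y.1 _ _) (h₂.extDeriv_eq y.2 _ _))
  refine (extDeriv₁_pullback₁ hη hs.smooth.contMDiffAt u v).symm.trans ?_
  rw [hα, hext]
  exact ((twoForm_congr (prodTwoForm Ω₁ Ω₂) rfl (mfderiv_proj_mfderiv_mk h₁ h₂ hs y u)
    (mfderiv_proj_mfderiv_mk h₁ h₂ hs y v)).trans
      (prodTwoForm_apply Ω₁ Ω₂ (p₁ y.1, p₂ y.2) _ _ _ _)).symm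

theorem isPrincipalContactification [J₁.Boundaryless] [J₂.Boundaryless] [FiniteDimensional ℝ E₁']
    [FiniteDimensional ℝ E₂'] [FiniteDimensional ℝ F]
    (hd : Module.finrank ℝ F = Module.finrank ℝ (E₁' × E₂') + 1) :
    IsPrincipalContactification K (J₁.prod J₂) η (flowGenerator K (flow φ₁ φ₂))
      (flow φ₁ φ₂) (proj h₁ h₂) (prodTwoForm Ω₁ Ω₂) ρ := by
  have hflow := isFlowOf_flow hs h₁.flow
  have hproj := hasSmoothLocalSections_proj h₁ h₂ hs
  have hsymp := h₁.symplectic.prodTwoForm h₂.symplectic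
  have hext := extDeriv₁_eq h₁ h₂ hs hη hα
  have hone := oneForm_flowGenerator hα hs h₁.flow h₁.reeb
  have hzero := hflow.mfderiv_comp_eq_zero (hproj.smooth.mdifferentiable (by simp))
    fun q t ↦ ((proj_eq_iff h₁ h₂ q _).2 ⟨t, rfl⟩).symm
  have hcontact := IsContactForm.of_extDeriv_eq hd hη hone hzero hproj.surjective_mfderiv hext
    hsymp.nondegenerate
  refine ⟨hsymp, hcontact, .of_extDeriv_eq hone hzero hext, hflow, h₁.period_pos,
    flow_eq_iff h₁ h₂, surjective_proj h₁ h₂, hproj.isSmoothSubmersion, proj_eq_iff h₁ h₂,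
    fun x ↦ ?_, hext⟩
  obtain ⟨q, rfl⟩ := surjective_proj h₁ h₂ x
  obtain ⟨U, σ, hU, hq, hσ, hpσ, -⟩ := hproj.exists_section q
  exact ⟨U, σ, hU, hq, hσ, hpσ⟩

end ReducedProduct

/-! ### The tensor product isomorphism -/

section MulProd

variable {E₁ : Type*} [NormedAddCommGroup E₁] [NormedSpace ℝ E₁]
  {H₁ : Type*} [TopologicalSpace H₁] {I₁ : ModelWithCorners ℝ E₁ H₁}
  {M₁ : Type*} [TopologicalSpace M₁] [ChartedSpace H₁ M₁]
  {E₂ : Type*} [NormedAddCommGroup E₂] [NormedSpace ℝ E₂]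
  {H₂ : Type*} [TopologicalSpace H₂] {I₂ : ModelWithCorners ℝ E₂ H₂}
  {M₂ : Type*} [TopologicalSpace M₂] [ChartedSpace H₂ M₂]

theorem mvfderiv_fst_mul_snd_apply {F₁ : M₁ → ℂ} {F₂ : M₂ → ℂ} {y : M₁ × M₂}
    (hF₁ : MDifferentiableAt I₁ 𝓘(ℝ, ℂ) F₁ y.1) (hF₂ : MDifferentiableAt I₂ 𝓘(ℝ, ℂ) F₂ y.2)
    (v : TangentSpace (I₁.prod I₂) y) :
    mvfderiv (I₁.prod I₂) (fun y : M₁ × M₂ ↦ F₁ y.1 * F₂ y.2) y v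
      = mvfderiv I₁ F₁ y.1 v.1 * F₂ y.2 + F₁ y.1 * mvfderiv I₂ F₂ y.2 v.2 := by
  have hfst : MDifferentiableAt (I₁.prod I₂) I₁ (Prod.fst : M₁ × M₂ → M₁) y := mdifferentiableAt_fst
  have hsnd : MDifferentiableAt (I₁.prod I₂) I₂ (Prod.snd : M₁ × M₂ → M₂) y := mdifferentiableAt_snd
  have hmul := mvfderiv_mul_apply (hF₁.comp y hfst) (hF₂.comp y hsnd) v
  have hcomp₁ := mvfderiv_comp_complex_apply hF₁ hfst v
  have hcomp₂ := mvfderiv_comp_complex_apply hF₂ hsnd v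
  rw [mfderiv_fst] at hcomp₁
  rw [mfderiv_snd] at hcomp₂
  exact hmul.trans ((add_comm _ _).trans
    (congrArg₂ (· + ·) (congrArg (· * F₂ y.2) hcomp₁) (congrArg (F₁ y.1 * ·) hcomp₂)))

end MulProd

namespace IsPrincipalContactification

variable {E : Type*} [NormedAddCommGroup E] [NormedSpace ℝ E] [FiniteDimensional ℝ E]
  {H : Type*} [TopologicalSpace H] {I : ModelWithCorners ℝ E H}
  {M : Type*} [TopologicalSpace M] [ChartedSpace H M] [IsManifold I ∞ M]
  {E' : Type*} [NormedAddCommGroup E'] [NormedSpace ℝ E'] [FiniteDimensional ℝ E']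
  {H' : Type*} [TopologicalSpace H'] {J : ModelWithCorners ℝ E' H'} [J.Boundaryless]
  {N : Type*} [TopologicalSpace N] [ChartedSpace H' N] [IsManifold J ∞ N]
  {η : OneForm I M} {R : VField I M} {φ : Flow ℝ M} {p : M → N} {Ω : TwoForm J N} {ρ : ENNReal}

theorem smoothOn_frame (h : IsPrincipalContactification I J η R φ p Ω ρ)
    (hd : Module.finrank ℝ E = Module.finrank ℝ E' + 1) {σ : N → M} {V : Set N} (hV : IsOpen V)
    (hσ : ContMDiffOn J I ∞ σ V) (hpσ : ∀ x ∈ V, p (σ x) = x) :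
    (prequantumBundle h).SmoothOn (h.frame σ) V :=
  (h.contMDiffOn_sectionFun_iff hd hV hσ hpσ _).2 <| contMDiffOn_const.congr fun x hx ↦
    (sectionFun_eq (h.frame σ) ⟨σ x, hpσ x hx⟩).trans (h.frame_apply (hpσ x hx))

end IsPrincipalContactification

namespace ReducedProduct

variable {E₁ : Type*} [NormedAddCommGroup E₁] [NormedSpace ℝ E₁]
  {H₁ : Type*} [TopologicalSpace H₁] {I₁ : ModelWithCorners ℝ E₁ H₁}
  {M₁ : Type*} [TopologicalSpace M₁] [ChartedSpace H₁ M₁]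
  {E₁' : Type*} [NormedAddCommGroup E₁'] [NormedSpace ℝ E₁']
  {H₁' : Type*} [TopologicalSpace H₁'] {J₁ : ModelWithCorners ℝ E₁' H₁'}
  {N₁ : Type*} [TopologicalSpace N₁] [ChartedSpace H₁' N₁]
  {E₂ : Type*} [NormedAddCommGroup E₂] [NormedSpace ℝ E₂]
  {H₂ : Type*} [TopologicalSpace H₂] {I₂ : ModelWithCorners ℝ E₂ H₂}
  {M₂ : Type*} [TopologicalSpace M₂] [ChartedSpace H₂ M₂]
  {E₂' : Type*} [NormedAddCommGroup E₂'] [NormedSpace ℝ E₂']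
  {H₂' : Type*} [TopologicalSpace H₂'] {J₂ : ModelWithCorners ℝ E₂' H₂'}
  {N₂ : Type*} [TopologicalSpace N₂] [ChartedSpace H₂' N₂]
  {η₁ : OneForm I₁ M₁} {R₁ : VField I₁ M₁} {φ₁ : Flow ℝ M₁} {p₁ : M₁ → N₁} {Ω₁ : TwoForm J₁ N₁}
  {η₂ : OneForm I₂ M₂} {R₂ : VField I₂ M₂} {φ₂ : Flow ℝ M₂} {p₂ : M₂ → N₂} {Ω₂ : TwoForm J₂ N₂}
  {ρ : ENNReal} [IsManifold I₁ ∞ M₁] [IsManifold J₁ ∞ N₁] [IsManifold I₂ ∞ M₂] [IsManifold J₂ ∞ N₂]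
  (h₁ : IsPrincipalContactification I₁ J₁ η₁ R₁ φ₁ p₁ Ω₁ ρ)
  (h₂ : IsPrincipalContactification I₂ J₂ η₂ R₂ φ₂ p₂ Ω₂ ρ)

/-- The point `[(y₁, y₂)]` of the fibre of `proj` over `x` that is represented by points of the
fibres of `p₁` and `p₂`. -/
def mkFiber {x : N₁ × N₂} (y₁ : {y : M₁ // p₁ y = x.1}) (y₂ : {y : M₂ // p₂ y = x.2}) :
    {q : ReducedProduct φ₁ φ₂ // proj h₁ h₂ q = x} :=
  ⟨mk φ₁ φ₂ (y₁, y₂), Prod.ext y₁.2 y₂.2⟩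

variable {F : Type*} [NormedAddCommGroup F] [NormedSpace ℝ F]
  {G : Type*} [TopologicalSpace G] {K : ModelWithCorners ℝ F G}
  [ChartedSpace G (ReducedProduct φ₁ φ₂)] [IsManifold K ∞ (ReducedProduct φ₁ φ₂)]
  {η : OneForm K (ReducedProduct φ₁ φ₂)} {R : VField K (ReducedProduct φ₁ φ₂)}
  {Ω : TwoForm (J₁.prod J₂) (N₁ × N₂)}
  (h : IsPrincipalContactification K (J₁.prod J₂) η R (flow φ₁ φ₂) (proj h₁ h₂) Ω ρ)

/-- The isomorphism of fibres under which `f₁ ⊗ f₂` becomes the function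
`[(y₁, y₂)] ↦ f₁ y₁ * f₂ y₂`. It is defined by evaluation at a chosen point of each fibre. -/
noncomputable def tensorEquiv (x : N₁ × N₂) :
    (equivariantFunctions φ₁ p₁ ρ x.1 ⊗[ℂ] equivariantFunctions φ₂ p₂ ρ x.2)
      ≃ₗ[ℂ] equivariantFunctions (flow φ₁ φ₂) (proj h₁ h₂) ρ x :=
  let y₁ : {y : M₁ // p₁ y = x.1} := ⟨surjInv h₁.surjective x.1, surjInv_eq h₁.surjective x.1⟩
  let y₂ : {y : M₂ // p₂ y = x.2} := ⟨surjInv h₂.surjective x.2, surjInv_eq h₂.surjective x.2⟩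
  (TensorProduct.congr (h₁.evalEquiv y₁) (h₂.evalEquiv y₂)).trans
    ((TensorProduct.lid ℂ ℂ).trans (h.evalEquiv (mkFiber h₁ h₂ y₁ y₂)).symm)

theorem tensorEquiv_tmul {x : N₁ × N₂} (f₁ : equivariantFunctions φ₁ p₁ ρ x.1)
    (f₂ : equivariantFunctions φ₂ p₂ ρ x.2) (y₁ : {y : M₁ // p₁ y = x.1})
    (y₂ : {y : M₂ // p₂ y = x.2}) :
    (tensorEquiv h₁ h₂ h x (f₁ ⊗ₜ[ℂ] f₂)).1 (mkFiber h₁ h₂ y₁ y₂) = f₁.1 y₁ * f₂.1 y₂ := by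
  set z₁ : {y : M₁ // p₁ y = x.1} := ⟨surjInv h₁.surjective x.1, surjInv_eq h₁.surjective x.1⟩
  set z₂ : {y : M₂ // p₂ y = x.2} := ⟨surjInv h₂.surjective x.2, surjInv_eq h₂.surjective x.2⟩
  have hbase : (tensorEquiv h₁ h₂ h x (f₁ ⊗ₜ[ℂ] f₂)).1 (mkFiber h₁ h₂ z₁ z₂)
      = f₁.1 z₁ * f₂.1 z₂ := h.evalEquiv_symm_apply _ _
  obtain ⟨t₁, ht₁⟩ := h₁.exists_time_fiber z₁ y₁
  obtain ⟨t₂, ht₂⟩ := h₂.exists_time_fiber z₂ y₂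
  have hflow : flow φ₁ φ₂ (t₂ + t₁) (mkFiber h₁ h₂ z₁ z₂) = mkFiber h₁ h₂ y₁ y₂ := by
    change flow φ₁ φ₂ (t₂ + t₁) (mk φ₁ φ₂ (z₁, z₂)) = mk φ₁ φ₂ (y₁, y₂)
    rw [flow_mk, φ₁.map_add, ht₁, ← ht₂]
    exact mk_flow φ₁ φ₂ t₂ (y₁, z₂)
  rw [(tensorEquiv h₁ h₂ h x (f₁ ⊗ₜ[ℂ] f₂)).2 _ _ _ hflow, hbase, f₁.2 z₁ y₁ t₁ ht₁,
    f₂.2 z₂ y₂ t₂ ht₂, phase_add]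
  ring

theorem sectionFun_tensorEquiv_tmul (ψ₁ : Π x, equivariantFunctions φ₁ p₁ ρ x)
    (ψ₂ : Π x, equivariantFunctions φ₂ p₂ ρ x) (y : M₁ × M₂) :
    sectionFun (fun x ↦ tensorEquiv h₁ h₂ h x (ψ₁ x.1 ⊗ₜ[ℂ] ψ₂ x.2)) (mk φ₁ φ₂ y)
      = sectionFun ψ₁ y.1 * sectionFun ψ₂ y.2 :=
  tensorEquiv_tmul h₁ h₂ h (x := (p₁ y.1, p₂ y.2)) (ψ₁ (p₁ y.1)) (ψ₂ (p₂ y.2)) ⟨y.1, rfl⟩ ⟨y.2, rfl⟩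

theorem sectionFun_tensorEquiv_sum {ι : Type*} [Fintype ι] {ψ : Π x : N₁ × N₂,
      equivariantFunctions φ₁ p₁ ρ x.1 ⊗[ℂ] equivariantFunctions φ₂ p₂ ρ x.2}
    {f : ι → N₁ × N₂ → ℂ} {s₁ : ι → Π x, equivariantFunctions φ₁ p₁ ρ x}
    {s₂ : ι → Π x, equivariantFunctions φ₂ p₂ ρ x} {y : M₁ × M₂}
    (hψ : ψ (p₁ y.1, p₂ y.2)
      = ∑ i, f i (p₁ y.1, p₂ y.2) • (s₁ i (p₁ y.1) ⊗ₜ[ℂ] s₂ i (p₂ y.2))) :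
    sectionFun (fun x ↦ tensorEquiv h₁ h₂ h x (ψ x)) (mk φ₁ φ₂ y)
      = ∑ i, f i (p₁ y.1, p₂ y.2) * (sectionFun (s₁ i) y.1 * sectionFun (s₂ i) y.2) := by
  set L : (equivariantFunctions φ₁ p₁ ρ (p₁ y.1) ⊗[ℂ] equivariantFunctions φ₂ p₂ ρ (p₂ y.2))
      →ₗ[ℂ] ℂ := evalFiber (flow φ₁ φ₂) (proj h₁ h₂) ρ ⟨mk φ₁ φ₂ y, rfl⟩ ∘ₗ
    (tensorEquiv h₁ h₂ h (p₁ y.1, p₂ y.2)).toLinearMap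
  refine (congrArg L hψ).trans ((map_sum L _ _).trans (Finset.sum_congr rfl fun i _ ↦ ?_))
  exact (map_smul L (f i (p₁ y.1, p₂ y.2)) _).trans (congrArg (f i (p₁ y.1, p₂ y.2) * ·)
    (sectionFun_tensorEquiv_tmul h₁ h₂ h (s₁ i) (s₂ i) y))

theorem eq_smul_frame_tmul_frame (ψ : Π x : N₁ × N₂,
      equivariantFunctions φ₁ p₁ ρ x.1 ⊗[ℂ] equivariantFunctions φ₂ p₂ ρ x.2)
    {σ₁ : N₁ → M₁} {σ₂ : N₂ → M₂} {x : N₁ × N₂} (hσ₁ : p₁ (σ₁ x.1) = x.1)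
    (hσ₂ : p₂ (σ₂ x.2) = x.2) :
    ψ x = sectionFun (fun x ↦ tensorEquiv h₁ h₂ h x (ψ x)) (mk φ₁ φ₂ (σ₁ x.1, σ₂ x.2))
      • (h₁.frame σ₁ x.1 ⊗ₜ[ℂ] h₂.frame σ₂ x.2) := by
  set q := mkFiber h₁ h₂ (x := x) ⟨σ₁ x.1, hσ₁⟩ ⟨σ₂ x.2, hσ₂⟩
  set L := evalFiber (flow φ₁ φ₂) (proj h₁ h₂) ρ q ∘ₗ (tensorEquiv h₁ h₂ h x).toLinearMap
  have hL : Injective L := (h.evalFiber_bijective q).1.comp (tensorEquiv h₁ h₂ h x).injective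
  have hframe : L (h₁.frame σ₁ x.1 ⊗ₜ[ℂ] h₂.frame σ₂ x.2) = 1 :=
    (tensorEquiv_tmul h₁ h₂ h _ _ ⟨σ₁ x.1, hσ₁⟩ ⟨σ₂ x.2, hσ₂⟩).trans
      ((congrArg₂ (· * ·) (h₁.frame_apply hσ₁) (h₂.frame_apply hσ₂)).trans (one_mul 1))
  refine hL ?_
  rw [map_smul, hframe, smul_eq_mul, mul_one]
  exact (sectionFun_eq (fun x ↦ tensorEquiv h₁ h₂ h x (ψ x)) q).symm

theorem herm_tensorEquiv (x : N₁ × N₂) (f₁ g₁ : equivariantFunctions φ₁ p₁ ρ x.1)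
    (f₂ g₂ : equivariantFunctions φ₂ p₂ ρ x.2) :
    (prequantumBundle h).herm x (tensorEquiv h₁ h₂ h x (f₁ ⊗ₜ[ℂ] f₂))
        (tensorEquiv h₁ h₂ h x (g₁ ⊗ₜ[ℂ] g₂))
      = (prequantumBundle h₁).herm x.1 f₁ g₁ * (prequantumBundle h₂).herm x.2 f₂ g₂ := by
  obtain ⟨y₁, hy₁⟩ := h₁.surjective x.1
  obtain ⟨y₂, hy₂⟩ := h₂.surjective x.2
  rw [h.herm_eq (mkFiber h₁ h₂ ⟨y₁, hy₁⟩ ⟨y₂, hy₂⟩), tensorEquiv_tmul, tensorEquiv_tmul,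
    h₁.herm_eq ⟨y₁, hy₁⟩ f₁ g₁, h₂.herm_eq ⟨y₂, hy₂⟩ f₂ g₂, map_mul, mul_mul_mul_comm]

variable (hs : HasSmoothLocalSections (I₁.prod I₂) K (mk φ₁ φ₂))
include hs

section Smoothness

theorem smoothOn_iff_mk (ψ : Π x, equivariantFunctions (flow φ₁ φ₂) (proj h₁ h₂) ρ x)
    {W : Set (N₁ × N₂)} (hW : IsOpen W) :
    (prequantumBundle h).SmoothOn ψ W ↔ ContMDiffOn (I₁.prod I₂) 𝓘(ℝ, ℂ) ∞
      (fun y ↦ sectionFun ψ (mk φ₁ φ₂ y)) (Prod.map p₁ p₂ ⁻¹' W) :=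
  hs.contMDiffOn_iff (isOpenQuotientMap_mk φ₁ φ₂).surjective
    (hW.preimage h.submersion.smooth.continuous)

theorem smoothOn_tensorEquiv_sum {ι : Type*} [Fintype ι] {ψ : Π x : N₁ × N₂,
      equivariantFunctions φ₁ p₁ ρ x.1 ⊗[ℂ] equivariantFunctions φ₂ p₂ ρ x.2}
    {f : ι → N₁ × N₂ → ℂ} {s₁ : ι → Π x, equivariantFunctions φ₁ p₁ ρ x}
    {s₂ : ι → Π x, equivariantFunctions φ₂ p₂ ρ x} {U₁ : Set N₁} {U₂ : Set N₂} (hU₁ : IsOpen U₁)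
    (hU₂ : IsOpen U₂) (hf : ∀ i, ContMDiffOn (J₁.prod J₂) 𝓘(ℝ, ℂ) ∞ (f i) (U₁ ×ˢ U₂))
    (hs₁ : ∀ i, (prequantumBundle h₁).SmoothOn (s₁ i) U₁)
    (hs₂ : ∀ i, (prequantumBundle h₂).SmoothOn (s₂ i) U₂)
    (hψ : ∀ x ∈ U₁ ×ˢ U₂, ψ x = ∑ i, f i x • (s₁ i x.1 ⊗ₜ[ℂ] s₂ i x.2)) :
    (prequantumBundle h).SmoothOn (fun x ↦ tensorEquiv h₁ h₂ h x (ψ x)) (U₁ ×ˢ U₂) := by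
  refine (smoothOn_iff_mk h₁ h₂ h hs _ (hU₁.prod hU₂)).2 (ContMDiffOn.congr ?_ fun y hy ↦
    sectionFun_tensorEquiv_sum h₁ h₂ h (hψ (p₁ y.1, p₂ y.2) hy))
  intro y hy
  refine ContMDiffWithinAt.sum fun i _ ↦ ?_
  have hcoeff : ContMDiffOn (I₁.prod I₂) 𝓘(ℝ, ℂ) ∞ (fun y : M₁ × M₂ ↦ f i (p₁ y.1, p₂ y.2))
      (Prod.map p₁ p₂ ⁻¹' U₁ ×ˢ U₂) :=
    (hf i).comp (h₁.submersion.smooth.prodMap h₂.submersion.smooth).contMDiffOn fun y hy ↦ hy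
  have hfst : ContMDiffOn (I₁.prod I₂) 𝓘(ℝ, ℂ) ∞ (fun y : M₁ × M₂ ↦ sectionFun (s₁ i) y.1)
      (Prod.map p₁ p₂ ⁻¹' U₁ ×ˢ U₂) :=
    ContMDiffOn.comp (g := sectionFun (s₁ i)) (hs₁ i) contMDiffOn_fst fun y hy ↦ hy.1
  have hsnd : ContMDiffOn (I₁.prod I₂) 𝓘(ℝ, ℂ) ∞ (fun y : M₁ × M₂ ↦ sectionFun (s₂ i) y.2)
      (Prod.map p₁ p₂ ⁻¹' U₁ ×ˢ U₂) :=
    ContMDiffOn.comp (g := sectionFun (s₂ i)) (hs₂ i) contMDiffOn_snd fun y hy ↦ hy.2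
  exact (hcoeff.mul (hfst.mul hsnd)) y hy

theorem smoothOn_tensorEquiv_tmul {ψ₁ : Π x, equivariantFunctions φ₁ p₁ ρ x}
    {ψ₂ : Π x, equivariantFunctions φ₂ p₂ ρ x} {U₁ : Set N₁} {U₂ : Set N₂} (hU₁ : IsOpen U₁)
    (hU₂ : IsOpen U₂) (hψ₁ : (prequantumBundle h₁).SmoothOn ψ₁ U₁)
    (hψ₂ : (prequantumBundle h₂).SmoothOn ψ₂ U₂) :
    (prequantumBundle h).SmoothOn
      (fun x ↦ tensorEquiv h₁ h₂ h x (ψ₁ x.1 ⊗ₜ[ℂ] ψ₂ x.2)) (U₁ ×ˢ U₂) :=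
  smoothOn_tensorEquiv_sum h₁ h₂ h hs (ι := Unit) (f := fun _ _ ↦ 1) (s₁ := fun _ ↦ ψ₁)
    (s₂ := fun _ ↦ ψ₂) hU₁ hU₂ (fun _ ↦ contMDiffOn_const) (fun _ ↦ hψ₁) (fun _ ↦ hψ₂)
    fun x _ ↦ by rw [Fintype.sum_unique, one_smul]

theorem smoothOn_of_tensorSmoothOn (hL : (prequantumBundle h).IsHermitianLineBundle)
    {ψ : Π x : N₁ × N₂, equivariantFunctions φ₁ p₁ ρ x.1 ⊗[ℂ] equivariantFunctions φ₂ p₂ ρ x.2}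
    {W : Set (N₁ × N₂)} (hW : IsOpen W)
    (hψ : tensorSmoothOn (prequantumBundle h₁) (prequantumBundle h₂) ψ W) :
    (prequantumBundle h).SmoothOn (fun x ↦ tensorEquiv h₁ h₂ h x (ψ x)) W := by
  refine (hL.smoothOn_iff_locally _ W hW).2 fun x hx ↦ ?_
  obtain ⟨U₁, U₂, hU₁, hU₂, hxU, hUW, k, f, s₁, s₂, hf, hs₁, hs₂, hsum⟩ := hψ x hx
  exact ⟨U₁ ×ˢ U₂, hUW, hU₁.prod hU₂, hxU,
    smoothOn_tensorEquiv_sum h₁ h₂ h hs hU₁ hU₂ hf hs₁ hs₂ hsum⟩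

variable [J₁.Boundaryless] [J₂.Boundaryless] [FiniteDimensional ℝ E₁] [FiniteDimensional ℝ E₁']
  [FiniteDimensional ℝ E₂] [FiniteDimensional ℝ E₂']
  (hd₁ : Module.finrank ℝ E₁ = Module.finrank ℝ E₁' + 1)
  (hd₂ : Module.finrank ℝ E₂ = Module.finrank ℝ E₂' + 1)
include hd₁ hd₂

-- Near each point `ψ` is a smooth multiple of the product of two local frames.
theorem tensorSmoothOn_of_smoothOn {ψ : Π x : N₁ × N₂,
      equivariantFunctions φ₁ p₁ ρ x.1 ⊗[ℂ] equivariantFunctions φ₂ p₂ ρ x.2} {W : Set (N₁ × N₂)}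
    (hW : IsOpen W)
    (hψ : (prequantumBundle h).SmoothOn (fun x ↦ tensorEquiv h₁ h₂ h x (ψ x)) W) :
    tensorSmoothOn (prequantumBundle h₁) (prequantumBundle h₂) ψ W := by
  intro x hx
  obtain ⟨V₁, σ₁, hV₁, hx₁, hσ₁, hpσ₁⟩ := h₁.localSection x.1
  obtain ⟨V₂, σ₂, hV₂, hx₂, hσ₂, hpσ₂⟩ := h₂.localSection x.2
  obtain ⟨W₁, W₂, hW₁, hW₂, hxW₁, hxW₂, hWW⟩ := isOpen_prod_iff.1 hW x.1 x.2 hx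
  have hframe₁ := h₁.smoothOn_frame hd₁ (hV₁.inter hW₁) (hσ₁.mono inter_subset_left)
    fun z hz ↦ hpσ₁ z hz.1
  have hframe₂ := h₂.smoothOn_frame hd₂ (hV₂.inter hW₂) (hσ₂.mono inter_subset_left)
    fun z hz ↦ hpσ₂ z hz.1
  refine ⟨V₁ ∩ W₁, V₂ ∩ W₂, hV₁.inter hW₁, hV₂.inter hW₂, ⟨⟨hx₁, hxW₁⟩, hx₂, hxW₂⟩,
    (prod_mono inter_subset_right inter_subset_right).trans hWW, 1,
    fun _ z ↦ sectionFun (fun x ↦ tensorEquiv h₁ h₂ h x (ψ x)) (mk φ₁ φ₂ (σ₁ z.1, σ₂ z.2)),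
    fun _ ↦ h₁.frame σ₁, fun _ ↦ h₂.frame σ₂, fun _ ↦ ?_, fun _ ↦ hframe₁, fun _ ↦ hframe₂,
    fun z hz ↦ ?_⟩
  · refine ((smoothOn_iff_mk h₁ h₂ h hs _ hW).1 hψ).comp ((hσ₁.mono inter_subset_left).prodMap
      (hσ₂.mono inter_subset_left)) fun z hz ↦ ?_
    change (p₁ (σ₁ z.1), p₂ (σ₂ z.2)) ∈ W
    rw [hpσ₁ _ hz.1.1, hpσ₂ _ hz.2.1]
    exact hWW ⟨hz.1.2, hz.2.2⟩
  · rw [Fin.sum_univ_one]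
    exact eq_smul_frame_tmul_frame h₁ h₂ h ψ (hpσ₁ _ hz.1.1) (hpσ₂ _ hz.2.1)

end Smoothness

section Connection

variable [FiniteDimensional ℝ E₁] [FiniteDimensional ℝ E₁'] [FiniteDimensional ℝ E₂]
  [FiniteDimensional ℝ E₂'] [FiniteDimensional ℝ F]
  (hα : pullback₁ (I₁.prod I₂) (mk φ₁ φ₂) η = prodOneForm η₁ η₂)
  (hd₁ : Module.finrank ℝ E₁ = Module.finrank ℝ E₁' + 1)
  (hd₂ : Module.finrank ℝ E₂ = Module.finrank ℝ E₂' + 1)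
  (hd : Module.finrank ℝ F = Module.finrank ℝ (E₁' × E₂') + 1)
include hα hd₁ hd₂ hd h

theorem mfderiv_mk_horizontalLift (X₁ : VField J₁ N₁) (X₂ : VField J₂ N₂) (y : M₁ × M₂) :
    (show E₁ × E₂ →L[ℝ] F from mfderiv (I₁.prod I₂) K (mk φ₁ φ₂) y)
        (horizontalLift η₁ p₁ y.1 (X₁ (p₁ y.1)), horizontalLift η₂ p₂ y.2 (X₂ (p₂ y.2)))
      = (show F from horizontalLift η (proj h₁ h₂) (mk φ₁ φ₂ y)
        (prodVField X₁ X₂ (proj h₁ h₂ (mk φ₁ φ₂ y)))) := by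
  obtain ⟨hη₁, hp₁⟩ := h₁.horizontalLift_spec hd₁ y.1 (X₁ (p₁ y.1))
  obtain ⟨hη₂, hp₂⟩ := h₂.horizontalLift_spec hd₂ y.2 (X₂ (p₂ y.2))
  set v : E₁ × E₂ :=
    (horizontalLift η₁ p₁ y.1 (X₁ (p₁ y.1)), horizontalLift η₂ p₂ y.2 (X₂ (p₂ y.2)))
  exact h.eq_horizontalLift hd
    ((oneForm_mfderiv_mk hα y v).trans ((congrArg₂ (· + ·) hη₁ hη₂).trans (add_zero 0)))
    ((mfderiv_proj_mfderiv_mk h₁ h₂ hs y v).trans (Prod.ext hp₁ hp₂))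

theorem horizontalDeriv_mk (X₁ : VField J₁ N₁) (X₂ : VField J₂ N₂) {f : ReducedProduct φ₁ φ₂ → ℂ}
    {f₁ : M₁ → ℂ} {f₂ : M₂ → ℂ} (hf : ∀ y, f (mk φ₁ φ₂ y) = f₁ y.1 * f₂ y.2) {y : M₁ × M₂}
    (hfd : MDifferentiableAt K 𝓘(ℝ, ℂ) f (mk φ₁ φ₂ y))
    (hfd₁ : MDifferentiableAt I₁ 𝓘(ℝ, ℂ) f₁ y.1) (hfd₂ : MDifferentiableAt I₂ 𝓘(ℝ, ℂ) f₂ y.2) :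
    horizontalDeriv η (proj h₁ h₂) (prodVField X₁ X₂) f (mk φ₁ φ₂ y)
      = horizontalDeriv η₁ p₁ X₁ f₁ y.1 * f₂ y.2 + f₁ y.1 * horizontalDeriv η₂ p₂ X₂ f₂ y.2 := by
  refine (congrArg (show F →L[ℝ] ℂ from mvfderiv K f (mk φ₁ φ₂ y))
    (mfderiv_mk_horizontalLift h₁ h₂ h hs hα hd₁ hd₂ hd X₁ X₂ y)).symm.trans ?_
  refine (mvfderiv_comp_complex_apply hfd (hs.smooth.mdifferentiable (by simp) y) _).symm.trans ?_
  rw [show (fun y ↦ f (mk φ₁ φ₂ y)) = fun y : M₁ × M₂ ↦ f₁ y.1 * f₂ y.2 from funext hf]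
  exact mvfderiv_fst_mul_snd_apply hfd₁ hfd₂ _

variable [I₁.Boundaryless] [I₂.Boundaryless] [K.Boundaryless]

theorem D_tensorEquiv_tmul (X₁ : VField J₁ N₁) (X₂ : VField J₂ N₂)
    {ψ₁ : Π x, equivariantFunctions φ₁ p₁ ρ x} {ψ₂ : Π x, equivariantFunctions φ₂ p₂ ρ x}
    {U₁ : Set N₁} {U₂ : Set N₂} (hU₁ : IsOpen U₁)
    (hU₂ : IsOpen U₂) (hψ₁ : (prequantumBundle h₁).SmoothOn ψ₁ U₁)
    (hψ₂ : (prequantumBundle h₂).SmoothOn ψ₂ U₂) {x : N₁ × N₂} (hx : x ∈ U₁ ×ˢ U₂) :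
    (prequantumBundle h).D (prodVField X₁ X₂)
        (fun x ↦ tensorEquiv h₁ h₂ h x (ψ₁ x.1 ⊗ₜ[ℂ] ψ₂ x.2)) x
      = tensorEquiv h₁ h₂ h x
        ((show equivariantFunctions φ₁ p₁ ρ x.1 from (prequantumBundle h₁).D X₁ ψ₁ x.1) ⊗ₜ[ℂ] ψ₂ x.2
        + ψ₁ x.1 ⊗ₜ[ℂ]
          (show equivariantFunctions φ₂ p₂ ρ x.2 from (prequantumBundle h₂).D X₂ ψ₂ x.2)) := by
  obtain ⟨y₁, hy₁⟩ := h₁.surjective x.1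
  obtain ⟨y₂, hy₂⟩ := h₂.surjective x.2
  set q := mkFiber h₁ h₂ (x := x) ⟨y₁, hy₁⟩ ⟨y₂, hy₂⟩
  have hdiff₁ := h₁.mdifferentiableAt_sectionFun hU₁ hψ₁ hx.1
  have hdiff₂ := h₂.mdifferentiableAt_sectionFun hU₂ hψ₂ hx.2
  have hdiff := h.mdifferentiableAt_sectionFun (hU₁.prod hU₂)
    (smoothOn_tensorEquiv_tmul h₁ h₂ h hs hU₁ hU₂ hψ₁ hψ₂) hx
  have hD₁ := h₁.D_apply hd₁ X₁ hdiff₁ ⟨y₁, hy₁⟩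
  have hD₂ := h₂.D_apply hd₂ X₂ hdiff₂ ⟨y₂, hy₂⟩
  have hderiv := horizontalDeriv_mk h₁ h₂ h hs hα hd₁ hd₂ hd X₁ X₂ (y := (y₁, y₂))
    (sectionFun_tensorEquiv_tmul h₁ h₂ h ψ₁ ψ₂) (hdiff q q.2) (hdiff₁ y₁ hy₁) (hdiff₂ y₂ hy₂)
  refine h.fiber_ext q ((h.D_apply hd _ hdiff q).trans (hderiv.trans ?_))
  rw [← hD₁, ← hD₂, sectionFun_eq ψ₁ ⟨y₁, hy₁⟩, sectionFun_eq ψ₂ ⟨y₂, hy₂⟩,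
    ← tensorEquiv_tmul h₁ h₂ h, ← tensorEquiv_tmul h₁ h₂ h, map_add]
  rfl

variable [J₁.Boundaryless] [J₂.Boundaryless]

theorem isTensorProductIso :
    IsTensorProductIso (prequantumBundle h₁) (prequantumBundle h₂) (prequantumBundle h)
      (tensorEquiv h₁ h₂ h) where
  smoothOn_iff _ _ hW := ⟨tensorSmoothOn_of_smoothOn h₁ h₂ h hs hd₁ hd₂ hW,
    smoothOn_of_tensorSmoothOn h₁ h₂ h hs (h.isHermitianLineBundle hd) hW⟩
  herm_tmul x f₁ g₁ f₂ g₂ := herm_tensorEquiv h₁ h₂ h x f₁ g₁ f₂ g₂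
  D_tmul X₁ X₂ _ _ _ _ hU₁ hU₂ hψ₁ hψ₂ _ hx :=
    D_tensorEquiv_tmul h₁ h₂ h hs hα hd₁ hd₂ hd X₁ X₂ hU₁ hU₂ hψ₁ hψ₂ hx

end Connection

end ReducedProduct

end Prequantization

theorem mainTheorem4_general
    {E₁ : Type*} [NormedAddCommGroup E₁] [NormedSpace ℝ E₁] [FiniteDimensional ℝ E₁]
    {H₁ : Type*} [TopologicalSpace H₁] {I₁ : ModelWithCorners ℝ E₁ H₁} [I₁.Boundaryless]
    {M₁ : Type*} [TopologicalSpace M₁] [T2Space M₁] [SecondCountableTopology M₁] [ConnectedSpace M₁]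
    [ChartedSpace H₁ M₁] [IsManifold I₁ ∞ M₁]
    {E₁' : Type*} [NormedAddCommGroup E₁'] [NormedSpace ℝ E₁'] [FiniteDimensional ℝ E₁']
    {H₁' : Type*} [TopologicalSpace H₁'] {J₁ : ModelWithCorners ℝ E₁' H₁'} [J₁.Boundaryless]
    {N₁ : Type*} [TopologicalSpace N₁] [ChartedSpace H₁' N₁] [IsManifold J₁ ∞ N₁]
    {E₂ : Type*} [NormedAddCommGroup E₂] [NormedSpace ℝ E₂] [FiniteDimensional ℝ E₂]
    {H₂ : Type*} [TopologicalSpace H₂] {I₂ : ModelWithCorners ℝ E₂ H₂} [I₂.Boundaryless]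
    {M₂ : Type*} [TopologicalSpace M₂] [SecondCountableTopology M₂] [ConnectedSpace M₂]
    [ChartedSpace H₂ M₂] [IsManifold I₂ ∞ M₂]
    {E₂' : Type*} [NormedAddCommGroup E₂'] [NormedSpace ℝ E₂'] [FiniteDimensional ℝ E₂']
    {H₂' : Type*} [TopologicalSpace H₂'] {J₂ : ModelWithCorners ℝ E₂' H₂'} [J₂.Boundaryless]
    {N₂ : Type*} [TopologicalSpace N₂] [T2Space N₂] [ChartedSpace H₂' N₂] [IsManifold J₂ ∞ N₂]
    {F : Type*} [NormedAddCommGroup F] [NormedSpace ℝ F] [FiniteDimensional ℝ F]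
    {η₁ : OneForm I₁ M₁} {R₁ : VField I₁ M₁} {φ₁ : Flow ℝ M₁} {p₁ : M₁ → N₁} {Ω₁ : TwoForm J₁ N₁}
    {η₂ : OneForm I₂ M₂} {R₂ : VField I₂ M₂} {φ₂ : Flow ℝ M₂} {p₂ : M₂ → N₂} {Ω₂ : TwoForm J₂ N₂}
    {ρ : ENNReal}
    (h₁ : IsPrincipalContactification I₁ J₁ η₁ R₁ φ₁ p₁ Ω₁ ρ)
    (h₂ : IsPrincipalContactification I₂ J₂ η₂ R₂ φ₂ p₂ Ω₂ ρ)
    (hd₁ : Module.finrank ℝ E₁ = Module.finrank ℝ E₁' + 1)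
    (hd₂ : Module.finrank ℝ E₂ = Module.finrank ℝ E₂' + 1)
    (hF : Module.finrank ℝ E₁ + Module.finrank ℝ E₂ = Module.finrank ℝ F + 1) :
    T2Space (ReducedProduct φ₁ φ₂) ∧ SecondCountableTopology (ReducedProduct φ₁ φ₂) ∧
    ConnectedSpace (ReducedProduct φ₁ φ₂) ∧
    ∃ (_ : ChartedSpace F (ReducedProduct φ₁ φ₂))
      (_ : IsManifold 𝓘(ℝ, F) ∞ (ReducedProduct φ₁ φ₂)),
      IsSmoothSubmersion (I₁.prod I₂) 𝓘(ℝ, F) (ReducedProduct.mk φ₁ φ₂) ∧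
    ∃ (η : OneForm 𝓘(ℝ, F) (ReducedProduct φ₁ φ₂)) (R : VField 𝓘(ℝ, F) (ReducedProduct φ₁ φ₂))
      (φ : Flow ℝ (ReducedProduct φ₁ φ₂)) (p : ReducedProduct φ₁ φ₂ → N₁ × N₂),
      pullback₁ (I₁.prod I₂) (ReducedProduct.mk φ₁ φ₂) η = prodOneForm η₁ η₂ ∧
      (∀ y, p (ReducedProduct.mk φ₁ φ₂ y) = (p₁ y.1, p₂ y.2)) ∧
    ∃ h : IsPrincipalContactification 𝓘(ℝ, F) (J₁.prod J₂) η R φ p (prodTwoForm Ω₁ Ω₂) ρ,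
      (prequantumBundle h).IsHermitianLineBundle ∧ (prequantumBundle h).IsLinearConnection ∧
      ∃ Φ : ∀ x : N₁ × N₂,
          ((prequantumBundle h₁).Fiber x.1 ⊗[ℂ] (prequantumBundle h₂).Fiber x.2)
            ≃ₗ[ℂ] (prequantumBundle h).Fiber x,
        IsTensorProductIso (prequantumBundle h₁) (prequantumBundle h₂) (prequantumBundle h) Φ ∧
        ∀ (ψ₁ : Π x, (prequantumBundle h₁).Fiber x) (ψ₂ : Π x, (prequantumBundle h₂).Fiber x)
          (y : M₁ × M₂),
          sectionFun (φ := φ) (p := p) (ρ := ρ) (fun x ↦ Φ x (ψ₁ x.1 ⊗ₜ[ℂ] ψ₂ x.2))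
              (ReducedProduct.mk φ₁ φ₂ y)
            = sectionFun (φ := φ₁) (p := p₁) (ρ := ρ) ψ₁ y.1
              * sectionFun (φ := φ₂) (p := p₂) (ρ := ρ) ψ₂ y.2 := by
  have hd : Module.finrank ℝ F = Module.finrank ℝ (E₁' × E₂') + 1 := by
    rw [Module.finrank_prod]
    omega
  have hslice : Module.finrank ℝ (E₁ × E₂') = Module.finrank ℝ F := by
    rw [Module.finrank_prod]
    omega
  have hq := ReducedProduct.isOpenQuotientMap_mk φ₁ φ₂
  refine ⟨ReducedProduct.t2Space h₁ h₂ hd₂, hq.isQuotientMap.secondCountableTopology hq.isOpenMap,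
    inferInstance, ?_⟩
  obtain ⟨C, hC, hs⟩ := ReducedProduct.exists_isManifold h₁ h₂ hd₂
    (ContinuousLinearEquiv.ofFinrankEq hslice)
  obtain ⟨η, hη, hα⟩ := ReducedProduct.exists_oneForm h₁ h₂ hs hF
  have h := ReducedProduct.isPrincipalContactification h₁ h₂ hs hη hα hd
  exact ⟨C, hC, hs.isSmoothSubmersion, η, _, ReducedProduct.flow φ₁ φ₂,
    ReducedProduct.proj h₁ h₂, hα, ReducedProduct.proj_mk h₁ h₂, h, h.isHermitianLineBundle hd,
    h.isLinearConnection hd, ReducedProduct.tensorEquiv h₁ h₂ h,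
    ReducedProduct.isTensorProductIso h₁ h₂ h hs hα hd₁ hd₂ hd,
    ReducedProduct.sectionFun_tensorEquiv_tmul h₁ h₂ h⟩

theorem mainTheorem4 {n₁ n₂ : ℕ}
    {M₁ : Type*} [TopologicalSpace M₁] [T2Space M₁] [SecondCountableTopology M₁] [ConnectedSpace M₁]
    [ChartedSpace (EuclideanSpace ℝ (Fin (2 * n₁ + 1))) M₁] [IsManifold (𝓡 (2 * n₁ + 1)) ∞ M₁]
    {N₁ : Type*} [TopologicalSpace N₁] [T2Space N₁] [SecondCountableTopology N₁]
    [ChartedSpace (EuclideanSpace ℝ (Fin (2 * n₁))) N₁] [IsManifold (𝓡 (2 * n₁)) ∞ N₁]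
    {M₂ : Type*} [TopologicalSpace M₂] [T2Space M₂] [SecondCountableTopology M₂] [ConnectedSpace M₂]
    [ChartedSpace (EuclideanSpace ℝ (Fin (2 * n₂ + 1))) M₂] [IsManifold (𝓡 (2 * n₂ + 1)) ∞ M₂]
    {N₂ : Type*} [TopologicalSpace N₂] [T2Space N₂] [SecondCountableTopology N₂]
    [ChartedSpace (EuclideanSpace ℝ (Fin (2 * n₂))) N₂] [IsManifold (𝓡 (2 * n₂)) ∞ N₂]
    {η₁ : OneForm (𝓡 (2 * n₁ + 1)) M₁} {R₁ : VField (𝓡 (2 * n₁ + 1)) M₁} {φ₁ : Flow ℝ M₁}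
    {p₁ : M₁ → N₁} {Ω₁ : TwoForm (𝓡 (2 * n₁)) N₁}
    {η₂ : OneForm (𝓡 (2 * n₂ + 1)) M₂} {R₂ : VField (𝓡 (2 * n₂ + 1)) M₂} {φ₂ : Flow ℝ M₂}
    {p₂ : M₂ → N₂} {Ω₂ : TwoForm (𝓡 (2 * n₂)) N₂} {ρ : ENNReal}
    (h₁ : IsPrincipalContactification (𝓡 (2 * n₁ + 1)) (𝓡 (2 * n₁)) η₁ R₁ φ₁ p₁ Ω₁ ρ)
    (h₂ : IsPrincipalContactification (𝓡 (2 * n₂ + 1)) (𝓡 (2 * n₂)) η₂ R₂ φ₂ p₂ Ω₂ ρ) :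
    -- the quotient `(M₁ × M₂) / (R₁ - R₂)` is a connected smooth manifold of dimension
    -- `dim M₁ + dim M₂ - 1`, and the canonical projection onto it is a smooth submersion
    T2Space (ReducedProduct φ₁ φ₂) ∧ SecondCountableTopology (ReducedProduct φ₁ φ₂) ∧
    ConnectedSpace (ReducedProduct φ₁ φ₂) ∧
    ∃ (_ : ChartedSpace (EuclideanSpace ℝ (Fin (2 * (n₁ + n₂) + 1))) (ReducedProduct φ₁ φ₂))
      (_ : IsManifold (𝓡 (2 * (n₁ + n₂) + 1)) ∞ (ReducedProduct φ₁ φ₂)),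
      IsSmoothSubmersion ((𝓡 (2 * n₁ + 1)).prod (𝓡 (2 * n₂ + 1))) (𝓡 (2 * (n₁ + n₂) + 1))
        (ReducedProduct.mk φ₁ φ₂) ∧
    -- `η` is the reduction of `η₁ ⊕ η₂`, `p` is induced by `p₁ × p₂`
    ∃ (η : OneForm (𝓡 (2 * (n₁ + n₂) + 1)) (ReducedProduct φ₁ φ₂))
      (R : VField (𝓡 (2 * (n₁ + n₂) + 1)) (ReducedProduct φ₁ φ₂))
      (φ : Flow ℝ (ReducedProduct φ₁ φ₂)) (p : ReducedProduct φ₁ φ₂ → N₁ × N₂),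
      pullback₁ ((𝓡 (2 * n₁ + 1)).prod (𝓡 (2 * n₂ + 1))) (ReducedProduct.mk φ₁ φ₂) η
        = prodOneForm η₁ η₂ ∧
      (∀ y, p (ReducedProduct.mk φ₁ φ₂ y) = (p₁ y.1, p₂ y.2)) ∧
    -- these make the quotient a principal contactification of the product, with period `ρ`
    ∃ h : IsPrincipalContactification (𝓡 (2 * (n₁ + n₂) + 1)) ((𝓡 (2 * n₁)).prod (𝓡 (2 * n₂)))
        η R φ p (prodTwoForm Ω₁ Ω₂) ρ,
    -- its prequantum bundle is the tensor product of the two prequantum bundles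
      (prequantumBundle h).IsHermitianLineBundle ∧ (prequantumBundle h).IsLinearConnection ∧
      ∃ Φ : ∀ x : N₁ × N₂,
          ((prequantumBundle h₁).Fiber x.1 ⊗[ℂ] (prequantumBundle h₂).Fiber x.2)
            ≃ₗ[ℂ] (prequantumBundle h).Fiber x,
        IsTensorProductIso (prequantumBundle h₁) (prequantumBundle h₂) (prequantumBundle h) Φ ∧
        -- `Φ` is induced by the product of equivariant functions
        ∀ (ψ₁ : Π x, (prequantumBundle h₁).Fiber x) (ψ₂ : Π x, (prequantumBundle h₂).Fiber x)
          (y : M₁ × M₂),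
          sectionFun (φ := φ) (p := p) (ρ := ρ) (fun x ↦ Φ x (ψ₁ x.1 ⊗ₜ[ℂ] ψ₂ x.2))
              (ReducedProduct.mk φ₁ φ₂ y)
            = sectionFun (φ := φ₁) (p := p₁) (ρ := ρ) ψ₁ y.1
              * sectionFun (φ := φ₂) (p := p₂) (ρ := ρ) ψ₂ y.2 :=
  mainTheorem4_general h₁ h₂ (by simp) (by simp) (by simp; ring)
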